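/- A shared memory concurrent program (SMCP) $S=(\Sigma,M,(A_i)_{i\in[1..t]})$, $t\ge 1$, consists of a finite alphabet $\Sigma$ of operations, a nondeterministic finite automaton $M$ over $\Sigma$ (the memory) and nondeterministic finite automata $A_i$ over $\Sigma\times\{i\}$ (the threads), all with one initial and one final state. Let $m$ be the number of states of $M$. The language $L(S)$ is the set of words $u\in(\Sigma\times[1..t])^*$ such that $L(M)$ contains the word obtained from $u$ by dropping the thread indices and such that, for every $i\in[1..t]$, the projection of $u$ to $\Sigma\times\{i\}$ lies in $L(A_i)\cup\{\varepsilon\}$. The contexts of a word are its maximal non-empty infixes produced by one thread. The problem $\mathrm{BCS}_L^{RR}$ asks, given an SMCP $S$ and $cs\in\mathbb N$ (written in binary), whether $L(S)$ contains a word with exactly $cs\cdot t$ contexts in which the threads take turns in the cyclic order $1,2,\dots,t,1,2,\dots,t,\dots$, starting with thread $1$ and ending with thread $t$, so that every thread has exactly $cs$ contexts. The scheduling graph $G(u)$ of a word $u$ is the directed multigraph whose nodes are the threads that occur in $u$, with $E(i,j)$, for $i\neq j$, the number of context switches from thread $i$ to thread $j$ in $u$, and $E(i,i)=0$. Let $C_{t,cs}$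 be the cycle on $[1..t]$ with an edge of weight $cs$ from $i$ to $i+1$ for $1\le i<t$ and an edge of weight $cs-1$ from $t$ to $1$. Contracting two distinct nodes $n_1,n_2$ of a graph into a fresh node $n$ adds up their edges from and to every other node; the edges between $n_1$ and $n_2$ disappear. A contraction process of a graph $G=(V,E)$ is a sequence $G_1=G,\dots,G_{|V|}$ in which each graph arises from the previous one by such a contraction and the last one has a single node. Its degree is the maximum, over all its graphs and their nodes, of the larger of indegree and outdegree. **Proposition.** (1) $\mathrm{BCS}_L^{RR}$ can be solved in time $O^*(m^{4cs})$: there are one deterministic algorithm (a random access machine with addition and subtraction, under logarithmic cost) and one polynomial $p$ such that for every instance $x=(S,cs)$ the algorithm correctly decides $x$ in time at most $m^{4cs}\cdot p(|x|)$, where $|x|$ is the length of the encoding of $x$. (2) For $cs\ge 1$, the instance $(S,cs)$ of $\mathrm{BCS}_L^{RR}$ is the instance of bounded context switching with fixed scheduling graph $C_{t,cs}$: it is a yes-instance if and only if there is a word $u\in L(S)$ with $G(u)=C_{t,cs}$. (3) For $t\ge 2$ and $cs\ge 1$, the graph $C_{t,cs}$ has a contraction process of degree $cs$. -/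

import Mathlib

namespace BCS

/-! ### Random access machine with logarithmic cost

A machine has registers and a memory, both indexed by `ℕ` and holding natural numbers. A program
mentions finitely many registers; the memory is addressed through registers. -/

structure State where
  reg : ℕ → ℕ
  mem : ℕ → ℕ

/-- Programs of the random access machine, in structured form. -/
inductive Prog where
  /-- `x := c` -/
  | const (x c : ℕ)
  /-- `x := y` -/
  | copy (x y : ℕ)
  /-- `x := y + z` -/
  | add (x y z : ℕ)
  /-- `x := y - z` (truncated) -/
  | sub (x y z : ℕ)
  /-- `x := mem[y]` -/
  | load (x y : ℕ)
  /-- `mem[x] := y` -/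
  | store (x y : ℕ)
  | seq (p q : Prog)
  /-- `if x ≠ 0 then p else q` -/
  | ite (x : ℕ) (p q : Prog)
  /-- `while x ≠ 0 do p` -/
  | loop (x : ℕ) (p : Prog)

def State.setReg (s : State) (x v : ℕ) : State := { s with reg := Function.update s.reg x v }

def State.setMem (s : State) (a v : ℕ) : State := { s with mem := Function.update s.mem a v }

/-- `Exec p s s' k`: program `p` started in state `s` halts in state `s'` after time `k`. Every
elementary instruction and every test costs `1` plus the bit lengths of all numbers and
addresses that it reads. -/
inductive Exec : Prog → State → State → ℕ → Prop where
  | const (s : State) (x c : ℕ) :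
      Exec (.const x c) s (s.setReg x c) (1 + Nat.size c)
  | copy (s : State) (x y : ℕ) :
      Exec (.copy x y) s (s.setReg x (s.reg y)) (1 + Nat.size (s.reg y))
  | add (s : State) (x y z : ℕ) :
      Exec (.add x y z) s (s.setReg x (s.reg y + s.reg z))
        (1 + Nat.size (s.reg y) + Nat.size (s.reg z))
  | sub (s : State) (x y z : ℕ) :
      Exec (.sub x y z) s (s.setReg x (s.reg y - s.reg z))
        (1 + Nat.size (s.reg y) + Nat.size (s.reg z))
  | load (s : State) (x y : ℕ) :
      Exec (.load x y) s (s.setReg x (s.mem (s.reg y)))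
        (1 + Nat.size (s.reg y) + Nat.size (s.mem (s.reg y)))
  | store (s : State) (x y : ℕ) :
      Exec (.store x y) s (s.setMem (s.reg x) (s.reg y))
        (1 + Nat.size (s.reg x) + Nat.size (s.reg y))
  | seq {p q : Prog} {s s' s'' : State} {k l : ℕ} :
      Exec p s s' k → Exec q s' s'' l → Exec (.seq p q) s s'' (k + l)
  | ite_true {x : ℕ} {p q : Prog} {s s' : State} {k : ℕ} :
      s.reg x ≠ 0 → Exec p s s' k → Exec (.ite x p q) s s' (1 + Nat.size (s.reg x) + k)
  | ite_false {x : ℕ} {p q : Prog} {s s' : State} {k : ℕ} :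
      s.reg x = 0 → Exec q s s' k → Exec (.ite x p q) s s' (1 + Nat.size (s.reg x) + k)
  | loop_done {x : ℕ} {p : Prog} {s : State} :
      s.reg x = 0 → Exec (.loop x p) s s (1 + Nat.size (s.reg x))
  | loop_step {x : ℕ} {p : Prog} {s s' s'' : State} {k l : ℕ} :
      s.reg x ≠ 0 → Exec p s s' k → Exec (.loop x p) s' s'' l →
        Exec (.loop x p) s s'' (1 + Nat.size (s.reg x) + k + l)

/-- Initial state on input `w`: the input is in the memory cells `0, 1, …`, its length in
register `0`, and everything else is `0`. -/
def initState (w : List ℕ) : State where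
  reg := fun x => if x = 0 then w.length else 0
  mem := fun a => w.getD a 0

/-- On input `w` the program halts within time `T`, and it accepts (register `0` is nonzero in the
end) if and only if `b` holds. -/
def DecidesWithin (p : Prog) (w : List ℕ) (b : Prop) (T : ℕ) : Prop :=
  ∃ s k, Exec p (initState w) s k ∧ k ≤ T ∧ (s.reg 0 ≠ 0 ↔ b)

/-- The length of an input: numbers are written in binary, with one separator each. -/
def inputSize (w : List ℕ) : ℕ := (w.map fun a => Nat.size a + 1).sum

/-! ### Shared memory concurrent programs -/

/-- Nondeterministic finite automata with one initial and one final state, over the alphabet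
`Fin s`, with state set `Fin n`. -/
structure Aut (s : ℕ) where
  n : ℕ
  init : Fin n
  final : Fin n
  δ : Fin n → Fin s → Fin n → Bool

def Aut.toNFA {s : ℕ} (A : Aut s) : NFA (Fin s) (Fin A.n) where
  step q a := {q' | A.δ q a q' = true}
  start := {A.init}
  accept := {A.final}

/-- Number of states, indicator list of the initial state, indicator list of the final state,
table of the transition relation. -/
def Aut.encode {s : ℕ} (A : Aut s) : List ℕ :=
  [A.n]
    ++ List.ofFn (fun q : Fin A.n => if q = A.init then 1 else 0)
    ++ List.ofFn (fun q : Fin A.n => if q = A.final then 1 else 0)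
    ++ (List.ofFn fun q : Fin A.n => (List.ofFn fun a : Fin s =>
          List.ofFn fun q' : Fin A.n => if A.δ q a q' = true then 1 else 0).flatten).flatten

/-- Shared memory concurrent programs: operations `Fin ops`, threads `Fin t` with `1 ≤ t`, memory
automaton `M`, thread automata `A i`. The automaton `A i` is over `Fin ops × {i}`; the constant
second component is added in `threadLang`. -/
structure SMCP where
  ops : ℕ
  t : ℕ
  t_pos : 1 ≤ t
  M : Aut ops
  A : Fin t → Aut ops

/-- The language of thread `i`, over the alphabet `Fin ops × {i}`. -/
def SMCP.threadLang (S : SMCP) (i : Fin S.t) : Language (Fin S.ops × Fin S.t) :=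
  {w | (∀ a ∈ w, a.2 = i) ∧ w.map Prod.fst ∈ (S.A i).toNFA.accepts}

/-- Shuffle of languages over the disjoint alphabets `α × {i}`. -/
def shuffle {α : Type} {t : ℕ} (L : Fin t → Language (α × Fin t)) : Language (α × Fin t) :=
  {u | ∀ i, u.filter (fun a => a.2 = i) ∈ L i ∨ u.filter (fun a => a.2 = i) = []}

def SMCP.lang (S : SMCP) : Language (Fin S.ops × Fin S.t) :=
  {u | u.map Prod.fst ∈ S.M.toNFA.accepts ∧ u ∈ shuffle S.threadLang}

/-! ### Round robin -/

/-- `c 0, …, c (k-1)` are the contexts of `u`, that is, its maximal infixes produced by one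
thread, and `φ` names the thread of each context. -/
structure IsContextDecomposition {α : Type} {t k : ℕ} (u : List (α × Fin t))
    (c : Fin k → List (α × Fin t)) (φ : Fin k → Fin t) : Prop where
  eq_flatten : u = (List.ofFn c).flatten
  nonempty : ∀ i, c i ≠ []
  thread : ∀ i, ∀ a ∈ c i, a.2 = φ i
  switch : ∀ i j : Fin k, (i : ℕ) + 1 = j → φ i ≠ φ j

/-- The words with `cs` rounds: there are `cs * t` contexts, and the threads take turns in the order
`0, …, t-1, 0, …, t-1, …`, ending with thread `t-1`. -/
def roundRobin (α : Type) (t cs : ℕ) : Language (α × Fin t) :=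
  {u | ∃ (c : Fin (cs * t) → List (α × Fin t)) (φ : Fin (cs * t) → Fin t),
    IsContextDecomposition u c φ ∧ ∀ i, (φ i : ℕ) = (i : ℕ) % t}

/-- Bounded context switching under round robin. -/
def BCSLRR (S : SMCP) (cs : ℕ) : Prop :=
  ∃ u, u ∈ S.lang ∧ u ∈ roundRobin (Fin S.ops) S.t cs

/-- An instance `(S, cs)` as a list of numbers. -/
def encodeInstance (S : SMCP) (cs : ℕ) : List ℕ :=
  [S.ops, S.t, cs] ++ S.M.encode ++ (List.ofFn fun i => (S.A i).encode).flatten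

/-! ### Scheduling graphs and contraction -/

/-- Directed multigraphs with nodes in `ℕ`; `E i j` is the number of edges from `i` to `j`. -/
@[ext]
structure MGraph where
  V : Finset ℕ
  E : ℕ → ℕ → ℕ
  supp : ∀ i j, E i j ≠ 0 → i ∈ V ∧ j ∈ V

namespace MGraph

def outdeg (G : MGraph) (v : ℕ) : ℕ := ∑ w ∈ G.V, G.E v w

def indeg (G : MGraph) (v : ℕ) : ℕ := ∑ w ∈ G.V, G.E w v

def nodeDegree (G : MGraph) (v : ℕ) : ℕ := max (G.indeg v) (G.outdeg v)

def degree (G : MGraph) : ℕ := G.V.sup G.nodeDegree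

/-- Node set after contracting `a` and `b` into `n`. -/
def contractV (G : MGraph) (a b n : ℕ) : Finset ℕ := insert n (G.V \ {a, b})

/-- Contraction of the nodes `a` and `b` into `n`: incoming and outgoing edges are added up, the
edges between `a` and `b` disappear. -/
def contract (G : MGraph) (a b n : ℕ) : MGraph where
  V := G.contractV a b n
  E i j :=
    if i ∈ G.contractV a b n ∧ j ∈ G.contractV a b n then
      if i = n then (if j = n then 0 else G.E a j + G.E b j)
      else if j = n then G.E i a + G.E i b
      else G.E i j
    else 0
  supp i j h := by
    by_contra hc
    exact h (if_neg hc)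

/-- `H` arises from `G` by contracting two nodes into a fresh one. -/
def ContractsTo (G H : MGraph) : Prop :=
  ∃ a ∈ G.V, ∃ b ∈ G.V, a ≠ b ∧ ∃ n, n ∉ G.V ∧ H = G.contract a b n

/-- Contraction processes: they start in `G`, each graph arises from the previous one by a
contraction, and the last graph has a single node. -/
structure IsContraction (G : MGraph) (π : List MGraph) : Prop where
  length : π.length = G.V.card
  head : π.head? = some G
  chain : π.IsChain ContractsTo
  last : ∃ H, π.getLast? = some H ∧ H.V.card = 1

/-- The maximal degree of the graphs in a list. -/
def listDegree (π : List MGraph) : ℕ := (π.map degree).foldr max 0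

/-- The cycle through `0, …, t-1` whose edges `i → i+1` have weight `cs` and whose closing edge
`t-1 → 0` has weight `cs - 1`. -/
def cycle (t cs : ℕ) : MGraph where
  V := Finset.range t
  E i j := if i + 1 = j ∧ j < t then cs else if i + 1 = t ∧ j = 0 then cs - 1 else 0
  supp i j h := by
    simp only [Finset.mem_range]
    split_ifs at h <;> omega

end MGraph

/-- The scheduling graph of a word: its nodes are the participating threads, and `E i j` is the number of
context switches from `i` to `j`. -/
def schedulingGraph {α : Type} {t : ℕ} (u : List (α × Fin t)) : MGraph where
  V := (u.map fun a => (a.2 : ℕ)).toFinset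
  E i j := if i = j then 0 else
    (u.zip u.tail).countP fun p => (p.1.2 : ℕ) = i ∧ (p.2.2 : ℕ) = j
  supp i j h := by
    have h' := (ite_ne_left_iff.mp (Ne.symm (Ne.symm h))).2
    obtain ⟨⟨a, b⟩, hp, hq⟩ := List.countP_pos_iff.mp (Nat.pos_of_ne_zero (Ne.symm h'))
    simp only [decide_eq_true_eq] at hq
    simp only [List.mem_toFinset, List.mem_map]
    exact ⟨⟨a, (List.of_mem_zip hp).1, hq.1⟩,
      ⟨b, List.mem_of_mem_tail (List.of_mem_zip hp).2, hq.2⟩⟩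

/-- The problem with a fixed scheduling graph `G`. -/
def BCSLFix (S : SMCP) (G : MGraph) : Prop :=
  ∃ u, u ∈ S.lang ∧ schedulingGraph u = G

end BCS

/-! Claim (1). Let `c` be the number of rounds, `c ≥ 1`. Whether a word with `c` rounds exists
depends only on the states at the context boundaries: the memory state `st j r` before the context
of thread `j` in round `r`, and the state `th j r` of thread `j` before that round. Such a table is
a certificate (`Sys.IsCert`) if every context can be filled with a nonempty word read jointly by
memory and thread; `SMCP.bcslRR_iff` turns the problem into the existence of a certificate.

Certificates are sought thread by thread, each thread running through all its rounds, instead of in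
the order of time. A number `p` in base `m` guesses the memory states in which the rounds begin. A
second number `v` with `c` digits acts as a queue: its lowest digit is the current memory state;
when a context ends, this digit is removed and the new state enters at the top. After its last round
a thread leaves in `v` exactly the states in which the next thread begins its contexts. After the
last thread, `v` must be `p` shifted by one round, with a final state as the top digit. Thus the
pair of `p` and `v` is the interface of the threads merged so far. Correctness is
`Sys.IsCert.reachable` and `Sys.Reachable.exists_cert`.

For fixed `p` there are `N = (t+1)·c·m^c·len` nodes. The program makes `N` sweeps over all `p`,
nodes and choices of a step, and marks the successors of marked nodes. This amounts to `m^(3c)`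
iterations, up to a factor polynomial in `len` and `c`. Since `cs` is written in binary, a power of
`c` need not be polynomial in the input length. If `m ≥ 2`, the fourth factor `m^c` absorbs it
(`effectiveRounds_pow_le`). If `m = 1`, nothing can absorb it, but then the threads do not influence
each other, and pumping (`chain_length`) allows `cs` to be replaced by `min cs len`. Zero rounds,
and one thread with several rounds, are decided separately. The machine has neither multiplication
nor division; both come from one routine of repeated doubling and subtraction, and compiled
expressions cost time cubic in the bit lengths (`Expr.compile_spec`).

Claim (2). In a word with scheduling graph `C_{t,cs}` every switch leads from a thread to its cyclic
successor, so only the first thread and the number of contexts are open. The edge of weight `cs - 1`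
determines both (`Contexts.eq_of_schedulingGraph`).

Claim (3). Merging the last two nodes of such a cycle gives the same kind of cycle with one node
fewer (`IsCycle.contract`), and all these cycles with at least two nodes have degree `cs`. -/

namespace BCS

/-! ### Execution within a time bound -/

/-- `p` started in `s` halts in `s'` within time `T`. -/
def Run (p : Prog) (s s' : State) (T : ℕ) : Prop := ∃ k ≤ T, Exec p s s' k

namespace Run

variable {p q : Prog} {s s' s'' : State} {T T' V x y z : ℕ}

theorem mono (h : Run p s s' T) (hT : T ≤ T') : Run p s s' T' :=
  let ⟨k, hk, he⟩ := h
  ⟨k, hk.trans hT, he⟩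

theorem const {c : ℕ} (hc : Nat.size c ≤ V) : Run (.const x c) s (s.setReg x c) (1 + 2 * V) :=
  ⟨_, by omega, .const s x c⟩

theorem copy (hy : Nat.size (s.reg y) ≤ V) :
    Run (.copy x y) s (s.setReg x (s.reg y)) (1 + 2 * V) :=
  ⟨_, by omega, .copy s x y⟩

theorem add (hy : Nat.size (s.reg y) ≤ V) (hz : Nat.size (s.reg z) ≤ V) :
    Run (.add x y z) s (s.setReg x (s.reg y + s.reg z)) (1 + 2 * V) :=
  ⟨_, by omega, .add s x y z⟩

theorem sub (hy : Nat.size (s.reg y) ≤ V) (hz : Nat.size (s.reg z) ≤ V) :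
    Run (.sub x y z) s (s.setReg x (s.reg y - s.reg z)) (1 + 2 * V) :=
  ⟨_, by omega, .sub s x y z⟩

theorem load (hy : Nat.size (s.reg y) ≤ V) (hz : Nat.size (s.mem (s.reg y)) ≤ V) :
    Run (.load x y) s (s.setReg x (s.mem (s.reg y))) (1 + 2 * V) :=
  ⟨_, by omega, .load s x y⟩

theorem store (hx : Nat.size (s.reg x) ≤ V) (hy : Nat.size (s.reg y) ≤ V) :
    Run (.store x y) s (s.setMem (s.reg x) (s.reg y)) (1 + 2 * V) :=
  ⟨_, by omega, .store s x y⟩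

theorem seq (hp : Run p s s' T) (hq : Run q s' s'' T') : Run (.seq p q) s s'' (T + T') :=
  let ⟨_, hk, he⟩ := hp
  let ⟨_, hl, hf⟩ := hq
  ⟨_, by omega, .seq he hf⟩

theorem ite_true (hx : s.reg x ≠ 0) (hV : Nat.size (s.reg x) ≤ V) (hp : Run p s s' T) :
    Run (.ite x p q) s s' (1 + 2 * V + T) :=
  let ⟨_, hk, he⟩ := hp
  ⟨_, by omega, .ite_true hx he⟩

theorem ite_false (hx : s.reg x = 0) (hq : Run q s s' T) :
    Run (.ite x p q) s s' (1 + 2 * V + T) :=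
  let ⟨_, hk, he⟩ := hq
  ⟨1 + Nat.size (s.reg x) + _, by rw [hx, Nat.size_zero]; omega, .ite_false hx he⟩

theorem loop_done (hx : s.reg x = 0) : Run (.loop x p) s s (1 + 2 * V) :=
  ⟨1 + Nat.size (s.reg x), by rw [hx, Nat.size_zero]; omega, .loop_done hx⟩

theorem loop_step (hx : s.reg x ≠ 0) (hV : Nat.size (s.reg x) ≤ V) (hp : Run p s s' T)
    (hl : Run (.loop x p) s' s'' T') : Run (.loop x p) s s'' (1 + 2 * V + T + T') :=
  let ⟨_, hk, he⟩ := hp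
  let ⟨_, hl, hf⟩ := hl
  ⟨_, by omega, .loop_step hx he hf⟩

end Run

@[simp] theorem State.setReg_reg (s : State) (x v y : ℕ) :
    (s.setReg x v).reg y = if y = x then v else s.reg y := by
  simp [State.setReg, Function.update_apply]

@[simp] theorem State.setReg_mem (s : State) (x v : ℕ) : (s.setReg x v).mem = s.mem := rfl

@[simp] theorem State.setMem_reg (s : State) (a v : ℕ) : (s.setMem a v).reg = s.reg := rfl

@[simp] theorem State.setMem_mem (s : State) (a v b : ℕ) :
    (s.setMem a v).mem b = if b = a then v else s.mem b := by
  simp [State.setMem, Function.update_apply]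

/-! ### Division with remainder and multiplication -/

/-- `s` and `s'` differ at most in the registers `6, …, 15`. -/
def Frame (s s' : State) : Prop := s'.mem = s.mem ∧ ∀ x, (x < 6 ∨ 16 ≤ x) → s'.reg x = s.reg x

theorem Frame.trans {s s' s'' : State} (h : Frame s s') (h' : Frame s' s'') : Frame s s'' :=
  ⟨h'.1.trans h.1, fun x hx => (h'.2 x hx).trans (h.2 x hx)⟩

theorem Frame.refl (s : State) : Frame s s := ⟨rfl, fun _ _ => rfl⟩

theorem Frame.setReg {s s' : State} (h : Frame s s') {x v : ℕ} (h1 : 6 ≤ x) (h2 : x < 16) :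
    Frame s (s'.setReg x v) :=
  ⟨h.1, fun y hy => by rw [State.setReg_reg, if_neg (by omega)]; exact h.2 y hy⟩

/-- Doubles register `10` and `11` as long as register `10` stays below register `14`. -/
def doubling : Prog :=
  .loop 13 (.seq (.copy 10 12) (.seq (.add 11 11 11) (.seq (.add 12 10 10) (.sub 13 14 12))))

/-- One round of long division: the multiple `y * e` found by doubling is taken off register `6`,
and `z * e` is added to register `9`. Register `14` holds `x + 1`, so that a truncated difference `x
+ 1 - u` is nonzero exactly when `u ≤ x`. -/
def divStep : Prog :=
  .seq (.copy 10 7) <| .seq (.copy 11 8) <| .seq (.add 12 10 10) <| .seq (.sub 13 14 12) <|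
  .seq doubling <| .seq (.sub 6 6 10) <| .seq (.add 9 9 11) <| .seq (.const 14 1) <|
  .seq (.add 14 6 14) (.sub 15 14 7)

/-- With `x, y, z` in the registers `6, 7, 8`: register `6` becomes `x % y` and register `9`
becomes `z * (x / y)`. -/
def divMul : Prog :=
  .seq (.const 9 0) <| .seq (.const 14 1) <| .seq (.add 14 6 14) <| .seq (.sub 15 14 7) <|
  .ite 7 (.loop 15 divStep) (.const 9 0)

theorem size_le_of_le {a N V : ℕ} (h : a ≤ N) (hN : N < 2 ^ V) : Nat.size a ≤ V :=
  Nat.size_le.2 (h.trans_lt hN)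

/-- The multiplier `e` doubles as long as `2 * (y * e) ≤ x`, and `x < 2 ^ n * (y * e)` bounds the
number of doublings. What matters on exit is `y * e ≤ x < 2 * (y * e)`: subtracting `y * e` then
more than halves `x`. The hypothesis `hV` keeps every number that is read within `V` bits. -/
theorem doubling_run {x y z V : ℕ} (hy : 1 ≤ y) (hV : 2 * (x + 1) * (z + 1) < 2 ^ V) :
    ∀ (n e : ℕ) (s : State), 1 ≤ e → y * e ≤ x → x < 2 ^ n * (y * e) → s.reg 14 = x + 1 →
      s.reg 10 = y * e → s.reg 11 = z * e → s.reg 12 = 2 * (y * e) →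
      s.reg 13 = x + 1 - 2 * (y * e) →
      ∃ s' e', Run doubling s s' ((n + 1) * (5 * (1 + 2 * V))) ∧ Frame s s' ∧ 1 ≤ e' ∧
        y * e' ≤ x ∧ x < 2 * (y * e') ∧ s'.reg 6 = s.reg 6 ∧ s'.reg 7 = s.reg 7 ∧
        s'.reg 8 = s.reg 8 ∧ s'.reg 9 = s.reg 9 ∧ s'.reg 10 = y * e' ∧ s'.reg 11 = z * e' := by
  intro n
  induction n with
  | zero => intro e s _ h1 h2; simp at h2; omega
  | succ n ih =>
    intro e s he h1 h2 h14 h10 h11 h12 h13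
    by_cases h : x + 1 - 2 * (y * e) = 0
    · refine ⟨s, e, (Run.loop_done (V := V) (by omega)).mono ?_, Frame.refl s, he, h1, by omega,
        rfl, rfl, rfl, rfl, h10, h11⟩
      nlinarith
    · have hle : 2 * (y * e) ≤ x := by omega
      have hb1 : 2 * (x + 1) ≤ 2 * (x + 1) * (z + 1) := Nat.le_mul_of_pos_right _ (by omega)
      have hex : e ≤ x := (Nat.le_mul_of_pos_left e hy).trans h1
      have hb2 : z * e ≤ 2 * (x + 1) * (z + 1) := by nlinarith
      set s1 := (((s.setReg 10 (2 * (y * e))).setReg 11 (z * e + z * e)).setReg 12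
        (2 * (y * e) + 2 * (y * e))).setReg 13 (x + 1 - (2 * (y * e) + 2 * (y * e))) with hs1
      obtain ⟨s', e', hr, hf, a1, a2, a3, a4, a5, a6, a7, a8, a9⟩ := ih (2 * e) s1 (by omega)
        (by linarith) (by rw [pow_succ] at h2; linarith) (by simp [hs1, h14])
        (by simp [hs1]; ring) (by simp [hs1]; ring) (by simp [hs1]; ring)
        (by simp [hs1]; congr 1; ring)
      refine ⟨s', e', ?_, Frame.trans ?_ hf, a1, a2, a3, ?_, ?_, ?_, ?_, a8, a9⟩
      · have hbody : Run (.seq (.copy 10 12) (.seq (.add 11 11 11)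
            (.seq (.add 12 10 10) (.sub 13 14 12)))) s s1 (4 * (1 + 2 * V)) := by
          have e1 := Run.copy (x := 10) (y := 12) (s := s) (V := V)
            (size_le_of_le (by rw [h12]; omega) hV)
          rw [h12] at e1
          have e2 := Run.add (x := 11) (y := 11) (z := 11) (s := s.setReg 10 (2 * (y * e)))
            (V := V) (size_le_of_le (by simp [h11]; omega) hV)
            (size_le_of_le (by simp [h11]; omega) hV)
          have e3 := Run.add (x := 12) (y := 10) (z := 10)
            (s := (s.setReg 10 (2 * (y * e))).setReg 11 (z * e + z * e)) (V := V)
            (size_le_of_le (by simp; omega) hV) (size_le_of_le (by simp; omega) hV)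
          have e4 := Run.sub (x := 13) (y := 14) (z := 12)
            (s := ((s.setReg 10 (2 * (y * e))).setReg 11 (z * e + z * e)).setReg 12
              (2 * (y * e) + 2 * (y * e))) (V := V)
            (size_le_of_le (by simp [h14]; omega) hV) (size_le_of_le (by simp; omega) hV)
          simp [h11] at e2
          simp at e3
          simp [h14] at e4
          exact (e1.seq (e2.seq (e3.seq e4))).mono (by omega)
        refine (Run.loop_step (V := V) (by omega) (size_le_of_le (by rw [h13]; omega) hV)
          hbody hr).mono ?_
        have : (n + 1 + 1) * (5 * (1 + 2 * V)) = (n + 1) * (5 * (1 + 2 * V)) +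
          5 * (1 + 2 * V) := by ring
        omega
      · exact (((((Frame.refl s).setReg (by omega) (by omega)).setReg (by omega)
          (by omega)).setReg (by omega) (by omega)).setReg (by omega) (by omega))
      · simpa [hs1] using a4
      · simpa [hs1] using a5
      · simpa [hs1] using a6
      · simpa [hs1] using a7

theorem divStep_run {x y z acc V : ℕ} (hy : 1 ≤ y) (hV : 2 * (x + 1) * (z + 1) + y < 2 ^ V)
    (hacc : acc + z * (x / y) < 2 ^ V) (hlt : y ≤ x) (s : State) (h6 : s.reg 6 = x)
    (h7 : s.reg 7 = y) (h8 : s.reg 8 = z) (h9 : s.reg 9 = acc) (h14 : s.reg 14 = x + 1) :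
    ∃ s' e, Run divStep s s' ((5 * V + 14) * (1 + 2 * V)) ∧ Frame s s' ∧ y * e ≤ x ∧
      x < 2 * (y * e) ∧ s'.reg 6 = x - y * e ∧ s'.reg 7 = y ∧ s'.reg 8 = z ∧
      s'.reg 9 = acc + z * e ∧ s'.reg 14 = x - y * e + 1 ∧ s'.reg 15 = x - y * e + 1 - y := by
  have hb1 : 2 * (x + 1) ≤ 2 * (x + 1) * (z + 1) := Nat.le_mul_of_pos_right _ (by omega)
  have hb2 : z + 1 ≤ 2 * (x + 1) * (z + 1) := Nat.le_mul_of_pos_left _ (by omega)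
  obtain ⟨s1, hs1⟩ : ∃ s1, s1 = (((s.setReg 10 y).setReg 11 z).setReg 12 (y + y)).setReg 13
    (x + 1 - (y + y)) := ⟨_, rfl⟩
  have hf1 : Frame s s1 := by
    rw [hs1]
    exact (((((Frame.refl s).setReg (by omega) (by omega)).setReg (by omega)
      (by omega)).setReg (by omega) (by omega)).setReg (by omega) (by omega))
  have hr1 : Run (.seq (.copy 10 7) <| .seq (.copy 11 8) <| .seq (.add 12 10 10)
      (.sub 13 14 12)) s s1 (4 * (1 + 2 * V)) := by
    have e1 := Run.copy (x := 10) (y := 7) (s := s) (V := V)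
      (size_le_of_le (by rw [h7]; omega) hV)
    rw [h7] at e1
    have e2 := Run.copy (x := 11) (y := 8) (s := s.setReg 10 y) (V := V)
      (size_le_of_le (by simp [h8]; omega) hV)
    simp only [State.setReg_reg, Nat.reduceEqDiff, if_false, h8] at e2
    have e3 := Run.add (x := 12) (y := 10) (z := 10) (s := (s.setReg 10 y).setReg 11 z)
      (V := V) (size_le_of_le (N := y) (by simp) (by omega)) (size_le_of_le (N := y) (by simp) (by omega))
    simp only [State.setReg_reg, Nat.reduceEqDiff, if_false, if_true] at e3
    have e4 := Run.sub (x := 13) (y := 14) (z := 12)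
      (s := ((s.setReg 10 y).setReg 11 z).setReg 12 (y + y))
      (V := V) (size_le_of_le (by simp [h14]; omega) hV)
      (size_le_of_le (by simp; omega) hV)
    simp only [State.setReg_reg, Nat.reduceEqDiff, if_false, if_true, h14] at e4
    rw [hs1]
    exact (e1.seq (e2.seq (e3.seq e4))).mono (by omega)
  have hxsz : x < 2 ^ Nat.size x := Nat.lt_size_self x
  obtain ⟨s2, e, hr, hf, he, a2, a3, a4, a5, a6, a7, a8, a9⟩ :=
    doubling_run hy (show 2 * (x + 1) * (z + 1) < 2 ^ V by omega) (Nat.size x) 1 s1 le_rfl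
      (by omega) (hxsz.trans_le (Nat.le_mul_of_pos_right _ (by omega)))
      (by simp [hs1, h14]) (by simp [hs1]) (by simp [hs1])
      (by simp [hs1]; ring) (by simp [hs1]; congr 1; ring)
  have a4' : s2.reg 6 = x := by rw [a4]; simpa [hs1] using h6
  have a5' : s2.reg 7 = y := by rw [a5]; simpa [hs1] using h7
  have a6' : s2.reg 8 = z := by rw [a6]; simpa [hs1] using h8
  have a7' : s2.reg 9 = acc := by rw [a7]; simpa [hs1] using h9
  clear a4 a5 a6 a7 hs1
  have hze : z * e ≤ z * (x / y) :=
    Nat.mul_le_mul le_rfl ((Nat.le_div_iff_mul_le hy).2 (by rw [mul_comm]; exact a2))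
  obtain ⟨s3, hs3⟩ : ∃ s3, s3 = ((((s2.setReg 6 (x - y * e)).setReg 9 (acc + z * e)).setReg
    14 1).setReg 14 (x - y * e + 1)).setReg 15 (x - y * e + 1 - y) := ⟨_, rfl⟩
  have hf3 : Frame s2 s3 := by
    rw [hs3]
    exact (((((Frame.refl s2).setReg (by omega) (by omega)).setReg (by omega)
      (by omega)).setReg (by omega) (by omega)).setReg (by omega) (by omega)).setReg
      (by omega) (by omega)
  have hr3 : Run (.seq (.sub 6 6 10) <| .seq (.add 9 9 11) <| .seq (.const 14 1) <|
      .seq (.add 14 6 14) (.sub 15 14 7)) s2 s3 (5 * (1 + 2 * V)) := by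
    have e6 := Run.sub (x := 6) (y := 6) (z := 10) (s := s2)
      (V := V) (size_le_of_le (by rw [a4']; omega) hV)
      (size_le_of_le (by rw [a8]; omega) hV)
    rw [a4', a8] at e6
    have e7 := Run.add (x := 9) (y := 9) (z := 11) (s := s2.setReg 6 (x - y * e))
      (V := V) (size_le_of_le (by simp [a7']) hacc)
      (size_le_of_le (by simp [a9]; omega) hacc)
    simp only [State.setReg_reg, Nat.reduceEqDiff, if_false, a7', a9] at e7
    have e8 := Run.const (x := 14) (c := 1)
      (s := (s2.setReg 6 (x - y * e)).setReg 9 (acc + z * e)) (V := V)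
      (size_le_of_le (by omega) hV)
    have e9 := Run.add (x := 14) (y := 6) (z := 14)
      (s := ((s2.setReg 6 (x - y * e)).setReg 9 (acc + z * e)).setReg 14 1) (V := V)
      (size_le_of_le (by simp; omega) hV) (size_le_of_le (by simp; omega) hV)
    simp only [State.setReg_reg, Nat.reduceEqDiff, if_false, if_true] at e9
    have e10 := Run.sub (x := 15) (y := 14) (z := 7)
      (s := (((s2.setReg 6 (x - y * e)).setReg 9 (acc + z * e)).setReg 14 1).setReg 14
        (x - y * e + 1)) (V := V)
      (size_le_of_le (by simp; omega) hV) (size_le_of_le (by simp [a5']) hV)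
    simp only [State.setReg_reg, Nat.reduceEqDiff, if_false, if_true, a5'] at e10
    rw [hs3]
    exact (e6.seq (e7.seq (e8.seq (e9.seq e10)))).mono (by omega)
  refine ⟨s3, e, ?_, (hf1.trans hf).trans hf3, a2, a3, ?_, ?_, ?_, ?_, ?_, ?_⟩
  · obtain ⟨_, hk1, h1⟩ := hr1
    obtain ⟨_, hk2, h2⟩ := hr
    obtain ⟨_, hk3, h3⟩ := hr3
    -- The first four instructions were run as a block of their own; the derivation is taken apart
    -- in order to bracket it as in `divStep`.
    cases h1 with | seq h11 h1 => cases h1 with | seq h12 h1 => cases h1 with | seq h13 h14 =>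
    refine ⟨_, ?_, .seq h11 (.seq h12 (.seq h13 (.seq h14 (.seq h2 h3))))⟩
    have hsz : Nat.size x ≤ V := size_le_of_le (by omega) hV
    have : (Nat.size x + 1) * (5 * (1 + 2 * V)) ≤ (V + 1) * (5 * (1 + 2 * V)) := by gcongr
    calc _ ≤ 9 * (1 + 2 * V) + (V + 1) * (5 * (1 + 2 * V)) := by omega
      _ = _ := by ring
  all_goals simp [hs3, a5', a6']

/-- Each pass more than halves register `6`, so `x < 2 ^ n` bounds the number of passes. The bound
on `acc` by `z * x₀` is stable under the passes and lets one `V` serve for all of them. -/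
theorem divLoop_run {x₀ y z V : ℕ} (hy : 1 ≤ y) (hV : 2 * (x₀ + 1) * (z + 1) + y < 2 ^ V) :
    ∀ (n x acc : ℕ) (s : State), x ≤ x₀ → x < 2 ^ n → acc + z * (x / y) ≤ z * x₀ →
      s.reg 6 = x → s.reg 7 = y → s.reg 8 = z → s.reg 9 = acc → s.reg 14 = x + 1 →
      s.reg 15 = x + 1 - y →
      ∃ s', Run (.loop 15 divStep) s s' ((n + 1) * ((5 * V + 15) * (1 + 2 * V))) ∧ Frame s s' ∧
        s'.reg 6 = x % y ∧ s'.reg 9 = acc + z * (x / y) := by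
  intro n
  induction n with
  | zero =>
    intro x acc s _ hx0 _ h6 h7 h8 h9 h14 h15
    have : x = 0 := by simpa using hx0
    subst this
    refine ⟨s, (Run.loop_done (V := V) (by omega)).mono ?_, Frame.refl s, by simpa using h6,
      by simpa using h9⟩
    nlinarith
  | succ n ih =>
    intro x acc s hxx hxn hacc h6 h7 h8 h9 h14 h15
    by_cases hlt : x < y
    · refine ⟨s, (Run.loop_done (V := V) (by omega)).mono ?_, Frame.refl s, ?_, ?_⟩
      · nlinarith [Nat.zero_le (n * ((5 * V + 15) * (1 + 2 * V)))]
      · rw [h6, Nat.mod_eq_of_lt hlt]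
      · rw [h9, Nat.div_eq_of_lt hlt]; simp
    · push Not at hlt
      have hxV : 2 * (x + 1) * (z + 1) + y < 2 ^ V := lt_of_le_of_lt (by gcongr) hV
      have hb1 : 2 * (x + 1) ≤ 2 * (x + 1) * (z + 1) := Nat.le_mul_of_pos_right _ (by omega)
      have hzx : z * x₀ < 2 ^ V := by nlinarith
      obtain ⟨s3, e, hr, hf, a2, a3, b6, b7, b8, b9, b14, b15⟩ :=
        divStep_run hy hxV (by omega) hlt s h6 h7 h8 h9 h14
      have hdiv : (x - y * e) / y + e = x / y := by
        rw [Nat.sub_mul_div, Nat.sub_add_cancel]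
        exact (Nat.le_div_iff_mul_le (by omega)).2 (by rw [mul_comm]; exact a2)
      have hmod : (x - y * e) % y = x % y := Nat.sub_mul_mod a2
      have hz : z * (x / y) = z * ((x - y * e) / y) + z * e := by rw [← hdiv]; ring
      obtain ⟨s4, hr4, hf4, c1, c2⟩ := ih (x - y * e) (acc + z * e) s3 (by omega)
        (by rw [pow_succ] at hxn; omega) (by omega) b6 b7 b8 b9 b14 b15
      refine ⟨s4, ?_, hf.trans hf4, by rw [c1, hmod], by rw [c2, hz]; ring⟩
      refine (Run.loop_step (V := V) (by omega) (size_le_of_le (by rw [h15]; omega) hxV)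
        hr hr4).mono (le_of_eq ?_)
      ring

theorem divMul_run {x y z V : ℕ} (hV : 2 * (x + 1) * (z + 1) + y < 2 ^ V) (s : State)
    (h6 : s.reg 6 = x) (h7 : s.reg 7 = y) (h8 : s.reg 8 = z) :
    ∃ s', Run divMul s s' ((V + 2) * ((5 * V + 15) * (1 + 2 * V))) ∧ Frame s s' ∧
      s'.reg 6 = x % y ∧ s'.reg 9 = z * (x / y) := by
  have hb1 : 2 * (x + 1) ≤ 2 * (x + 1) * (z + 1) := Nat.le_mul_of_pos_right _ (by omega)
  set s1 := (((s.setReg 9 0).setReg 14 1).setReg 14 (x + 1)).setReg 15 (x + 1 - y) with hs1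
  have e1 := Run.const (x := 9) (c := 0) (s := s) (V := V) (by simp)
  have e2 := Run.const (x := 14) (c := 1) (s := s.setReg 9 0) (V := V)
    (size_le_of_le (by omega) hV)
  have e3 := Run.add (x := 14) (y := 6) (z := 14) (s := (s.setReg 9 0).setReg 14 1) (V := V)
    (size_le_of_le (N := x) (by simp [h6]) (by omega)) (size_le_of_le (N := 1) (by simp) (by omega))
  simp [h6] at e3
  have e4 := Run.sub (x := 15) (y := 14) (z := 7)
    (s := ((s.setReg 9 0).setReg 14 1).setReg 14 (x + 1)) (V := V)
    (size_le_of_le (N := x + 1) (by simp) (by omega))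
    (size_le_of_le (N := y) (by simp [h7]) (by omega))
  simp [h7] at e4
  have hfr : Frame s s1 := (((((Frame.refl s).setReg (by omega) (by omega)).setReg (by omega)
          (by omega)).setReg (by omega) (by omega)).setReg (by omega) (by omega))
  have h17 : s1.reg 7 = y := by simpa [hs1] using h7
  rcases Nat.eq_zero_or_pos y with hy | hy
  -- Divisor zero: register `6` keeps `x` and register `9` is `0`, in agreement with `x % 0 = x` and
  -- `x / 0 = 0`.
  · have e5 := Run.const (x := 9) (c := 0) (s := s1) (V := V) (by simp)
    refine ⟨s1.setReg 9 0, (e1.seq (e2.seq (e3.seq (e4.seq (Run.ite_false (V := V)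
      (h17.trans hy) e5))))).mono ?_, hfr.setReg (by omega) (by omega), ?_, ?_⟩
    · nlinarith [Nat.zero_le (V * ((5 * V + 15) * (1 + 2 * V)))]
    · simp [hs1, h6, hy]
    · simp [hy]
  · have hxV : x < 2 ^ V := by omega
    obtain ⟨s', hr, hf, b1, b2⟩ := divLoop_run hy hV V x 0 s1 le_rfl hxV
      (by simpa using Nat.mul_le_mul le_rfl (Nat.div_le_self x y)) (by simpa [hs1] using h6)
      (by simpa [hs1] using h7) (by simpa [hs1] using h8) (by simp [hs1]) (by simp [hs1])
      (by simp [hs1])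
    refine ⟨s', (e1.seq (e2.seq (e3.seq (e4.seq (Run.ite_true (V := V)
      (show s1.reg 7 ≠ 0 by omega) (size_le_of_le (N := y) h17.le (by omega)) hr))))).mono ?_, hfr.trans hf, b1, by simpa using b2⟩
    nlinarith


/-! ### Expressions -/

/-- Arithmetic expressions in the registers `0, …, 5` and the memory. -/
inductive Expr where
  | lit (c : ℕ)
  | var (x : Fin 6)
  | add (a b : Expr)
  | sub (a b : Expr)
  | mul (a b : Expr)
  | div (a b : Expr)
  | mod (a b : Expr)
  | load (a : Expr)

namespace Expr

def eval (s : State) : Expr → ℕ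
  | lit c => c
  | var x => s.reg x
  | add a b => a.eval s + b.eval s
  | sub a b => a.eval s - b.eval s
  | mul a b => a.eval s * b.eval s
  | div a b => a.eval s / b.eval s
  | mod a b => a.eval s % b.eval s
  | load a => s.mem (a.eval s)

/-- Bound on the growth of bit lengths under evaluation. -/
def weight : Expr → ℕ
  | lit c => Nat.size c
  | var _ => 1
  | add a b | sub a b | mul a b | div a b | mod a b => a.weight + b.weight
  | load _ => 1

/-- Code that leaves the value in register `d` and does not change the registers `16, …, d - 1`. -/
def compile : Expr → ℕ → Prog
  | lit c, d => .const d c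
  | var x, d => .copy d x
  | add a b, d => .seq (.seq (a.compile d) (b.compile (d + 1))) (.add d d (d + 1))
  | sub a b, d => .seq (.seq (a.compile d) (b.compile (d + 1))) (.sub d d (d + 1))
  | mul a b, d => .seq (.seq (a.compile d) (b.compile (d + 1))) <|
      .seq (.seq (.copy 6 d) <| .seq (.const 7 1) <| .seq (.copy 8 (d + 1)) divMul) (.copy d 9)
  | div a b, d => .seq (.seq (a.compile d) (b.compile (d + 1))) <|
      .seq (.seq (.copy 6 d) <| .seq (.copy 7 (d + 1)) <| .seq (.const 8 1) divMul) (.copy d 9)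
  | mod a b, d => .seq (.seq (a.compile d) (b.compile (d + 1))) <|
      .seq (.seq (.copy 6 d) <| .seq (.copy 7 (d + 1)) <| .seq (.const 8 1) divMul) (.copy d 6)
  | load a, d => .seq (a.compile d) (.load d d)

end Expr

/-- The states agree in the registers `0, …, 5` and in the memory. -/
def Sim (s s' : State) : Prop := s'.mem = s.mem ∧ ∀ x < 6, s'.reg x = s.reg x

theorem Sim.refl (s : State) : Sim s s := ⟨rfl, fun _ _ => rfl⟩

theorem Sim.trans {s s' s'' : State} (h : Sim s s') (h' : Sim s' s'') : Sim s s'' :=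
  ⟨h'.1.trans h.1, fun x hx => (h'.2 x hx).trans (h.2 x hx)⟩

theorem Sim.eval {s s' : State} (h : Sim s s') (e : Expr) : e.eval s' = e.eval s := by
  induction e with
  | lit c => rfl
  | var x => exact h.2 x x.2
  | load a ih => simp [Expr.eval, ih, h.1]
  | _ => simp_all [Expr.eval]

/-- The numbers in the registers `0, …, 5` and in the memory have at most `B` bits. -/
def Bounded (B : ℕ) (s : State) : Prop :=
  (∀ x < 6, Nat.size (s.reg x) ≤ B) ∧ ∀ a, Nat.size (s.mem a) ≤ B

theorem Sim.bounded {s s' : State} {B : ℕ} (h : Sim s s') (hb : Bounded B s) : Bounded B s' :=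
  ⟨fun x hx => by rw [h.2 x hx]; exact hb.1 x hx, fun a => by rw [h.1]; exact hb.2 a⟩

theorem size_add_le (a b : ℕ) : Nat.size (a + b) ≤ Nat.size a + Nat.size b := by
  have ha := Nat.lt_size_self a
  have hb := Nat.lt_size_self b
  rw [Nat.size_le, pow_add]
  nlinarith

theorem size_mul_le (a b : ℕ) : Nat.size (a * b) ≤ Nat.size a + Nat.size b := by
  have ha := Nat.lt_size_self a
  have hb := Nat.lt_size_self b
  rw [Nat.size_le, pow_add]
  nlinarith

/-- Sums and products have at most as many bits as both operands together, so weights add up. A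
memory cell has at most `B` bits whatever its address, so a load has weight `1` again. -/
theorem Expr.size_eval_le {s : State} {B : ℕ} (hB : 1 ≤ B) (h : Bounded B s) (e : Expr) :
    Nat.size (e.eval s) ≤ e.weight * B := by
  induction e with
  | lit c => exact Nat.le_mul_of_pos_right _ hB
  | var x => simpa [eval, weight] using h.1 x x.2
  | add a b iha ihb =>
    exact (size_add_le _ _).trans (by simp only [weight, add_mul]; omega)
  | sub a b iha ihb =>
    exact (Nat.size_le_size (Nat.sub_le _ _)).trans (by simp only [weight, add_mul]; omega)
  | mul a b iha ihb =>
    exact (size_mul_le _ _).trans (by simp only [weight, add_mul]; omega)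
  | div a b iha ihb =>
    exact (Nat.size_le_size (Nat.div_le_self _ _)).trans (by simp only [weight, add_mul]; omega)
  | mod a b iha ihb =>
    exact (Nat.size_le_size (Nat.mod_le _ _)).trans (by simp only [weight, add_mul]; omega)
  | load a _ => simpa [eval, weight] using h.2 _

/-- `p` computes the value `v` into register `d` within time `T`. -/
def Computes (p : Prog) (s : State) (d v T : ℕ) : Prop :=
  ∃ s', Run p s s' T ∧ Sim s s' ∧ (∀ x, 16 ≤ x → x < d → s'.reg x = s.reg x) ∧ s'.reg d = v

/-- Copying into the registers `6, 7, 8` and dividing. -/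
theorem divMul_call {p₁ p₂ p₃ : Prog} {x y z V : ℕ} (hV : 2 * (x + 1) * (z + 1) + y < 2 ^ V)
    {s : State} (h1 : Run p₁ s (s.setReg 6 x) (1 + 2 * V))
    (h2 : Run p₂ (s.setReg 6 x) ((s.setReg 6 x).setReg 7 y) (1 + 2 * V))
    (h3 : Run p₃ ((s.setReg 6 x).setReg 7 y) (((s.setReg 6 x).setReg 7 y).setReg 8 z)
      (1 + 2 * V)) :
    ∃ s', Run (.seq p₁ <| .seq p₂ <| .seq p₃ divMul) s s'
        ((V + 3) * ((5 * V + 15) * (1 + 2 * V))) ∧ Frame s s' ∧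
      s'.reg 6 = x % y ∧ s'.reg 9 = z * (x / y) := by
  obtain ⟨s', hr, hf, h6, h9⟩ := divMul_run hV (((s.setReg 6 x).setReg 7 y).setReg 8 z)
    (by simp) (by simp) (by simp)
  refine ⟨s', (h1.seq (h2.seq (h3.seq hr))).mono (by nlinarith), Frame.trans ?_ hf, h6, h9⟩
  exact (((Frame.refl s).setReg (by omega) (by omega)).setReg (by omega) (by omega)).setReg
    (by omega) (by omega)

theorem lt_two_pow_of_size {x y z V : ℕ} (h : Nat.size x + Nat.size y + Nat.size z + 2 ≤ V) :
    2 * (x + 1) * (z + 1) + y < 2 ^ V := by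
  have hx := Nat.lt_size_self x
  have hy := Nat.lt_size_self y
  have hz := Nat.lt_size_self z
  have h1 : 2 ^ (Nat.size x + Nat.size y + Nat.size z + 2) ≤ 2 ^ V :=
    Nat.pow_le_pow_right (by omega) h
  rw [pow_add, pow_add, pow_add] at h1
  have h2 : (x + 1) * (z + 1) ≤ 2 ^ Nat.size x * 2 ^ Nat.size z := Nat.mul_le_mul hx hz
  have h3 : 1 ≤ 2 ^ Nat.size x * 2 ^ Nat.size z := Nat.one_le_iff_ne_zero.2 (by positivity)
  have h4 : 2 ^ Nat.size x * 2 ^ Nat.size y * 2 ^ Nat.size z * 2 ^ 2 =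
      4 * (2 ^ Nat.size x * 2 ^ Nat.size z) * 2 ^ Nat.size y := by ring
  rw [h4] at h1
  generalize 2 ^ Nat.size x * 2 ^ Nat.size z = u at *
  generalize 2 ^ Nat.size y = w at *
  have h5 : u + w ≤ 2 * (u * w) := by nlinarith
  nlinarith

/-- The registers from `16` on form an evaluation stack: the right operand is evaluated at `d + 1`
and leaves register `d` alone. Multiplication is `divMul` with divisor `1`, and division is `divMul`
with factor `1`. The cost is cubic because long division makes linearly many passes, each with
linearly many doublings of numbers of linear bit length. -/
theorem Expr.compile_spec (e : Expr) : ∃ C, ∀ d ≥ 16, ∀ (s : State) (B : ℕ), 1 ≤ B →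
    Bounded B s → Computes (e.compile d) s d (e.eval s) (C * B ^ 3) := by
  have setReg_sim : ∀ {s : State} {d v : ℕ}, 16 ≤ d → Sim s (s.setReg d v) := fun {s d v} hd =>
    ⟨rfl, fun x hx => by rw [State.setReg_reg, if_neg (by omega)]⟩
  have hpow : ∀ {B : ℕ}, 1 ≤ B → B ≤ B ^ 3 := fun {B} _ => Nat.le_self_pow (by omega) B
  have binary : ∀ {a b : Expr} {C C' : ℕ},
      (∀ d ≥ 16, ∀ (s : State) (B : ℕ), 1 ≤ B → Bounded B s →
        Computes (a.compile d) s d (a.eval s) (C * B ^ 3)) →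
      (∀ d ≥ 16, ∀ (s : State) (B : ℕ), 1 ≤ B → Bounded B s →
        Computes (b.compile d) s d (b.eval s) (C' * B ^ 3)) →
      ∀ d ≥ 16, ∀ (s : State) (B : ℕ), 1 ≤ B → Bounded B s →
        ∃ s', Run (.seq (a.compile d) (b.compile (d + 1))) s s' ((C + C') * B ^ 3) ∧ Sim s s' ∧
          (∀ x, 16 ≤ x → x < d → s'.reg x = s.reg x) ∧ s'.reg d = a.eval s ∧
          s'.reg (d + 1) = b.eval s := by
    intro a b C C' ha hb d hd s B hB hs
    obtain ⟨s1, r1, m1, f1, v1⟩ := ha d hd s B hB hs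
    obtain ⟨s2, r2, m2, f2, v2⟩ := hb (d + 1) (by omega) s1 B hB (m1.bounded hs)
    refine ⟨s2, (r1.seq r2).mono (by ring_nf; omega), m1.trans m2, fun x h1 h2 => ?_, ?_, ?_⟩
    · rw [f2 x h1 (by omega), f1 x h1 h2]
    · rw [f2 d hd (by omega), v1]
    · rw [v2, m1.eval]
  -- Cost of a call of `divMul` and the final copy. Because of `V ≥ 4` the additive constants can be
  -- replaced by multiples of `V`; `300` is a generous sum of the resulting coefficients.
  have division : ∀ (wa wb B : ℕ), 1 ≤ B →
      ((wa + wb + 4) * B + 3) * ((5 * ((wa + wb + 4) * B) + 15) * (1 + 2 * ((wa + wb + 4) * B)))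
        + (1 + 2 * ((wa + wb + 4) * B)) ≤ 300 * (wa + wb + 4) ^ 3 * B ^ 3 := by
    intro wa wb B hB
    have hV : 4 ≤ (wa + wb + 4) * B := by nlinarith
    have : 300 * (wa + wb + 4) ^ 3 * B ^ 3 = 300 * ((wa + wb + 4) * B) ^ 3 := by ring
    rw [this]
    generalize (wa + wb + 4) * B = V at *
    calc _ ≤ (V + V) * ((5 * V + 4 * V) * (V + 2 * V)) + (V + 2 * V) * 1 * 1 := by
          gcongr <;> omega
      _ ≤ (V + V) * ((5 * V + 4 * V) * (V + 2 * V)) + (V + 2 * V) * V * V := by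
          gcongr <;> omega
      _ ≤ _ := by ring_nf; gcongr; omega
  have sim_frame : ∀ {s s' : State}, Frame s s' → Sim s s' := fun h =>
    ⟨h.1, fun x hx => h.2 x (Or.inl hx)⟩
  induction e with
  | lit c =>
    refine ⟨1 + 2 * Nat.size c, fun d hd s B hB hs => ⟨_, (Run.const le_rfl).mono ?_,
      setReg_sim hd, fun x h1 h2 => ?_, by simp [eval]⟩⟩
    · exact Nat.le_mul_of_pos_right _ (by positivity)
    · rw [State.setReg_reg, if_neg (by omega)]
  | var x =>
    refine ⟨3, fun d hd s B hB hs => ⟨_, (Run.copy (hs.1 x x.2)).mono ?_,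
      setReg_sim hd, fun y h1 h2 => ?_, by simp [eval]⟩⟩
    · have := hpow hB; omega
    · rw [State.setReg_reg, if_neg (by omega)]
  | load a ih =>
    obtain ⟨C, hC⟩ := ih
    refine ⟨C + 1 + 2 * (a.weight + 1), fun d hd s B hB hs => ?_⟩
    obtain ⟨s1, r1, m1, f1, v1⟩ := hC d hd s B hB hs
    refine ⟨_, (r1.seq (Run.load (x := d) (y := d) (V := (a.weight + 1) * B) ?_ ?_)).mono ?_,
      m1.trans (setReg_sim hd), fun y h1 h2 => ?_, ?_⟩
    · rw [v1]
      exact (a.size_eval_le hB hs).trans (by gcongr; omega)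
    · rw [m1.1]
      exact (hs.2 _).trans (Nat.le_mul_of_pos_left _ (by omega))
    · have h1 := hpow hB
      have h2 : (a.weight + 1) * B ≤ (a.weight + 1) * B ^ 3 := by gcongr
      have h3 : 1 ≤ B ^ 3 := by omega
      calc _ ≤ C * B ^ 3 + (B ^ 3 + 2 * ((a.weight + 1) * B ^ 3)) := by omega
        _ = _ := by ring
    · rw [State.setReg_reg, if_neg (by omega), f1 y h1 h2]
    · simp [eval, v1, m1.1]
  | add a b iha ihb =>
    obtain ⟨C, hC⟩ := iha
    obtain ⟨C', hC'⟩ := ihb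
    refine ⟨C + C' + 1 + 2 * (a.weight + b.weight), fun d hd s B hB hs => ?_⟩
    obtain ⟨s1, r1, m1, f1, v1, v1'⟩ := binary hC hC' d hd s B hB hs
    refine ⟨_, (r1.seq (Run.add (x := d) (V := (a.weight + b.weight) * B) ?_ ?_)).mono ?_,
      m1.trans (setReg_sim hd), fun y h1 h2 => ?_, ?_⟩
    · rw [v1]
      exact (a.size_eval_le hB hs).trans (by gcongr; omega)
    · rw [v1']
      exact (b.size_eval_le hB hs).trans (by gcongr; omega)
    · have h2 : (a.weight + b.weight) * B ≤ (a.weight + b.weight) * B ^ 3 := by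
        gcongr; exact hpow hB
      have h3 := hpow hB
      calc _ ≤ (C + C') * B ^ 3 + (B ^ 3 + 2 * ((a.weight + b.weight) * B ^ 3)) := by omega
        _ = _ := by ring
    · rw [State.setReg_reg, if_neg (by omega), f1 y h1 h2]
    · simp [eval, v1, v1']
  | sub a b iha ihb =>
    obtain ⟨C, hC⟩ := iha
    obtain ⟨C', hC'⟩ := ihb
    refine ⟨C + C' + 1 + 2 * (a.weight + b.weight), fun d hd s B hB hs => ?_⟩
    obtain ⟨s1, r1, m1, f1, v1, v1'⟩ := binary hC hC' d hd s B hB hs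
    refine ⟨_, (r1.seq (Run.sub (x := d) (V := (a.weight + b.weight) * B) ?_ ?_)).mono ?_,
      m1.trans (setReg_sim hd), fun y h1 h2 => ?_, ?_⟩
    · rw [v1]
      exact (a.size_eval_le hB hs).trans (by gcongr; omega)
    · rw [v1']
      exact (b.size_eval_le hB hs).trans (by gcongr; omega)
    · have h2 : (a.weight + b.weight) * B ≤ (a.weight + b.weight) * B ^ 3 := by
        gcongr; exact hpow hB
      have h3 := hpow hB
      calc _ ≤ (C + C') * B ^ 3 + (B ^ 3 + 2 * ((a.weight + b.weight) * B ^ 3)) := by omega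
        _ = _ := by ring
    · rw [State.setReg_reg, if_neg (by omega), f1 y h1 h2]
    · simp [eval, v1, v1']
  | mul a b iha ihb =>
    obtain ⟨C, hC⟩ := iha
    obtain ⟨C', hC'⟩ := ihb
    refine ⟨C + C' + 300 * (a.weight + b.weight + 4) ^ 3, fun d hd s B hB hs => ?_⟩
    obtain ⟨s1, r1, m1, f1, v1, v1'⟩ := binary hC hC' d hd s B hB hs
    have ha := a.size_eval_le hB hs
    have hb := b.size_eval_le hB hs
    have hw : (a.weight + b.weight + 4) * B = a.weight * B + b.weight * B + 4 * B := by ring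
    obtain ⟨s2, r2, f2, -, v9⟩ := divMul_call (x := a.eval s) (y := 1) (z := b.eval s)
      (V := (a.weight + b.weight + 4) * B) (p₁ := .copy 6 d) (p₂ := .const 7 1)
      (p₃ := .copy 8 (d + 1)) (s := s1)
      (lt_two_pow_of_size (by rw [Nat.size_one]; omega))
      (by have := Run.copy (s := s1) (x := 6) (y := d) (V := (a.weight + b.weight + 4) * B)
            (by rw [v1]; omega)
          rwa [v1] at this)
      (Run.const (by rw [Nat.size_one]; omega))
      (by have := Run.copy (s := (s1.setReg 6 (a.eval s)).setReg 7 1) (x := 8) (y := d + 1)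
            (V := (a.weight + b.weight + 4) * B)
          simp only [State.setReg_reg, if_neg (show ¬ d + 1 = 7 by omega),
            if_neg (show ¬ d + 1 = 6 by omega), v1'] at this
          exact this (by omega))
    have hv : s2.reg 9 = a.eval s * b.eval s := by rw [v9, Nat.div_one, mul_comm]
    have r3 := Run.copy (s := s2) (x := d) (y := 9) (V := (a.weight + b.weight + 4) * B)
      (by rw [hv]; exact (size_mul_le _ _).trans (by omega))
    refine ⟨_, (r1.seq (r2.seq r3)).mono ?_, (m1.trans (sim_frame f2)).trans (setReg_sim hd),
      fun y h1 h2 => ?_, by simpa [eval] using hv⟩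
    · have := division a.weight b.weight B hB
      rw [add_mul (C + C')]
      omega
    · rw [State.setReg_reg, if_neg (by omega), f2.2 y (by omega), f1 y h1 h2]
  | div a b iha ihb =>
    obtain ⟨C, hC⟩ := iha
    obtain ⟨C', hC'⟩ := ihb
    refine ⟨C + C' + 300 * (a.weight + b.weight + 4) ^ 3, fun d hd s B hB hs => ?_⟩
    obtain ⟨s1, r1, m1, f1, v1, v1'⟩ := binary hC hC' d hd s B hB hs
    have ha := a.size_eval_le hB hs
    have hb := b.size_eval_le hB hs
    have hw : (a.weight + b.weight + 4) * B = a.weight * B + b.weight * B + 4 * B := by ring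
    obtain ⟨s2, r2, f2, -, v9⟩ := divMul_call (x := a.eval s) (y := b.eval s) (z := 1)
      (V := (a.weight + b.weight + 4) * B) (p₁ := .copy 6 d) (p₂ := .copy 7 (d + 1))
      (p₃ := .const 8 1) (s := s1)
      (lt_two_pow_of_size (by rw [Nat.size_one]; omega))
      (by have := Run.copy (s := s1) (x := 6) (y := d) (V := (a.weight + b.weight + 4) * B)
            (by rw [v1]; omega)
          rwa [v1] at this)
      (by have := Run.copy (s := s1.setReg 6 (a.eval s)) (x := 7) (y := d + 1)
            (V := (a.weight + b.weight + 4) * B)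
          simp only [State.setReg_reg, if_neg (show ¬ d + 1 = 6 by omega), v1'] at this
          exact this (by omega))
      (Run.const (by rw [Nat.size_one]; omega))
    have hv : s2.reg 9 = a.eval s / b.eval s := by rw [v9, one_mul]
    have r3 := Run.copy (s := s2) (x := d) (y := 9) (V := (a.weight + b.weight + 4) * B)
      (by rw [hv]; exact (Nat.size_le_size (Nat.div_le_self _ _)).trans (by omega))
    refine ⟨_, (r1.seq (r2.seq r3)).mono ?_, (m1.trans (sim_frame f2)).trans (setReg_sim hd),
      fun y h1 h2 => ?_, by simpa [eval] using hv⟩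
    · have := division a.weight b.weight B hB
      rw [add_mul (C + C')]
      omega
    · rw [State.setReg_reg, if_neg (by omega), f2.2 y (by omega), f1 y h1 h2]
  | mod a b iha ihb =>
    obtain ⟨C, hC⟩ := iha
    obtain ⟨C', hC'⟩ := ihb
    refine ⟨C + C' + 300 * (a.weight + b.weight + 4) ^ 3, fun d hd s B hB hs => ?_⟩
    obtain ⟨s1, r1, m1, f1, v1, v1'⟩ := binary hC hC' d hd s B hB hs
    have ha := a.size_eval_le hB hs
    have hb := b.size_eval_le hB hs
    have hw : (a.weight + b.weight + 4) * B = a.weight * B + b.weight * B + 4 * B := by ring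
    obtain ⟨s2, r2, f2, hv, -⟩ := divMul_call (x := a.eval s) (y := b.eval s) (z := 1)
      (V := (a.weight + b.weight + 4) * B) (p₁ := .copy 6 d) (p₂ := .copy 7 (d + 1))
      (p₃ := .const 8 1) (s := s1)
      (lt_two_pow_of_size (by rw [Nat.size_one]; omega))
      (by have := Run.copy (s := s1) (x := 6) (y := d) (V := (a.weight + b.weight + 4) * B)
            (by rw [v1]; omega)
          rwa [v1] at this)
      (by have := Run.copy (s := s1.setReg 6 (a.eval s)) (x := 7) (y := d + 1)
            (V := (a.weight + b.weight + 4) * B)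
          simp only [State.setReg_reg, if_neg (show ¬ d + 1 = 6 by omega), v1'] at this
          exact this (by omega))
      (Run.const (by rw [Nat.size_one]; omega))
    have r3 := Run.copy (s := s2) (x := d) (y := 6) (V := (a.weight + b.weight + 4) * B)
      (by rw [hv]; exact (Nat.size_le_size (Nat.mod_le _ _)).trans (by omega))
    refine ⟨_, (r1.seq (r2.seq r3)).mono ?_, (m1.trans (sim_frame f2)).trans (setReg_sim hd),
      fun y h1 h2 => ?_, by simpa [eval] using hv⟩
    · have := division a.weight b.weight B hB
      rw [add_mul (C + C')]
      omega
    · rw [State.setReg_reg, if_neg (by omega), f2.2 y (by omega), f1 y h1 h2]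

/-! ### Commands -/

/-- Loop-free commands. -/
inductive Cmd where
  | skip
  | assign (x : Fin 6) (e : Expr)
  | store (a e : Expr)
  | seq (c c' : Cmd)
  | ite (e : Expr) (c c' : Cmd)

namespace Cmd

def run : Cmd → State → State
  | skip, s => s
  | assign x e, s => s.setReg x (e.eval s)
  | store a e, s => s.setMem (a.eval s) (e.eval s)
  | seq c c', s => c'.run (c.run s)
  | ite e c c', s => if e.eval s ≠ 0 then c.run s else c'.run s

def compile : Cmd → Prog
  | skip => .const 16 0
  | assign x e => .seq (e.compile 16) (.copy x 16)
  | store a e => .seq (.seq (a.compile 16) (e.compile 17)) (.store 16 17)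
  | seq c c' => .seq c.compile c'.compile
  | ite e c c' => .seq (e.compile 16) (.ite 16 c.compile c'.compile)

/-- Compiled code spoils the scratch registers, so its result agrees with `Cmd.run` only up to
`Sim`. A loop-free command increases bit lengths by a constant factor; in a sequence the second
command starts with `C * B` bits, which explains the constant `C + C' * C ^ 3`. -/
theorem compile_spec (c : Cmd) : ∃ C, 1 ≤ C ∧ ∀ (s t : State) (B : ℕ), 1 ≤ B → Bounded B t →
    Sim t s → ∃ s', Run c.compile s s' (C * B ^ 3) ∧ Sim (c.run t) s' ∧
      Bounded (C * B) (c.run t) := by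
  induction c with
  | skip =>
    refine ⟨1, le_rfl, fun s t B hB ht hs => ⟨_, (Run.const (V := 0) (by simp)).mono ?_,
      hs.trans ⟨rfl, fun x hx => ?_⟩, by simpa [run] using ht⟩⟩
    · have : 0 < B ^ 3 := by positivity
      omega
    · rw [State.setReg_reg, if_neg (by omega)]
  | assign x e =>
    obtain ⟨C, hC⟩ := e.compile_spec
    refine ⟨C + 1 + 2 * e.weight, by omega, fun s t B hB ht hs => ?_⟩
    obtain ⟨s1, r1, m1, -, v1⟩ := hC 16 le_rfl s B hB (hs.bounded ht)
    have hsz := e.size_eval_le hB ht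
    rw [hs.eval] at v1
    have r2 := Run.copy (s := s1) (x := x) (y := 16) (V := e.weight * B) (by rwa [v1])
    refine ⟨_, (r1.seq r2).mono ?_, ⟨(hs.trans m1).1, fun y hy => ?_⟩, fun y hy => ?_, fun a => ?_⟩
    · have h2 : e.weight * B ≤ e.weight * B ^ 3 := by gcongr; exact Nat.le_self_pow (by omega) B
      have h3 : 0 < B ^ 3 := by positivity
      calc _ ≤ C * B ^ 3 + (B ^ 3 + 2 * (e.weight * B ^ 3)) := by omega
        _ = _ := by ring
    · rw [v1, run, State.setReg_reg, State.setReg_reg, (hs.trans m1).2 y hy]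
    · rw [run, State.setReg_reg]
      split_ifs
      · exact hsz.trans (by gcongr; omega)
      · exact (ht.1 y hy).trans (Nat.le_mul_of_pos_left _ (by omega))
    · exact (ht.2 a).trans (Nat.le_mul_of_pos_left _ (by omega))
  | store a e =>
    obtain ⟨C, hC⟩ := a.compile_spec
    obtain ⟨C', hC'⟩ := e.compile_spec
    refine ⟨C + C' + 1 + 2 * (a.weight + e.weight), by omega, fun s t B hB ht hs => ?_⟩
    obtain ⟨s1, r1, m1, -, v1⟩ := hC 16 le_rfl s B hB (hs.bounded ht)
    obtain ⟨s2, r2, m2, f2, v2⟩ := hC' 17 (by omega) s1 B hB ((hs.trans m1).bounded ht)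
    have ha := a.size_eval_le hB ht
    have he := e.size_eval_le hB ht
    rw [hs.eval] at v1
    rw [(hs.trans m1).eval] at v2
    have v1' : s2.reg 16 = a.eval t := by rw [f2 16 le_rfl (by omega), v1]
    have r3 := Run.store (s := s2) (x := 16) (y := 17) (V := (a.weight + e.weight) * B)
      (by rw [v1', add_mul]; omega) (by rw [v2, add_mul]; omega)
    have hm := (hs.trans m1).trans m2
    refine ⟨_, ((r1.seq r2).seq r3).mono ?_, ⟨?_, fun y hy => hm.2 y hy⟩, fun y hy => ?_,
      fun b => ?_⟩
    · have h2 : (a.weight + e.weight) * B ≤ (a.weight + e.weight) * B ^ 3 := by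
        gcongr; exact Nat.le_self_pow (by omega) B
      have h3 : 0 < B ^ 3 := by positivity
      calc _ ≤ C * B ^ 3 + C' * B ^ 3 + (B ^ 3 + 2 * ((a.weight + e.weight) * B ^ 3)) := by omega
        _ = _ := by ring
    · rw [v1', v2, run, State.setMem, State.setMem, hm.1]
    · exact (ht.1 y hy).trans (Nat.le_mul_of_pos_left _ (by omega))
    · rw [run, State.setMem_mem]
      split_ifs
      · exact he.trans (by gcongr; omega)
      · exact (ht.2 b).trans (Nat.le_mul_of_pos_left _ (by omega))
  | seq c c' ih ih' =>
    obtain ⟨C, hC1, hC⟩ := ih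
    obtain ⟨C', hC1', hC'⟩ := ih'
    refine ⟨C + C' * C ^ 3, by omega, fun s t B hB ht hs => ?_⟩
    obtain ⟨s1, r1, m1, b1⟩ := hC s t B hB ht hs
    obtain ⟨s2, r2, m2, b2⟩ := hC' s1 _ (C * B) (Nat.mul_pos hC1 hB) b1 m1
    refine ⟨s2, (r1.seq r2).mono (le_of_eq (by ring)), m2, fun y hy => (b2.1 y hy).trans ?_,
      fun a => (b2.2 a).trans ?_⟩
    all_goals
      have : C ≤ C ^ 3 := Nat.le_self_pow (by omega) C
      calc C' * (C * B) = (0 + C' * C) * B := by ring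
        _ ≤ _ := by gcongr; omega
  | ite e c c' ih ih' =>
    obtain ⟨C₀, hC₀⟩ := e.compile_spec
    obtain ⟨C, hC1, hC⟩ := ih
    obtain ⟨C', hC1', hC'⟩ := ih'
    refine ⟨C₀ + (1 + 2 * e.weight) + C + C', by omega, fun s t B hB ht hs => ?_⟩
    obtain ⟨s1, r1, m1, -, v1⟩ := hC₀ 16 le_rfl s B hB (hs.bounded ht)
    have hsz := e.size_eval_le hB ht
    rw [hs.eval] at v1
    have h2 : e.weight * B ≤ e.weight * B ^ 3 := by gcongr; exact Nat.le_self_pow (by omega) B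
    have h3 : 0 < B ^ 3 := by positivity
    have hexp : (C₀ + (1 + 2 * e.weight) + C + C') * B ^ 3 =
      C₀ * B ^ 3 + (B ^ 3 + 2 * (e.weight * B ^ 3)) + C * B ^ 3 + C' * B ^ 3 := by ring
    rw [run]
    split_ifs with h
    · obtain ⟨s2, r2, m2, b2⟩ := hC s1 t B hB ht (hs.trans m1)
      refine ⟨s2, (r1.seq (Run.ite_true (V := e.weight * B) (by rwa [v1]) (by rwa [v1])
        r2)).mono ?_, m2, fun y hy => (b2.1 y hy).trans ?_, fun a => (b2.2 a).trans ?_⟩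
      · omega
      all_goals gcongr; omega
    · obtain ⟨s2, r2, m2, b2⟩ := hC' s1 t B hB ht (hs.trans m1)
      refine ⟨s2, (r1.seq (Run.ite_false (V := e.weight * B) (by rw [v1]; omega)
        r2)).mono ?_, m2, fun y hy => (b2.1 y hy).trans ?_, fun a => (b2.2 a).trans ?_⟩
      · omega
      all_goals gcongr; omega

/-- Repeats the command while counting register `z` down to `0`. -/
def forLoop (z : Fin 6) (c : Cmd) : Prog :=
  .loop z (seq (assign z (.sub (.var z) (.lit 1))) c).compile

/-- Iterating `compile_spec` alone would multiply the bit bound in every pass. Therefore the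
invariant itself has to supply the bound `B`, and the cost of a pass is uniform. The counter is
decreased before the command runs, so the command sees the values `n - 1, …, 0`. -/
theorem forLoop_spec (z : Fin 6) (c : Cmd) : ∃ C, ∀ (B : ℕ) (I : ℕ → State → Prop), 1 ≤ B →
    (∀ j t, I j t → t.reg z = j ∧ Bounded B t) →
    (∀ j t, I (j + 1) t → I j (c.run (t.setReg z j))) →
    ∀ n s t, Sim t s → I n t →
      ∃ s' t', Run (forLoop z c) s s' ((n + 1) * (C * B ^ 3)) ∧ Sim t' s' ∧ I 0 t' := by
  obtain ⟨C, hC1, hC⟩ := (seq (assign z (.sub (.var z) (.lit 1))) c).compile_spec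
  refine ⟨C + 3, fun B I hB hI hstep n => ?_⟩
  have hB3 : B ≤ B ^ 3 := Nat.le_self_pow (by omega) B
  induction n with
  | zero =>
    intro s t hs ht
    have h0 : s.reg z = 0 := by rw [hs.2 z z.2, (hI 0 t ht).1]
    refine ⟨s, t, (Run.loop_done (V := 0) h0).mono ?_, hs, ht⟩
    nlinarith
  | succ n ih =>
    intro s t hs ht
    have hz : s.reg z = n + 1 := by rw [hs.2 z z.2, (hI _ t ht).1]
    obtain ⟨s1, r1, m1, -⟩ := hC s t B hB (hI _ t ht).2 hs
    have hrun : (seq (assign z (.sub (.var z) (.lit 1))) c).run t = c.run (t.setReg z n) := by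
      simp [run, Expr.eval, (hI _ t ht).1]
    rw [hrun] at m1
    obtain ⟨s2, t2, r2, m2, i2⟩ := ih s1 _ m1 (hstep n t ht)
    refine ⟨s2, t2, (Run.loop_step (V := B) (by omega)
      (((hs.bounded (hI _ t ht).2)).1 z z.2) r1 r2).mono ?_, m2, i2⟩
    have : (n + 1 + 1) * ((C + 3) * B ^ 3) =
      (n + 1) * ((C + 3) * B ^ 3) + (C * B ^ 3 + 3 * B ^ 3) := by ring
    omega

end Cmd

namespace MGraph

/-! ### Contraction of cycles -/

/-- Weight of the edge from `i` to `j` in the cycle on `t` nodes. -/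
def cycleWeight (cs t i j : ℕ) : ℕ :=
  if i + 1 = j then cs else if i + 1 = t ∧ j = 0 ∧ 2 ≤ t then cs - 1 else 0

/-- `G` is the cycle through the nodes `f 0, …, f (t - 1)`. -/
structure IsCycle (cs : ℕ) (G : MGraph) (f : ℕ → ℕ) (t : ℕ) : Prop where
  inj : Set.InjOn f (Finset.range t)
  nodes : G.V = (Finset.range t).image f
  edges : ∀ i < t, ∀ j < t, G.E (f i) (f j) = cycleWeight cs t i j

variable {cs t : ℕ} {G : MGraph} {f : ℕ → ℕ}

theorem IsCycle.mem (h : IsCycle cs G f t) {i : ℕ} (hi : i < t) : f i ∈ G.V := by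
  rw [h.nodes]
  exact Finset.mem_image_of_mem f (Finset.mem_range.2 hi)

theorem IsCycle.card (h : IsCycle cs G f t) : G.V.card = t := by
  rw [h.nodes, Finset.card_image_of_injOn h.inj, Finset.card_range]

theorem isCycle_cycle (ht : 2 ≤ t) : IsCycle cs (cycle t cs) id t where
  inj := Set.injOn_id _
  nodes := by simp [cycle]
  edges i hi j hj := by simp only [cycle, cycleWeight, id]; split_ifs <;> omega

theorem IsCycle.outdeg (h : IsCycle cs G f t) {i : ℕ} (hi : i < t) :
    G.outdeg (f i) = ∑ j ∈ Finset.range t, cycleWeight cs t i j := by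
  rw [MGraph.outdeg, h.nodes, Finset.sum_image h.inj]
  exact Finset.sum_congr rfl fun j hj => h.edges i hi j (Finset.mem_range.1 hj)

theorem IsCycle.indeg (h : IsCycle cs G f t) {j : ℕ} (hj : j < t) :
    G.indeg (f j) = ∑ i ∈ Finset.range t, cycleWeight cs t i j := by
  rw [MGraph.indeg, h.nodes, Finset.sum_image h.inj]
  exact Finset.sum_congr rfl fun i hi => h.edges i (Finset.mem_range.1 hi) j hj

/-- Each node has a single outgoing and a single incoming edge, of weight `cs` except for the
closing edge of weight `cs - 1`. Because of `2 ≤ t` the node `f 0` is not the source of the closing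
edge, so the value `cs` is attained. -/
theorem IsCycle.degree_eq (h : IsCycle cs G f t) (ht : 2 ≤ t) : G.degree = cs := by
  have hout : ∀ i < t, G.outdeg (f i) = if i + 1 < t then cs else cs - 1 := by
    intro i hi
    rw [h.outdeg hi]
    split_ifs with h1
    · rw [Finset.sum_eq_single (i + 1)]
      · simp [cycleWeight]
      · intro j _ hj
        rw [cycleWeight, if_neg (Ne.symm hj), if_neg (by omega)]
      · simp [h1]
    · rw [Finset.sum_eq_single 0]
      · rw [cycleWeight, if_neg (by omega), if_pos (by omega)]
      · intro j hj hj0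
        have := Finset.mem_range.1 hj
        rw [cycleWeight, if_neg (by omega), if_neg (by omega)]
      · simp; omega
  have hin : ∀ j < t, G.indeg (f j) = if 1 ≤ j then cs else cs - 1 := by
    intro j hj
    rw [h.indeg hj]
    split_ifs with h1
    · rw [Finset.sum_eq_single (j - 1)]
      · rw [cycleWeight, if_pos (by omega)]
      · intro i hi hij
        rw [cycleWeight, if_neg (by omega), if_neg (by omega)]
      · simp; omega
    · rw [Finset.sum_eq_single (t - 1)]
      · rw [cycleWeight, if_neg (by omega), if_pos (by omega)]
      · intro i hi hij
        rw [cycleWeight, if_neg (by omega), if_neg (by omega)]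
      · simp; omega
  apply le_antisymm
  · refine Finset.sup_le fun v hv => ?_
    rw [h.nodes] at hv
    obtain ⟨i, hi, rfl⟩ := Finset.mem_image.1 hv
    rw [nodeDegree, hout i (Finset.mem_range.1 hi), hin i (Finset.mem_range.1 hi)]
    split_ifs <;> omega
  · calc cs = G.outdeg (f 0) := by rw [hout 0 (by omega), if_pos (by omega)]
      _ ≤ G.nodeDegree (f 0) := le_max_right _ _
      _ ≤ _ := Finset.le_sup (h.mem (by omega))

/-- The condition `2 ≤ t` in `cycleWeight` removes the loop at a single node, in accordance with
contraction, which deletes the edges between the merged nodes. -/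
theorem IsCycle.degree_one (h : IsCycle cs G f 1) : G.degree = 0 := by
  rw [MGraph.degree, h.nodes]
  simp [nodeDegree, h.indeg, h.outdeg, cycleWeight]

/-- The edge from `f t` to `f (t + 1)` disappears; the new node inherits the edge of weight `cs`
entering `f t` and the closing edge leaving `f (t + 1)`. No weights are ever added, since no third
node is joined in the same direction to both merged nodes. For `t = 0` no edge is left. -/
theorem IsCycle.contract (h : IsCycle cs G f (t + 2)) {n : ℕ} (hn : n ∉ G.V) :
    IsCycle cs (G.contract (f t) (f (t + 1)) n) (Function.update f t n) (t + 1) := by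
  have hne : ∀ i < t + 2, f i ≠ n := fun i hi hin => hn (hin ▸ h.mem hi)
  have hff : ∀ i < t + 2, ∀ j < t + 2, f i = f j → i = j := fun i hi j hj =>
    h.inj (by simpa using hi) (by simpa using hj)
  have hupd : ∀ i ≠ t, Function.update f t n i = f i := fun i hi => Function.update_of_ne hi _ _
  have hV : G.contractV (f t) (f (t + 1)) n =
      (Finset.range (t + 1)).image (Function.update f t n) := by
    ext v
    simp only [contractV, h.nodes, Finset.mem_insert, Finset.mem_sdiff, Finset.mem_image,
      Finset.mem_range, Finset.mem_singleton, not_or]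
    constructor
    · rintro (rfl | ⟨⟨i, hi, rfl⟩, h1, h2⟩)
      · exact ⟨t, by omega, by simp⟩
      · have : i ≠ t := fun e => h1 (e ▸ rfl)
        have : i ≠ t + 1 := fun e => h2 (e ▸ rfl)
        exact ⟨i, by omega, hupd i (by omega)⟩
    · rintro ⟨i, hi, rfl⟩
      by_cases hit : i = t
      · subst hit; simp
      · rw [hupd i hit]
        refine Or.inr ⟨⟨i, by omega, rfl⟩, fun e => ?_, fun e => ?_⟩
        · exact hit (hff i (by omega) t (by omega) e)
        · have := hff i (by omega) (t + 1) (by omega) e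
          omega
  refine ⟨?_, hV, fun i hi j hj => ?_⟩
  · intro i hi j hj hij
    have hi : i < t + 1 := by simpa using hi
    have hj : j < t + 1 := by simpa using hj
    by_cases h1 : i = t <;> by_cases h2 : j = t
    · omega
    · rw [hupd j h2, h1, Function.update_self] at hij
      exact absurd hij.symm (hne j (by omega))
    · rw [hupd i h1, h2, Function.update_self] at hij
      exact absurd hij (hne i (by omega))
    · rw [hupd i h1, hupd j h2] at hij
      exact hff i (by omega) j (by omega) hij
  · have hmem : ∀ i < t + 1, Function.update f t n i ∈ G.contractV (f t) (f (t + 1)) n :=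
      fun i hi => hV ▸ Finset.mem_image_of_mem _ (Finset.mem_range.2 hi)
    simp only [MGraph.contract, hmem i hi, hmem j hj, and_self, if_true]
    by_cases h1 : i = t <;> by_cases h2 : j = t
    · rw [h1, h2, Function.update_self, if_pos rfl, if_pos rfl, cycleWeight,
        if_neg (by omega), if_neg (by omega)]
    · rw [hupd j h2, h1, Function.update_self, if_pos rfl, if_neg (hne j (by omega)),
        h.edges t (by omega) j (by omega), h.edges (t + 1) (by omega) j (by omega)]
      simp only [cycleWeight]
      split_ifs <;> grind
    · rw [hupd i h1, h2, Function.update_self, if_pos rfl, if_neg (hne i (by omega)),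
        h.edges i (by omega) t (by omega), h.edges i (by omega) (t + 1) (by omega)]
      simp only [cycleWeight]
      split_ifs <;> omega
    · rw [hupd i h1, hupd j h2, if_neg (hne i (by omega)), if_neg (hne j (by omega)),
        h.edges i (by omega) j (by omega)]
      simp only [cycleWeight]
      split_ifs <;> omega

/-- Merging the last two nodes again and again passes only through cycles of degree `cs`, until the
single node of degree `0` remains. -/
theorem IsCycle.exists_contraction : ∀ {t : ℕ} {G : MGraph} {f : ℕ → ℕ},
    IsCycle cs G f (t + 1) →
      ∃ π, G.IsContraction π ∧ listDegree π = if t = 0 then 0 else cs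
  | 0, G, f, h => ⟨[G], ⟨by simp [h.card], rfl, .singleton G, G, rfl, h.card⟩, by
      simp [listDegree, h.degree_one]⟩
  | t + 1, G, f, h => by
    obtain ⟨n, hn⟩ := Infinite.exists_notMem_finset G.V
    obtain ⟨π, hπ, hd⟩ := (h.contract hn).exists_contraction
    refine ⟨G :: π, ⟨?_, rfl, ?_, ?_⟩, ?_⟩
    · rw [List.length_cons, hπ.length, (h.contract hn).card, h.card]
    · refine List.IsChain.cons hπ.chain fun H hH => ?_
      rw [hπ.head, Option.mem_some_iff] at hH
      exact ⟨f t, h.mem (by omega), f (t + 1), h.mem (by omega),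
        fun e => absurd (h.inj (by simp) (by simp) e) (by omega), n, hn, hH.symm⟩
    · obtain ⟨H, hH, hc⟩ := hπ.last
      exact ⟨H, by rw [List.getLast?_cons, hH]; rfl, hc⟩
    · have : listDegree (G :: π) = max G.degree (listDegree π) := rfl
      rw [this, hd, h.degree_eq (by omega)]
      rw [if_neg (Nat.succ_ne_zero t)]
      split_ifs <;> simp

end MGraph

/-! ### Contexts and the scheduling graph -/

section Contexts

variable {α : Type} {t : ℕ}

/-- Context decompositions with indices in `ℕ`. -/
structure Contexts (u : List (α × Fin t)) (k : ℕ) (c : ℕ → List (α × Fin t)) (φ : ℕ → ℕ) :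
    Prop where
  eq : u = (List.range k).flatMap c
  ne : ∀ n < k, c n ≠ []
  thread : ∀ n < k, ∀ a ∈ c n, (a.2 : ℕ) = φ n
  switch : ∀ n, n + 1 < k → φ n ≠ φ (n + 1)

theorem flatten_ofFn_eq {β : Type} {k : ℕ} (c : ℕ → List β) :
    (List.ofFn fun i : Fin k => c i).flatten = (List.range k).flatMap c := by
  rw [← List.map_coe_finRange_eq_range, List.ofFn_eq_map, List.flatMap_def, List.map_map]
  rfl

theorem mem_roundRobin_iff (ht : 1 ≤ t) {u : List (α × Fin t)} {cs : ℕ} :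
    u ∈ roundRobin α t cs ↔ ∃ c, Contexts u (cs * t) c (· % t) := by
  constructor
  · rintro ⟨c, φ, h, hφ⟩
    have hc : c = fun i : Fin (cs * t) => (fun n => if h : n < cs * t then c ⟨n, h⟩ else []) i := by
      funext i; simp
    refine ⟨fun n => if h : n < cs * t then c ⟨n, h⟩ else [], ?_, ?_, ?_, ?_⟩
    · rw [← flatten_ofFn_eq, ← hc]; exact h.eq_flatten
    · intro n hn; simpa [hn] using h.nonempty ⟨n, hn⟩
    · intro n hn a ha
      simp only [hn, dif_pos] at ha
      rw [h.thread _ a ha, hφ]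
    · intro n hn e
      refine h.switch ⟨n, by omega⟩ ⟨n + 1, hn⟩ rfl (Fin.ext ?_)
      rw [hφ, hφ]; exact e
  · rintro ⟨c, h⟩
    refine ⟨fun i => c i, fun i => ⟨(i : ℕ) % t, Nat.mod_lt _ ht⟩, ⟨?_, ?_, ?_, ?_⟩, fun i => rfl⟩
    · rw [flatten_ofFn_eq]; exact h.eq
    · exact fun i => h.ne i i.2
    · exact fun i a ha => Fin.ext (h.thread i i.2 a ha)
    · intro i j hij e
      have := h.switch i (by omega)
      rw [hij] at this
      exact this (by simpa using e)

/-- A letter put in front of a word either prolongs its first context or opens a new one, depending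
on whether the threads agree. -/
theorem exists_contexts : ∀ u : List (α × Fin t), ∃ k c φ, Contexts u k c φ
  | [] => ⟨0, fun _ => [], fun _ => 0, by simp, by simp, by simp, by simp⟩
  | a :: u => by
    obtain ⟨k, c, φ, h⟩ := exists_contexts u
    by_cases hk : 0 < k ∧ φ 0 = a.2
    · obtain ⟨k, rfl⟩ : ∃ k', k = k' + 1 := ⟨k - 1, by omega⟩
      refine ⟨k + 1, fun n => if n = 0 then a :: c 0 else c n, φ, ?_, ?_, ?_, h.switch⟩
      · rw [h.eq, List.range_succ_eq_map]
        simp [List.flatMap_map]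
      · intro n hn; split_ifs
        · simp
        · exact h.ne n hn
      · intro n hn b hb; split_ifs at hb with h0
        · subst h0
          rcases List.mem_cons.1 hb with rfl | hb
          · exact hk.2.symm
          · exact h.thread 0 hn b hb
        · exact h.thread n hn b hb
    · refine ⟨k + 1, fun n => if n = 0 then [a] else c (n - 1),
        fun n => if n = 0 then a.2 else φ (n - 1), ?_, ?_, ?_, ?_⟩
      · rw [h.eq, List.range_succ_eq_map]
        simp [List.flatMap_map]
      · intro n hn; split_ifs
        · simp
        · exact h.ne _ (by omega)
      · intro n hn b hb; split_ifs at hb ⊢ with h0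
        · simp at hb; rw [hb]
        · exact h.thread _ (by omega) b hb
      · intro n hn
        rw [if_neg (by omega : ¬ n + 1 = 0)]
        split_ifs with h0
        · subst h0; intro e; exact hk ⟨by omega, e.symm⟩
        · have := h.switch (n - 1) (by omega)
          rwa [Nat.sub_add_cancel (by omega : 1 ≤ n)] at this

/-- Number of adjacent positions with threads `i` and `j`. -/
def switches (i j : ℕ) (u : List (α × Fin t)) : ℕ :=
  (u.zip u.tail).countP fun p => (p.1.2 : ℕ) = i ∧ (p.2.2 : ℕ) = j

theorem switches_append (i j : ℕ) (a b : α × Fin t) (l' : List (α × Fin t)) :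
    ∀ l : List (α × Fin t), switches i j (l ++ a :: b :: l') =
      switches i j (l ++ [a]) + switches i j (b :: l') +
        if (a.2 : ℕ) = i ∧ (b.2 : ℕ) = j then 1 else 0
  | [] => by simp [switches, List.countP_cons]
  | [x] => by
    have h := switches_append i j a b l' []
    simp only [switches, List.nil_append, List.tail_cons, List.zip_cons_cons, List.countP_cons,
      List.cons_append, List.zip_nil_right, List.countP_nil, decide_eq_true_eq] at h ⊢
    omega
  | x :: y :: l => by
    have h := switches_append i j a b l' (y :: l)
    simp only [switches, List.cons_append, List.tail_cons, List.zip_cons_cons,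
      List.countP_cons] at h ⊢
    omega

theorem switches_eq_zero {i j m : ℕ} (hij : i ≠ j) {u : List (α × Fin t)}
    (h : ∀ a ∈ u, (a.2 : ℕ) = m) : switches i j u = 0 := by
  refine List.countP_eq_zero.2 fun p hp => ?_
  simp only [decide_eq_true_eq]
  have h1 := h _ (List.of_mem_zip hp).1
  have h2 := h _ (List.mem_of_mem_tail (List.of_mem_zip hp).2)
  omega

/-- Neighbouring letters inside a context belong to one thread and do not count because of `i ≠ j`.
Each of the `k - 1` boundaries contributes one pair, given by the threads of the two adjacent
contexts. -/
theorem Contexts.switches_eq {u : List (α × Fin t)} {k : ℕ} {c : ℕ → List (α × Fin t)}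
    {φ : ℕ → ℕ} (h : Contexts u k c φ) {i j : ℕ} (hij : i ≠ j) :
    switches i j u = Nat.count (fun n => φ n = i ∧ φ (n + 1) = j) (k - 1) := by
  rw [h.eq]
  have key : ∀ n < k, switches i j ((List.range (n + 1)).flatMap c) =
      Nat.count (fun n => φ n = i ∧ φ (n + 1) = j) n := by
    intro n
    induction n with
    | zero =>
      intro hn
      simpa using switches_eq_zero hij (h.thread 0 hn)
    | succ n ih =>
      intro hn
      have ih := ih (by omega)
      obtain ⟨l, a, hl⟩ := List.eq_nil_or_concat (c n) |>.resolve_left (h.ne n (by omega))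
      obtain ⟨b, l', hb⟩ := List.exists_cons_of_ne_nil (h.ne (n + 1) hn)
      have ha2 := h.thread n (by omega) a (by simp [hl])
      have hb2 := h.thread (n + 1) hn b (by simp [hb])
      have hz := switches_eq_zero hij (h.thread (n + 1) hn)
      rw [List.range_succ, List.flatMap_append, List.flatMap_singleton] at ih
      rw [List.range_succ, List.range_succ, List.flatMap_append, List.flatMap_append,
        List.flatMap_singleton, List.flatMap_singleton, Nat.count_succ, ← ih]
      rw [hl, List.concat_eq_append, ← List.append_assoc]
      rw [hb] at hz ⊢
      rw [List.append_assoc, List.singleton_append, switches_append, hz, ha2, hb2]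
      rfl
  rcases Nat.eq_zero_or_pos k with rfl | hk
  · simp [switches]
  · have := key (k - 1) (by omega)
    rwa [Nat.sub_add_cancel hk] at this

theorem Contexts.V_eq {u : List (α × Fin t)} {k : ℕ} {c : ℕ → List (α × Fin t)}
    {φ : ℕ → ℕ} (h : Contexts u k c φ) : (schedulingGraph u).V = (Finset.range k).image φ := by
  ext v
  simp only [schedulingGraph, List.mem_toFinset, List.mem_map, Finset.mem_image, Finset.mem_range,
    h.eq, List.mem_flatMap, List.mem_range]
  constructor
  · rintro ⟨a, ⟨n, hn, ha⟩, rfl⟩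
    exact ⟨n, hn, (h.thread n hn a ha).symm⟩
  · rintro ⟨n, hn, rfl⟩
    obtain ⟨a, ha⟩ := List.exists_mem_of_ne_nil _ (h.ne n hn)
    exact ⟨a, ⟨n, hn, ha⟩, h.thread n hn a ha⟩

theorem schedulingGraph_E (u : List (α × Fin t)) (i j : ℕ) :
    (schedulingGraph u).E i j = if i = j then 0 else switches i j u := rfl

theorem count_mod_eq {t v : ℕ} (hv : v < t) (q r : ℕ) (hr : r < t) :
    Nat.count (fun n => n % t = v) (q * t + r) = q + if v < r then 1 else 0 := by
  have h := Nat.count_modEq_card (q * t + r) (r := t) (by omega) v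
  simp only [Nat.ModEq, Nat.mod_eq_of_lt hv] at h
  rw [h, Nat.mul_add_mod', Nat.mod_eq_of_lt hr, mul_comm, Nat.mul_add_div (by omega),
    Nat.div_eq_of_lt hr, add_zero]

theorem succ_mod_cases {t n : ℕ} (ht : 0 < t) :
    (n % t + 1 < t ∧ (n + 1) % t = n % t + 1) ∨ (n % t + 1 = t ∧ (n + 1) % t = 0) := by
  have := Nat.mod_lt n ht
  rw [Nat.add_mod]
  rcases Nat.lt_or_ge (n % t + 1) t with h | h
  · left
    refine ⟨h, ?_⟩
    rw [Nat.mod_eq_of_lt (by omega : 1 < t), Nat.mod_eq_of_lt h]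
  · right
    refine ⟨by omega, ?_⟩
    rcases Nat.eq_or_lt_of_le (by omega : 1 ≤ t) with rfl | h1
    · simp [Nat.mod_one]
    · rw [Nat.mod_eq_of_lt h1, (by omega : n % t + 1 = t), Nat.mod_self]

theorem Contexts.schedulingGraph_eq {u : List (α × Fin t)} {cs : ℕ}
    {c : ℕ → List (α × Fin t)} (ht : 1 ≤ t) (hcs : 1 ≤ cs)
    (h : Contexts u (cs * t) c (· % t)) : schedulingGraph u = MGraph.cycle t cs := by
  have hle : t ≤ cs * t := Nat.le_mul_of_pos_left t hcs
  have hmul : (cs - 1) * t + t = cs * t := by rw [← Nat.succ_mul]; congr 1; omega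
  apply MGraph.ext
  · rw [h.V_eq]
    ext v
    simp only [Finset.mem_image, Finset.mem_range, MGraph.cycle]
    constructor
    · rintro ⟨n, -, rfl⟩; exact Nat.mod_lt _ ht
    · exact fun hv => ⟨v, by omega, Nat.mod_eq_of_lt hv⟩
  · funext i j
    rw [schedulingGraph_E]
    by_cases ht1 : t = 1
    · subst ht1
      -- With a single thread two consecutive contexts would violate maximality.
      have hcs1 : cs = 1 := by
        by_contra hne
        have := h.switch 0 (by omega)
        omega
      subst hcs1
      have : switches i j u = Nat.count (fun n => n % 1 = i ∧ (n + 1) % 1 = j) 0 ∨ i = j := by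
        by_cases hij : i = j
        · exact Or.inr hij
        · exact Or.inl (h.switches_eq hij)
      simp only [MGraph.cycle]
      rcases this with h1 | h1
      · simp only [Nat.count_zero] at h1
        split_ifs <;> omega
      · split_ifs <;> omega
    -- No switch follows the last context. The switches thus make up `cs - 1` full turns and one
    -- turn without its closing switch, which gives the weights `cs` and `cs - 1`.
    · have hk : cs * t - 1 = (cs - 1) * t + (t - 1) := by omega
      by_cases hij : i = j
      · subst hij
        simp only [MGraph.cycle]
        split_ifs <;> omega
      rw [if_neg hij, h.switches_eq hij, hk]
      simp only [MGraph.cycle]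
      split_ifs with h1 h2
      · have : (fun n => n % t = i ∧ (n + 1) % t = j) = fun n => n % t = i := by
          funext n
          have := succ_mod_cases (n := n) ht
          rw [eq_iff_iff]; omega
        simp only [this]
        rw [count_mod_eq (by omega) _ _ (by omega), if_pos (by omega)]
        omega
      · have : (fun n => n % t = i ∧ (n + 1) % t = j) = fun n => n % t = i := by
          funext n
          have := succ_mod_cases (n := n) ht
          rw [eq_iff_iff]; omega
        simp only [this]
        rw [count_mod_eq (by omega) _ _ (by omega), if_neg (by omega), add_zero]
      · have : (fun n => n % t = i ∧ (n + 1) % t = j) = fun n => False := by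
          funext n
          have := succ_mod_cases (n := n) ht
          rw [eq_iff_iff, iff_false]
          rintro ⟨rfl, rfl⟩
          omega
        simp only [this]
        rw [Nat.count_false]

/-- The edges of the cycle force every switch to go to the cyclic successor, so `φ n = (s + n) % t`
for the first thread `s`. Threads that come earlier in the order `s, s + 1, …` are left at least as
often as later ones. As thread `t - 1` alone is left only `cs - 1` times, it must come last in this
order, so `s = 0`, and the counts then give `k`. -/
theorem Contexts.eq_of_schedulingGraph {u : List (α × Fin t)} {cs k : ℕ}
    {c : ℕ → List (α × Fin t)} {φ : ℕ → ℕ} (ht : 1 ≤ t) (hcs : 1 ≤ cs)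
    (h : Contexts u k c φ) (hG : schedulingGraph u = MGraph.cycle t cs) :
    k = cs * t ∧ ∀ n < k, φ n = n % t := by
  have hV : (Finset.range k).image φ = Finset.range t := by rw [← h.V_eq, hG]; rfl
  have hφt : ∀ n < k, φ n < t := fun n hn =>
    Finset.mem_range.1 (hV ▸ Finset.mem_image_of_mem φ (Finset.mem_range.2 hn))
  have hk : 1 ≤ k := by
    by_contra hk
    have : k = 0 := by omega
    subst this
    have h0 : 0 ∈ Finset.range t := Finset.mem_range.2 ht
    simp [← hV] at h0
  have hE : ∀ i j, i ≠ j → Nat.count (fun n => φ n = i ∧ φ (n + 1) = j) (k - 1) =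
      (MGraph.cycle t cs).E i j := by
    intro i j hij
    rw [← h.switches_eq hij, ← hG, schedulingGraph_E, if_neg hij]
  by_cases ht1 : t = 1
  · subst ht1
    have hk1 : k = 1 := by
      by_contra hne
      have h0 := hφt 0 (by omega)
      have h1 := hφt 1 (by omega)
      have := h.switch 0 (by omega)
      simp only [zero_add] at this
      omega
    -- `cycle 1 cs` has a loop of weight `cs - 1`, whereas a scheduling graph has none; this forces
    -- `cs = 1`.
    have h00 : (schedulingGraph u).E 0 0 = (MGraph.cycle 1 cs).E 0 0 := by rw [hG]
    simp only [schedulingGraph_E, MGraph.cycle] at h00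
    simp at h00
    refine ⟨by omega, fun n hn => ?_⟩
    have := hφt n hn
    omega
  have hstep : ∀ n, n + 1 < k → φ (n + 1) = (φ n + 1) % t := by
    intro n hn
    have hne := h.switch n hn
    have hpos : 0 < Nat.count (fun m => φ m = φ n ∧ φ (m + 1) = φ (n + 1)) (k - 1) := by
      rw [Nat.count_eq_card_filter_range]
      exact Finset.card_pos.2 ⟨n, by simp; omega⟩
    rw [hE _ _ hne] at hpos
    simp only [MGraph.cycle] at hpos
    have h1 := hφt n (by omega)
    have := succ_mod_cases (t := t) (n := φ n) ht
    rw [Nat.mod_eq_of_lt h1] at this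
    split_ifs at hpos <;> omega
  obtain ⟨s, hs⟩ : ∃ s, s = φ 0 := ⟨_, rfl⟩
  have hst : s < t := hs ▸ hφt 0 (by omega)
  have hφ : ∀ n < k, φ n = (s + n) % t := by
    intro n
    induction n with
    | zero => intro _; rw [add_zero, Nat.mod_eq_of_lt hst, hs]
    | succ n ih => intro hn; rw [hstep n hn, ih (by omega), Nat.mod_add_mod, add_assoc]
  have hd : ∀ d < t, (k - 1) / t + (if d < (k - 1) % t then 1 else 0) =
      if d + s + 1 = t then cs - 1 else cs := by
    intro d hd
    have hc := succ_mod_cases (t := t) (n := s + d) ht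
    have hne : (s + d) % t ≠ (s + d + 1) % t := by omega
    have h1 := hE _ _ hne
    have h2 : Nat.count (fun n => φ n = (s + d) % t ∧ φ (n + 1) = (s + d + 1) % t) (k - 1) =
        Nat.count (fun n => n % t = d) (k - 1) := by
      rw [Nat.count_eq_card_filter_range, Nat.count_eq_card_filter_range]
      congr 1
      refine Finset.filter_congr fun n hn => ?_
      have hn := Finset.mem_range.1 hn
      rw [hφ n (by omega), hφ (n + 1) (by omega)]
      constructor
      · intro ⟨e, _⟩
        have : n % t = d % t := Nat.ModEq.add_left_cancel' s e
        rwa [Nat.mod_eq_of_lt hd] at this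
      · intro e
        have e' : (s + n) % t = (s + d) % t := by rw [← Nat.add_mod_mod, e]
        refine ⟨e', ?_⟩
        rw [← add_assoc, ← Nat.mod_add_mod, e', Nat.mod_add_mod]
    have h3 := count_mod_eq hd ((k - 1) / t) ((k - 1) % t) (Nat.mod_lt _ ht)
    rw [Nat.div_add_mod'] at h3
    rw [← h3, ← h2, h1]
    have hsd : (s + d) % t = if s + d < t then s + d else s + d - t := by
      split_ifs with hlt
      · exact Nat.mod_eq_of_lt hlt
      · rw [Nat.mod_eq_sub_mod (by omega), Nat.mod_eq_of_lt (by omega)]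
    simp only [MGraph.cycle]
    split_ifs at hsd ⊢ <;> omega
  have hlt := Nat.mod_lt (k - 1) (show t > 0 from ht)
  -- Index `t - 1` is the thread left least often, and index `t - 1 - s` is thread `t - 1` with the
  -- light edge. Comparing the two yields `s = 0`; index `t - 2` then shows that the incomplete turn
  -- at the end has `t - 1` switches.
  have d1 := hd (t - 1) (by omega)
  have d2 := hd (t - 1 - s) (by omega)
  have d3 := hd (t - 2) (by omega)
  rw [if_neg (by omega)] at d1
  rw [if_pos (by omega : t - 1 - s + s + 1 = t)] at d2
  have hs0 : s = 0 := by
    by_contra hne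
    rw [if_neg (by omega)] at d1
    split_ifs at d2 <;> omega
  subst hs0
  rw [if_pos (by omega)] at d1
  rw [if_neg (by omega : ¬ t - 2 + 0 + 1 = t)] at d3
  refine ⟨?_, fun n hn => by rw [hφ n hn, zero_add]⟩
  have hr : (k - 1) % t = t - 1 := by split_ifs at d3 <;> omega
  have hdm := Nat.div_add_mod' (k - 1) t
  rw [hr, ← add_zero ((k - 1) / t), d1] at hdm
  have hmul : (cs - 1) * t + t = cs * t := by rw [← Nat.succ_mul]; congr 1; omega
  omega

theorem mem_roundRobin_iff_schedulingGraph (ht : 1 ≤ t) {cs : ℕ} (hcs : 1 ≤ cs)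
    {u : List (α × Fin t)} :
    u ∈ roundRobin α t cs ↔ schedulingGraph u = MGraph.cycle t cs := by
  rw [mem_roundRobin_iff ht]
  constructor
  · rintro ⟨c, h⟩
    exact h.schedulingGraph_eq ht hcs
  · intro hG
    obtain ⟨k, c, φ, h⟩ := exists_contexts u
    obtain ⟨rfl, hφ⟩ := h.eq_of_schedulingGraph ht hcs hG
    refine ⟨c, h.eq, h.ne, fun n hn a ha => (h.thread n hn a ha).trans (hφ n hn), fun n hn => ?_⟩
    have := h.switch n hn
    rwa [hφ n (by omega), hφ (n + 1) hn] at this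

end Contexts

theorem bcslRR_iff_bcslFix (S : SMCP) {cs : ℕ} (hcs : 1 ≤ cs) :
    BCSLRR S cs ↔ BCSLFix S (MGraph.cycle S.t cs) :=
  exists_congr fun _ => and_congr_right fun _ =>
    mem_roundRobin_iff_schedulingGraph S.t_pos hcs


/-! ### Runs of automata -/

/-- `w` labels a path from `q` to `q'`. -/
def IsPath {Q A : Type} (δ : Q → A → Q → Prop) : Q → List A → Q → Prop
  | q, [], q' => q = q'
  | q, a :: w, q' => ∃ p, δ q a p ∧ IsPath δ p w q'

section IsPath

variable {Q A : Type} {δ : Q → A → Q → Prop}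

theorem IsPath.append_iff {q q' : Q} {w w' : List A} :
    IsPath δ q (w ++ w') q' ↔ ∃ p, IsPath δ q w p ∧ IsPath δ p w' q' := by
  induction w generalizing q with
  | nil => simp [IsPath]
  | cons a w ih =>
    simp only [List.cons_append, IsPath, ih]
    constructor
    · rintro ⟨p, h, r, h1, h2⟩; exact ⟨r, ⟨p, h, h1⟩, h2⟩
    · rintro ⟨r, ⟨p, h, h1⟩, h2⟩; exact ⟨p, h, r, h1, h2⟩

theorem IsPath.flatMap_iff {q q' : Q} {n : ℕ} {f : ℕ → List A} :
    IsPath δ q ((List.range n).flatMap f) q' ↔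
      ∃ s : ℕ → Q, s 0 = q ∧ s n = q' ∧ ∀ i < n, IsPath δ (s i) (f i) (s (i + 1)) := by
  induction n generalizing q' with
  | zero =>
    constructor
    · intro h
      exact ⟨fun _ => q, rfl, h, by simp⟩
    · rintro ⟨s, rfl, rfl, -⟩; rfl
  | succ n ih =>
    rw [List.range_succ, List.flatMap_append, List.flatMap_singleton, IsPath.append_iff]
    constructor
    · rintro ⟨p, h1, h2⟩
      obtain ⟨s, h0, hn, hs⟩ := ih.1 h1
      refine ⟨fun i => if i ≤ n then s i else q', by simpa using h0, by simp, fun i hi => ?_⟩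
      rcases Nat.lt_or_ge i n with h | h
      · simpa [h.le, Nat.succ_le_of_lt h] using hs i h
      · obtain rfl : i = n := by omega
        simpa [hn] using h2
    · rintro ⟨s, h0, hn, hs⟩
      exact ⟨s n, ih.2 ⟨s, h0, rfl, fun i hi => hs i (by omega)⟩, hn ▸ hs n (by omega)⟩

theorem mem_evalFrom_iff (M : NFA A Q) {S : Set Q} {w : List A} {q' : Q} :
    q' ∈ M.evalFrom S w ↔ ∃ q ∈ S, IsPath (fun q a p => p ∈ M.step q a) q w q' := by
  induction w generalizing S with
  | nil => simp [IsPath]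
  | cons a w ih =>
    rw [NFA.evalFrom_cons, ih]
    simp only [NFA.mem_stepSet, IsPath]
    constructor
    · rintro ⟨p, ⟨q, hq, h⟩, h'⟩; exact ⟨q, hq, p, h, h'⟩
    · rintro ⟨q, hq, p, h, h'⟩; exact ⟨p, ⟨q, hq, h⟩, h'⟩

end IsPath

/-- The transition relation with states and letters in `ℕ`. -/
def Aut.Step {s : ℕ} (A : Aut s) (q a q' : ℕ) : Prop :=
  ∃ (hq : q < A.n) (ha : a < s) (hq' : q' < A.n), A.δ ⟨q, hq⟩ ⟨a, ha⟩ ⟨q', hq'⟩ = true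

theorem Aut.isPath_map_iff {s : ℕ} (A : Aut s) {w : List (Fin s)} {q q' : Fin A.n} :
    IsPath A.Step q (w.map Fin.val) q' ↔ IsPath (fun q a p => A.δ q a p = true) q w q' := by
  induction w generalizing q with
  | nil => simp [IsPath, Fin.val_inj]
  | cons a w ih =>
    simp only [List.map_cons, IsPath]
    constructor
    · rintro ⟨p, ⟨_, _, hp, h⟩, h'⟩
      exact ⟨⟨p, hp⟩, h, ih.1 h'⟩
    · rintro ⟨p, h, h'⟩
      exact ⟨p, ⟨q.2, a.2, p.2, h⟩, ih.2 h'⟩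

theorem Aut.mem_accepts_iff {s : ℕ} (A : Aut s) {w : List (Fin s)} :
    w ∈ A.toNFA.accepts ↔ IsPath A.Step A.init (w.map Fin.val) A.final := by
  rw [A.isPath_map_iff, NFA.mem_accepts]
  simp only [mem_evalFrom_iff]
  constructor
  · rintro ⟨_, rfl, _, rfl, h⟩; exact h
  · intro h; exact ⟨_, rfl, _, rfl, h⟩

theorem Aut.exists_map_eq {s : ℕ} (A : Aut s) {w : List ℕ} {q q' : ℕ} (h : IsPath A.Step q w q') :
    ∃ v : List (Fin s), v.map Fin.val = w := by
  induction w generalizing q with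
  | nil => exact ⟨[], rfl⟩
  | cons a w ih =>
    obtain ⟨p, ⟨_, ha, _⟩, h⟩ := h
    obtain ⟨v, rfl⟩ := ih h
    exact ⟨⟨a, ha⟩ :: v, rfl⟩

/-! ### Certificates -/

/-- Systems with states and letters in `ℕ`: memory size, number of threads, number of
operations, bound on the thread sizes; initial and final states and transitions of the memory
and of the threads. -/
structure Sys where
  m : ℕ
  t : ℕ
  ops : ℕ
  len : ℕ
  Mi : ℕ → Prop
  Mf : ℕ → Prop
  Md : ℕ → ℕ → ℕ → Prop
  Ai : ℕ → ℕ → Prop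
  Af : ℕ → ℕ → Prop
  Ad : ℕ → ℕ → ℕ → ℕ → Prop
  t_pos : 1 ≤ t
  Mi_lt : ∀ {q}, Mi q → q < m
  Mf_lt : ∀ {q}, Mf q → q < m
  Md_lt : ∀ {q a q'}, Md q a q' → q < m ∧ a < ops ∧ q' < m
  Ai_lt : ∀ {i q}, Ai i q → q < len
  Ad_lt : ∀ {i q a q'}, Ad i q a q' → q < len ∧ q' < len

namespace Sys

variable (Y : Sys)

/-- A context of thread `j` that takes the memory from `q` to `q'` and the thread from `a`
to `a'`. -/
def Block (j q a q' a' : ℕ) : Prop :=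
  ∃ w, w ≠ [] ∧ IsPath Y.Md q w q' ∧ IsPath (Y.Ad j) a w a'

/-- `st j r` is the memory state before thread `j` runs in round `r`, and `th j r` is the state of
thread `j` before round `r`. -/
structure IsCert (c : ℕ) (st th : ℕ → ℕ → ℕ) : Prop where
  init : Y.Mi (st 0 0)
  final : Y.Mf (st 0 c)
  next : ∀ r < c, st Y.t r = st 0 (r + 1)
  thread_init : ∀ j < Y.t, Y.Ai j (th j 0)
  thread_final : ∀ j < Y.t, Y.Af j (th j c)
  block : ∀ j < Y.t, ∀ r < c, Y.Block j (st j r) (th j r) (st (j + 1) r) (th j (r + 1))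

end Sys

/-- The system of a shared memory concurrent program. -/
def SMCP.toSys (S : SMCP) (len : ℕ) (hlen : ∀ i, (S.A i).n ≤ len) : Sys where
  m := S.M.n
  t := S.t
  ops := S.ops
  len := len
  Mi q := q = S.M.init
  Mf q := q = S.M.final
  Md := S.M.Step
  Ai i q := ∃ h : i < S.t, q = (S.A ⟨i, h⟩).init
  Af i q := ∃ h : i < S.t, q = (S.A ⟨i, h⟩).final
  Ad i q a q' := ∃ h : i < S.t, (S.A ⟨i, h⟩).Step q a q'
  t_pos := S.t_pos
  Mi_lt := by rintro _ rfl; exact Fin.is_lt _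
  Mf_lt := by rintro _ rfl; exact Fin.is_lt _
  Md_lt := fun ⟨hq, ha, hq', _⟩ => ⟨hq, ha, hq'⟩
  Ai_lt := by rintro _ _ ⟨h, rfl⟩; exact (Fin.is_lt _).trans_le (hlen _)
  Ad_lt := fun ⟨h, hq, _, hq', _⟩ => ⟨hq.trans_le (hlen _), hq'.trans_le (hlen _)⟩

/-! ### From words to certificates -/

section Projection

variable {α : Type} {t : ℕ}

theorem filter_flatMap_range {g : ℕ → List (α × Fin t)} (j : Fin t) :
    ∀ b, (∀ i < b, ∀ a ∈ g i, (a.2 : ℕ) = i) →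
      ((List.range b).flatMap g).filter (fun a => a.2 = j) = if (j : ℕ) < b then g j else []
  | 0, _ => by simp
  | b + 1, h => by
    rw [List.range_succ, List.flatMap_append, List.flatMap_singleton, List.filter_append,
      filter_flatMap_range j b fun i hi => h i (by omega)]
    rcases lt_trichotomy (j : ℕ) b with hj | hj | hj
    · rw [if_pos hj, if_pos (by omega), List.filter_eq_nil_iff.2, List.append_nil]
      intro a ha e
      simp only [decide_eq_true_eq] at e
      have := h b (by omega) a ha
      rw [e] at this; omega
    · rw [if_neg (by omega), if_pos (by omega), List.nil_append, ← hj, List.filter_eq_self]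
      intro a ha
      rw [hj] at ha
      simp only [decide_eq_true_eq]
      exact Fin.ext ((h b (by omega) a ha).trans hj.symm)
    · rw [if_neg (by omega), if_neg (by omega), List.filter_eq_nil_iff.2, List.append_nil]
      intro a ha e
      simp only [decide_eq_true_eq] at e
      have := h b (by omega) a ha
      rw [e] at this; omega

theorem filter_rounds {c : ℕ → List (α × Fin t)} (j : Fin t) :
    ∀ cs, (∀ n < cs * t, ∀ a ∈ c n, (a.2 : ℕ) = n % t) →
      ((List.range (cs * t)).flatMap c).filter (fun a => a.2 = j) =
        (List.range cs).flatMap fun r => c (r * t + j)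
  | 0, _ => by simp
  | cs + 1, h => by
    have ih := filter_rounds (c := c) j cs fun n hn => h n (by rw [add_mul]; omega)
    rw [add_mul, one_mul, List.range_add, List.flatMap_append, List.filter_append, ih,
      List.range_succ, List.flatMap_append, List.flatMap_singleton, List.flatMap_map,
      filter_flatMap_range j t, if_pos j.2]
    intro i hi a ha
    rw [h (cs * t + i) (by rw [add_mul]; omega) a ha, Nat.mul_add_mod', Nat.mod_eq_of_lt hi]

end Projection

/-- For `cs ≥ 1` every thread has a nonempty context, so the alternative of an empty projection in
`shuffle` never applies, and the projection to thread `j` consists of the contexts number `r * t +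
j`. -/
theorem SMCP.mem_lang_iff (S : SMCP) {cs : ℕ} (hcs : 1 ≤ cs) {u : List (Fin S.ops × Fin S.t)}
    {c : ℕ → List (Fin S.ops × Fin S.t)} (h : Contexts u (cs * S.t) c (· % S.t)) :
    u ∈ S.lang ↔
      IsPath S.M.Step S.M.init
        ((List.range (cs * S.t)).flatMap fun n => (c n).map fun a => (a.1 : ℕ)) S.M.final ∧
      ∀ j, IsPath (S.A j).Step (S.A j).init
        ((List.range cs).flatMap fun r => (c (r * S.t + j)).map fun a => (a.1 : ℕ))
          (S.A j).final := by
  have hmap : ∀ {v : List (Fin S.ops × Fin S.t)} {k : ℕ} {d : ℕ → List (Fin S.ops × Fin S.t)},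
      v = (List.range k).flatMap d →
      (v.map Prod.fst).map Fin.val = (List.range k).flatMap fun n => (d n).map fun a => (a.1 : ℕ) := by
    rintro v k d rfl
    simp [List.map_flatMap, Function.comp_def]
  have hfilter : ∀ j : Fin S.t, u.filter (fun a => a.2 = j) =
      (List.range cs).flatMap fun r => c (r * S.t + j) := by
    intro j
    rw [h.eq]
    exact filter_rounds j cs h.thread
  have hne : ∀ j : Fin S.t, u.filter (fun a => a.2 = j) ≠ [] := by
    intro j e
    rw [hfilter, List.flatMap_eq_nil_iff] at e
    have hlt : 0 * S.t + (j : ℕ) < cs * S.t := by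
      rw [zero_mul, zero_add]; exact j.2.trans_le (Nat.le_mul_of_pos_left _ hcs)
    exact h.ne _ hlt (e 0 (List.mem_range.2 hcs))
  have hthread : ∀ j : Fin S.t, ∀ a ∈ u.filter (fun a => a.2 = j), a.2 = j := by
    intro j a ha
    simpa using (List.mem_filter.1 ha).2
  refine and_congr ?_ (forall_congr' fun j => ?_)
  · rw [S.M.mem_accepts_iff, hmap h.eq]
  · rw [or_iff_left (hne j)]
    refine (and_iff_right (hthread j)).trans ?_
    rw [(S.A j).mem_accepts_iff, hmap (hfilter j)]

/-- Cutting the runs of the memory and of the threads at the context boundaries yields `st` and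
`th`; conversely the words of the blocks, placed at the positions `r * t + j`, form the word. A
certificate does not see that contexts of the same thread would merge when `t = 1`, hence the side
condition. -/
theorem SMCP.bcslRR_iff (S : SMCP) {cs : ℕ} (hcs : 1 ≤ cs) {len : ℕ}
    (hlen : ∀ i, (S.A i).n ≤ len) :
    BCSLRR S cs ↔ (S.t = 1 → cs = 1) ∧ ∃ st th, (S.toSys len hlen).IsCert cs st th := by
  have ht := S.t_pos
  constructor
  · rintro ⟨u, hu, hr⟩
    obtain ⟨c, hc⟩ := (mem_roundRobin_iff ht).1 hr
    obtain ⟨hM, hA⟩ := (S.mem_lang_iff hcs hc).1 hu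
    obtain ⟨s, hs0, hsn, hs⟩ := IsPath.flatMap_iff.1 hM
    have hA' := fun j => IsPath.flatMap_iff.1 (hA j)
    choose th h0 hn hth using hA'
    refine ⟨fun h1 => ?_, fun j r => s (r * S.t + j),
      fun j r => if h : j < S.t then th ⟨j, h⟩ r else 0, ?_, ?_, ?_, ?_, ?_, ?_⟩
    · by_contra hne
      have := hc.switch 0 (by rw [h1]; omega)
      simp [h1] at this
    · show s (0 * S.t + 0) = _
      simpa using hs0
    · show s (cs * S.t + 0) = _
      simpa using hsn
    · intro r _
      show s (r * S.t + S.t) = s ((r + 1) * S.t + 0)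
      congr 1; ring
    · intro j hj
      have hj : j < S.t := hj
      exact ⟨hj, by simpa [hj] using h0 ⟨j, hj⟩⟩
    · intro j hj
      have hj : j < S.t := hj
      exact ⟨hj, by simpa [hj] using hn ⟨j, hj⟩⟩
    · intro j hj r hr
      have hj : j < S.t := hj
      have hlt : r * S.t + j < cs * S.t := by nlinarith
      refine ⟨(c (r * S.t + j)).map fun a => (a.1 : ℕ), by simpa using hc.ne _ hlt, ?_, ?_⟩
      · have := hs _ hlt
        rwa [add_assoc] at this
      · have hd : ∀ r, (if h : j < S.t then th ⟨j, h⟩ r else 0) = th ⟨j, hj⟩ r := by simp [hj]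
        have hstep : (S.toSys len hlen).Ad j = (S.A ⟨j, hj⟩).Step := by
          funext q a q'
          exact propext ⟨fun ⟨_, h⟩ => h, fun h => ⟨hj, h⟩⟩
        rw [hstep]
        simpa only [hd] using hth ⟨j, hj⟩ r hr
  · rintro ⟨h1, st, th, h⟩
    have hb : ∀ (j : Fin S.t) (r : ℕ), ∃ w : List (Fin S.ops), r < cs → w ≠ [] ∧
        IsPath S.M.Step (st j r) (w.map Fin.val) (st (j + 1) r) ∧
        IsPath (S.A j).Step (th j r) (w.map Fin.val) (th j (r + 1)) := by
      intro j r
      by_cases hr : r < cs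
      · obtain ⟨w, hw, hM, hA⟩ := h.block j j.2 r hr
        obtain ⟨v, rfl⟩ := S.M.exists_map_eq hM
        have hstep : (S.toSys len hlen).Ad j = (S.A j).Step := by
          funext q a q'
          exact propext ⟨fun ⟨_, h⟩ => h, fun h => ⟨j.2, h⟩⟩
        rw [hstep] at hA
        exact ⟨v, fun _ => ⟨by simpa using hw, hM, hA⟩⟩
      · exact ⟨[], fun h => absurd h hr⟩
    choose w hw using hb
    let J : ℕ → Fin S.t := fun n => ⟨n % S.t, Nat.mod_lt _ ht⟩
    have hJ : ∀ r (j : Fin S.t), J (r * S.t + j) = j := fun r j =>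
      Fin.ext (by simp [J, Nat.mod_eq_of_lt j.2])
    have hdiv : ∀ r (j : Fin S.t), (r * S.t + j) / S.t = r := fun r j => by
      rw [mul_comm, Nat.mul_add_div ht, Nat.div_eq_of_lt j.2, add_zero]
    have hlt : ∀ n < cs * S.t, n / S.t < cs := fun n hn => Nat.div_lt_of_lt_mul (by rwa [mul_comm])
    let c : ℕ → List (Fin S.ops × Fin S.t) := fun n => (w (J n) (n / S.t)).map fun a => (a, J n)
    have hcmap : ∀ n, (c n).map (fun a => (a.1 : ℕ)) = (w (J n) (n / S.t)).map Fin.val := by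
      intro n
      simp [c, Function.comp_def]
    have hc : Contexts ((List.range (cs * S.t)).flatMap c) (cs * S.t) c (· % S.t) := by
      refine ⟨rfl, fun n hn => ?_, fun n hn a ha => ?_, fun n hn e => ?_⟩
      · simpa [c] using (hw (J n) (n / S.t) (hlt n hn)).1
      · obtain ⟨b, -, rfl⟩ := List.mem_map.1 ha
        rfl
      · have := succ_mod_cases (t := S.t) (n := n) ht
        have h2 : S.t = 1 := by omega
        have := h1 h2
        rw [h2, this] at hn
        omega
    refine ⟨_, (S.mem_lang_iff hcs hc).2 ⟨?_, fun j => ?_⟩, (mem_roundRobin_iff ht).2 ⟨c, hc⟩⟩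
    · refine IsPath.flatMap_iff.2 ⟨fun n => st (n % S.t) (n / S.t), ?_, ?_, fun n hn => ?_⟩
      · show st (0 % S.t) (0 / S.t) = _
        rw [Nat.zero_mod, Nat.zero_div]; exact h.init
      · show st (cs * S.t % S.t) (cs * S.t / S.t) = _
        rw [Nat.mul_mod_left, Nat.mul_div_cancel _ ht]; exact h.final
      · rw [hcmap]
        have := (hw (J n) (n / S.t) (hlt n hn)).2.1
        -- Behind thread `t - 1` the indices wrap to thread `0` of the following round; there the
        -- field `next` of the certificate is needed.
        have hnext : st (n % S.t + 1) (n / S.t) = st ((n + 1) % S.t) ((n + 1) / S.t) := by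
          have hd := Nat.div_add_mod' n S.t
          have hd' := Nat.div_add_mod' (n + 1) S.t
          rcases succ_mod_cases (t := S.t) (n := n) ht with ⟨e1, e2⟩ | ⟨e1, e2⟩
          · rw [e2, Nat.succ_div_of_not_dvd (fun hdvd => by
              have := Nat.mod_eq_zero_of_dvd hdvd; omega)]
          · rw [e2, e1, Nat.succ_div_of_dvd (Nat.dvd_of_mod_eq_zero e2)]
            exact h.next _ (hlt n hn)
        simp only [← hnext]
        exact this
    · refine IsPath.flatMap_iff.2 ⟨th j, ?_, ?_, fun r hr => ?_⟩
      · obtain ⟨_, h⟩ := h.thread_init j j.2; exact h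
      · obtain ⟨_, h⟩ := h.thread_final j j.2; exact h
      · rw [hcmap, hJ, hdiv]
        exact (hw j r hr).2.2

theorem SMCP.bcslRR_zero (S : SMCP) : BCSLRR S 0 ↔ S.M.init = S.M.final := by
  constructor
  · rintro ⟨u, ⟨hM, -⟩, c, φ, h, -⟩
    obtain rfl : u = [] := by
      rw [h.eq_flatten, List.flatten_eq_nil_iff]
      intro l hl
      obtain ⟨i, -⟩ := (List.mem_ofFn).1 hl
      exact absurd i.2 (by simp)
    rw [Aut.mem_accepts_iff] at hM
    exact Fin.ext hM
  · intro e
    refine ⟨[], ⟨?_, fun i => Or.inr rfl⟩, fun i => [], fun i => ⟨0, S.t_pos⟩, ⟨?_, ?_, ?_, ?_⟩, ?_⟩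
    · rw [Aut.mem_accepts_iff]; exact congrArg Fin.val e
    · simp
    all_goals
      intro i
      exact absurd i.2 (by simp)

/-! ### Reduction of the number of rounds for a memory with one state -/

theorem Sys.Block.trans {Y : Sys} {j q a q' a' q'' a'' : ℕ} (h : Y.Block j q a q' a')
    (h' : Y.Block j q' a' q'' a'') : Y.Block j q a q'' a'' := by
  obtain ⟨w, hw, h1, h2⟩ := h
  obtain ⟨w', hw', h1', h2'⟩ := h'
  exact ⟨w ++ w', by simp [hw], IsPath.append_iff.2 ⟨_, h1, h1'⟩, IsPath.append_iff.2 ⟨_, h2, h2'⟩⟩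

theorem Sys.Block.lt {Y : Sys} {j q a q' a' : ℕ} (h : Y.Block j q a q' a') :
    q < Y.m ∧ a < Y.len ∧ q' < Y.m ∧ a' < Y.len := by
  obtain ⟨w, hw, h1, h2⟩ := h
  have key : ∀ {δ : ℕ → ℕ → ℕ → Prop} {b : ℕ}, (∀ {q a q'}, δ q a q' → q < b ∧ q' < b) →
      ∀ {w : List ℕ} {q q' : ℕ}, w ≠ [] → IsPath δ q w q' → q < b ∧ q' < b := by
    intro δ b hδ w
    induction w with
    | nil => intro q q' hw; exact absurd rfl hw
    | cons a w ih =>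
      rintro q q' - ⟨p, hp, h⟩
      rcases List.eq_nil_or_concat w with rfl | ⟨v, x, hv⟩
      · obtain rfl : p = q' := h
        exact hδ hp
      · exact ⟨(hδ hp).1, (ih (by simp [hv]) h).2⟩
  have k1 := key (fun h => ⟨(Y.Md_lt h).1, (Y.Md_lt h).2.2⟩) hw h1
  have k2 := key Y.Ad_lt hw h2
  exact ⟨k1.1, k2.1, k1.2, k2.2⟩

/-- In a transitive relation on `{0, …, len - 1}` the chains of any two lengths above `len` have
the same end points. -/
theorem chain_length {R : ℕ → ℕ → Prop} {len n n' : ℕ}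
    (htrans : ∀ {a b c}, R a b → R b c → R a c) (hlt : ∀ {a b}, R a b → a < len ∧ b < len)
    (hlen : 1 ≤ len) (hn : len ≤ n) (hn' : len ≤ n') {f : ℕ → ℕ}
    (hf : ∀ r < n, R (f r) (f (r + 1))) :
    ∃ g : ℕ → ℕ, g 0 = f 0 ∧ g n' = f n ∧ ∀ r < n', R (g r) (g (r + 1)) := by
  have hchain : ∀ i j, i < j → j ≤ n → R (f i) (f j) := by
    intro i j hij
    induction j, hij using Nat.le_induction with
    | base => intro h; exact hf i (by omega)
    | succ j hj ih => intro h; exact htrans (ih (by omega)) (hf j (by omega))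
  rcases le_total n' n with h | h
  -- Shortening: the first `n'` points are kept, and transitivity allows the last step to jump to
  -- the end point.
  · refine ⟨fun r => if r < n' then f r else f n, by simp; omega, by simp, fun r hr => ?_⟩
    simp only [hr, if_true]
    split_ifs with h1
    · exact hf r (by omega)
    · exact hchain r n (by omega) le_rfl
  -- Lengthening: among `n + 1 > len` points two coincide, and transitivity turns the part between
  -- them into a loop at `f i`, which is inserted `n' - n` times.
  · obtain ⟨i, j, hij, hj, he⟩ : ∃ i j, i < j ∧ j ≤ n ∧ f i = f j := by
      have hmaps : ∀ r ∈ Finset.range (n + 1), f r ∈ Finset.range len := by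
        intro r hr
        have hr := Finset.mem_range.1 hr
        rw [Finset.mem_range]
        rcases Nat.lt_or_ge r n with h1 | h1
        · exact (hlt (hf r h1)).1
        · obtain rfl : r = n := by omega
          have := (hlt (hf (r - 1) (by omega))).2
          rwa [Nat.sub_add_cancel (by omega)] at this
      obtain ⟨i, hi, j, hj, hne, he⟩ := Finset.exists_ne_map_eq_of_card_lt_of_maps_to
        (by simp; omega) hmaps
      simp only [Finset.mem_range] at hi hj
      rcases lt_or_gt_of_ne hne with h1 | h1
      · exact ⟨i, j, h1, by omega, he⟩
      · exact ⟨j, i, h1, by omega, he.symm⟩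
    have hloop : R (f i) (f i) := by
      have := hchain i j hij hj
      rwa [← he] at this
    refine ⟨fun r => if r ≤ i then f r else if r ≤ i + (n' - n) then f i else f (r - (n' - n)),
      by simp, ?_, fun r hr => ?_⟩
    · dsimp only
      rw [if_neg (by omega)]
      split_ifs with h1
      · omega
      · congr 1; omega
    · dsimp only
      split_ifs with h1 h2 h3 h4 h5 h6
      · exact hf r (by omega)
      · obtain rfl : r = i := by omega
        exact hloop
      · obtain rfl : r = i := by omega
        have : n' - n = 0 := by omega
        rw [this]
        exact hf r (by omega)
      · omega
      · exact hloop
      · obtain rfl : r = i + (n' - n) := by omega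
        have : i + (n' - n) + 1 - (n' - n) = i + 1 := by omega
        rw [this]
        exact hf i (by omega)
      · omega
      · omega
      · have : r + 1 - (n' - n) = r - (n' - n) + 1 := by omega
        rw [this]
        exact hf _ (by omega)

/-- With one memory state the threads do not constrain each other. The states of thread `j` form a
chain for the transitive relation of being linked by a block from `0` to `0`, and each chain is
brought to the new length separately. -/
theorem Sys.IsCert.change_rounds {Y : Sys} (hm : Y.m = 1) (hlen : 1 ≤ Y.len) {c c' : ℕ}
    (hc : Y.len ≤ c) (hc' : Y.len ≤ c') {st th : ℕ → ℕ → ℕ} (h : Y.IsCert c st th) :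
    ∃ st th, Y.IsCert c' st th := by
  have hst : ∀ j < Y.t, ∀ r < c, Y.Block j 0 (th j r) 0 (th j (r + 1)) := by
    intro j hj r hr
    have hb := h.block j hj r hr
    have := hb.lt
    rw [hm] at this
    obtain ⟨h1, -, h2, -⟩ := this
    rwa [Nat.lt_one_iff.1 h1, Nat.lt_one_iff.1 h2] at hb
  have key : ∀ j, ∃ g : ℕ → ℕ, j < Y.t → g 0 = th j 0 ∧ g c' = th j c ∧
      ∀ r < c', Y.Block j 0 (g r) 0 (g (r + 1)) := by
    intro j
    by_cases hj : j < Y.t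
    · obtain ⟨g, hg⟩ := chain_length (R := fun a b => Y.Block j 0 a 0 b) (n := c) (n' := c')
        (fun h1 h2 => h1.trans h2) (fun h => ⟨h.lt.2.1, h.lt.2.2.2⟩) hlen hc hc' (hst j hj)
      exact ⟨g, fun _ => hg⟩
    · exact ⟨id, fun h => absurd h hj⟩
  choose g hg using key
  have hi := h.init
  have hf := h.final
  have hi0 := Y.Mi_lt hi
  have hf0 := Y.Mf_lt hf
  rw [hm, Nat.lt_one_iff] at hi0 hf0
  rw [hi0] at hi
  rw [hf0] at hf
  refine ⟨fun _ _ => 0, g, hi, hf, fun _ _ => rfl, fun j hj => ?_, fun j hj => ?_,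
    fun j hj => (hg j hj).2.2⟩
  · rw [(hg j hj).1]; exact h.thread_init j hj
  · rw [(hg j hj).2.1]; exact h.thread_final j hj


/-! ### Numbers as digit vectors -/

/-- The number with the digits `f 0, …, f (n - 1)` in base `m`, least significant digit first. -/
def num (m : ℕ) : ℕ → (ℕ → ℕ) → ℕ
  | 0, _ => 0
  | n + 1, f => f 0 + m * num m n (fun r => f (r + 1))

section num

variable {m n : ℕ} {f g : ℕ → ℕ}

theorem num_congr (h : ∀ r < n, f r = g r) : num m n f = num m n g := by
  induction n generalizing f g with
  | zero => rfl
  | succ n ih => rw [num, num, h 0 (by omega), ih fun r hr => h (r + 1) (by omega)]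

theorem num_succ_top : num m (n + 1) f = num m n f + f n * m ^ n := by
  induction n generalizing f with
  | zero => simp [num]
  | succ n ih => rw [num, ih, num]; ring

theorem num_lt (h : ∀ r < n, f r < m) : num m n f < m ^ n := by
  induction n generalizing f with
  | zero => simp [num]
  | succ n ih =>
    have h0 := h 0 (by omega)
    have h1 : num m n (fun r => f (r + 1)) + 1 ≤ m ^ n := ih fun r hr => h (r + 1) (by omega)
    rw [num, pow_succ]
    calc _ < m + m * num m n (fun r => f (r + 1)) := by omega
      _ = (num m n (fun r => f (r + 1)) + 1) * m := by ring
      _ ≤ _ := Nat.mul_le_mul_right m h1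

theorem num_inj (hf : ∀ r < n, f r < m) (hg : ∀ r < n, g r < m) (h : num m n f = num m n g) :
    ∀ r < n, f r = g r := by
  induction n generalizing f g with
  | zero => simp
  | succ n ih =>
    have hf0 := hf 0 (by omega)
    have hg0 := hg 0 (by omega)
    rw [num, num] at h
    have h0 : f 0 = g 0 := by
      have := congrArg (· % m) h
      simpa [Nat.mod_eq_of_lt hf0, Nat.mod_eq_of_lt hg0] using this
    rw [h0, Nat.add_left_cancel_iff] at h
    have h1 := Nat.eq_of_mul_eq_mul_left (by omega) h
    rintro (_ | r) hr
    · exact h0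
    · exact ih (fun r hr => hf (r + 1) (by omega)) (fun r hr => hg (r + 1) (by omega)) h1 r
        (by omega)

end num

/-- The digits for round `k` of a thread, where the memory states before the thread are `f` and
those after it are `g`: first the rounds from `k` on, then the finished ones. -/
def digits (c k : ℕ) (f g : ℕ → ℕ) (r : ℕ) : ℕ := if r + k < c then f (r + k) else g (r + k - c)

section digits

variable {m c k : ℕ} {f g : ℕ → ℕ}

theorem num_digits (hk : k < c) :
    num m c (digits c k f g) = f k + m * num m (c - 1) (fun r => digits c k f g (r + 1)) := by
  obtain ⟨c, rfl⟩ : ∃ c', c = c' + 1 := ⟨c - 1, by omega⟩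
  rw [num, digits, if_pos (by omega), zero_add, Nat.add_sub_cancel]

/-- Together with `num_digits` this is the queue operation at the end of round `k`: the lowest digit
`f k` is dropped, and `g k` enters as the top digit. -/
theorem num_digits_succ (hc : 1 ≤ c) :
    num m c (digits c (k + 1) f g) =
      num m (c - 1) (fun r => digits c k f g (r + 1)) + g k * m ^ (c - 1) := by
  obtain ⟨c, rfl⟩ : ∃ c', c = c' + 1 := ⟨c - 1, by omega⟩
  rw [num_succ_top, Nat.add_sub_cancel, digits, if_neg (by omega)]
  congr 1
  · refine num_congr fun r hr => ?_
    simp only [digits]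
    rw [(by omega : r + (k + 1) = r + 1 + k)]
  · congr 2; omega

theorem digits_zero {r : ℕ} (hr : r < c) : digits c 0 f g r = f r := by
  rw [digits, add_zero, if_pos hr]

/-- After `c` rounds the queue has turned over completely, and the states left by one thread are
those in which the next one starts. -/
theorem num_digits_self {f' : ℕ → ℕ} : num m c (digits c c f' f) = num m c (digits c 0 f g) := by
  refine num_congr fun r hr => ?_
  rw [digits_zero hr, digits, if_neg (by omega), Nat.add_sub_cancel]

end digits

/-! ### The search graph -/

/-- Node of the search graph: the current thread, its round, the memory states of all rounds and
the state of the thread. -/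
structure Node where
  i : ℕ
  k : ℕ
  v : ℕ
  a : ℕ

namespace Sys

variable (Y : Sys) (c : ℕ)

/-- The current memory state is `v % Y.m`. A context is ended by the step that reads its last
letter, so no context is empty. In `last` the initial state of the next thread is guessed along with
the step; once all threads are done, `a''` is an arbitrary filler. -/
inductive Step : Node → Node → Prop
  | stay {i k v a σ q' a' : ℕ} : i < Y.t → Y.Md (v % Y.m) σ q' → Y.Ad i a σ a' →
      Step ⟨i, k, v, a⟩ ⟨i, k, v - v % Y.m + q', a'⟩
  | next {i k v a σ q' a' : ℕ} : i < Y.t → Y.Md (v % Y.m) σ q' → Y.Ad i a σ a' → k + 1 < c →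
      Step ⟨i, k, v, a⟩ ⟨i, k + 1, v / Y.m + q' * Y.m ^ (c - 1), a'⟩
  | last {i k v a σ q' a' a'' : ℕ} : i < Y.t → Y.Md (v % Y.m) σ q' → Y.Ad i a σ a' → k + 1 = c →
      Y.Af i a' → a'' < Y.len → (i + 1 = Y.t ∨ Y.Ai (i + 1) a'') →
      Step ⟨i, k, v, a⟩ ⟨i + 1, 0, v / Y.m + q' * Y.m ^ (c - 1), a''⟩

def Start (p : ℕ) (x : Node) : Prop :=
  x.i = 0 ∧ x.k = 0 ∧ x.v = p ∧ Y.Mi (p % Y.m) ∧ Y.Ai 0 x.a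

/-- The digits of `p / Y.m` are the guessed states at the start of all rounds but the first. They
must be the states in which the last thread ends all rounds but the last; the top digit of `x.v` is
the memory state after the whole word. -/
def Accept (p : ℕ) (x : Node) : Prop :=
  x.i = Y.t ∧ x.k = 0 ∧ x.v % Y.m ^ (c - 1) = p / Y.m ∧ Y.Mf (x.v / Y.m ^ (c - 1))

/-- Some accepting node is reachable from a start node. -/
def Reachable : Prop :=
  ∃ p < Y.m ^ c, ∃ x y, Y.Start p x ∧ Relation.ReflTransGen (Y.Step c) x y ∧ Y.Accept c p y

variable {Y c}

theorem stay_path {i k h : ℕ} (hi : i < Y.t) {w : List ℕ} : ∀ {q a q' a' : ℕ}, q < Y.m →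
    IsPath Y.Md q w q' → IsPath (Y.Ad i) a w a' →
      Relation.ReflTransGen (Y.Step c) ⟨i, k, q + Y.m * h, a⟩ ⟨i, k, q' + Y.m * h, a'⟩ := by
  induction w with
  | nil =>
    rintro q a q' a' - h1 h2
    obtain rfl : q = q' := h1
    obtain rfl : a = a' := h2
    exact .refl
  | cons σ w ih =>
    rintro q a q' a' hq ⟨p, h1, h1'⟩ ⟨b, h2, h2'⟩
    have hmod : (q + Y.m * h) % Y.m = q := by rw [Nat.add_mul_mod_self_left, Nat.mod_eq_of_lt hq]
    have hs := Step.stay (Y := Y) (c := c) (k := k) (v := q + Y.m * h) hi (by rwa [hmod]) h2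
    rw [hmod, Nat.add_sub_cancel_left, add_comm _ p] at hs
    exact .head hs (ih (Y.Md_lt h1).2.2 h1' h2')

theorem Block.exists_last {j q a q' a' : ℕ} (h : Y.Block j q a q' a') :
    ∃ w σ p b, IsPath Y.Md q w p ∧ IsPath (Y.Ad j) a w b ∧ Y.Md p σ q' ∧ Y.Ad j b σ a' := by
  obtain ⟨w, hw, h1, h2⟩ := h
  obtain ⟨v, σ, rfl⟩ := (List.eq_nil_or_concat w).resolve_left hw
  rw [List.concat_eq_append, IsPath.append_iff] at h1 h2
  obtain ⟨p, h1, p', hp, rfl⟩ := h1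
  obtain ⟨b, h2, b', hb, rfl⟩ := h2
  exact ⟨v, σ, p, b, h1, h2, hp, hb⟩

theorem Block.snoc {j q a p b σ q' a' : ℕ} {w : List ℕ} (h1 : IsPath Y.Md q w p)
    (h2 : IsPath (Y.Ad j) a w b) (hp : Y.Md p σ q') (hb : Y.Ad j b σ a') : Y.Block j q a q' a' :=
  ⟨w ++ [σ], by simp, IsPath.append_iff.2 ⟨p, h1, q', hp, rfl⟩,
    IsPath.append_iff.2 ⟨b, h2, a', hb, rfl⟩⟩

/-- The start number is read off from `st 0`. The search then follows the certificate, with the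
queue `digits c k (st i) (st (i + 1))` at the start of round `k` of thread `i`. The equations `next`
become the shift demanded by `Accept`. -/
theorem IsCert.reachable {st th : ℕ → ℕ → ℕ} (hc : 1 ≤ c) (h : Y.IsCert c st th) :
    Y.Reachable c := by
  have hlt : ∀ j < Y.t, ∀ r < c, st j r < Y.m ∧ st (j + 1) r < Y.m := fun j hj r hr =>
    ⟨(h.block j hj r hr).lt.1, (h.block j hj r hr).lt.2.2.1⟩
  have ht := Y.t_pos
  let x0 : Node := ⟨0, 0, num Y.m c (digits c 0 (st 0) (st 1)), th 0 0⟩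
  have hround : ∀ i < Y.t,
      Relation.ReflTransGen (Y.Step c) x0
        ⟨i, 0, num Y.m c (digits c 0 (st i) (st (i + 1))), th i 0⟩ →
      ∀ k < c, Relation.ReflTransGen (Y.Step c) x0
        ⟨i, k, num Y.m c (digits c k (st i) (st (i + 1))), th i k⟩ := by
    intro i hi h0 k
    induction k with
    | zero => exact fun _ => h0
    | succ k ih =>
      intro hk
      refine (ih (by omega)).trans ?_
      obtain ⟨w, σ, p, b, h1, h2, h3, h4⟩ := (h.block i hi k (by omega)).exists_last
      rw [num_digits (by omega), num_digits_succ hc]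
      refine (stay_path hi (hlt i hi k (by omega)).1 h1 h2).tail ?_
      have hp := (Y.Md_lt h3).1
      have hs := Step.next (Y := Y) (c := c) (k := k)
        (v := p + Y.m * num Y.m (c - 1) (fun r => digits c k (st i) (st (i + 1)) (r + 1))) hi
        (by rwa [Nat.add_mul_mod_self_left, Nat.mod_eq_of_lt hp]) h4 hk
      rwa [Nat.add_mul_div_left _ _ (by omega), Nat.div_eq_of_lt hp, zero_add] at hs
  have hlen : 0 < Y.len := by have := Y.Ai_lt (h.thread_init 0 ht); omega
  have hlast : ∀ i < Y.t,
      Relation.ReflTransGen (Y.Step c) x0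
        ⟨i, 0, num Y.m c (digits c 0 (st i) (st (i + 1))), th i 0⟩ →
      ∀ a'' < Y.len, (i + 1 = Y.t ∨ Y.Ai (i + 1) a'') → Relation.ReflTransGen (Y.Step c) x0
        ⟨i + 1, 0, num Y.m c (digits c 0 (st (i + 1)) (st (i + 2))), a''⟩ := by
    intro i hi h0 a'' ha hor
    refine (hround i hi h0 (c - 1) (by omega)).trans ?_
    obtain ⟨w, σ, p, b, h1, h2, h3, h4⟩ := (h.block i hi (c - 1) (by omega)).exists_last
    rw [← num_digits_self (f' := st i), num_digits (by omega)]
    refine (stay_path hi (hlt i hi (c - 1) (by omega)).1 h1 h2).tail ?_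
    have hp := (Y.Md_lt h3).1
    have hs := Step.last (Y := Y) (c := c) (k := c - 1)
      (v := p + Y.m * num Y.m (c - 1) (fun r => digits c (c - 1) (st i) (st (i + 1)) (r + 1))) hi
      (by rwa [Nat.add_mul_mod_self_left, Nat.mod_eq_of_lt hp]) h4 (by omega)
      (by rw [Nat.sub_add_cancel hc]; exact h.thread_final i hi) ha hor
    rw [Nat.add_mul_div_left _ _ (by omega), Nat.div_eq_of_lt hp, zero_add,
      ← num_digits_succ hc, Nat.sub_add_cancel hc] at hs
    exact hs
  have hthread : ∀ i < Y.t, Relation.ReflTransGen (Y.Step c) x0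
      ⟨i, 0, num Y.m c (digits c 0 (st i) (st (i + 1))), th i 0⟩ := by
    intro i
    induction i with
    | zero => exact fun _ => .refl
    | succ i ih =>
      intro hi
      exact hlast i (by omega) (ih (by omega)) _ (Y.Ai_lt (h.thread_init (i + 1) hi))
        (Or.inr (h.thread_init (i + 1) hi))
  -- The state `0` is a filler, since no thread `t` exists.
  have hend := hlast (Y.t - 1) (by omega) (hthread _ (by omega)) 0 hlen (Or.inl (by omega))
  rw [Nat.sub_add_cancel ht] at hend
  have hd0 : num Y.m c (digits c 0 (st 0) (st 1)) = num Y.m c (st 0) :=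
    num_congr fun r hr => digits_zero hr
  have hdt : num Y.m c (digits c 0 (st Y.t) (st (Y.t - 1 + 2))) = num Y.m c (st Y.t) :=
    num_congr fun r hr => digits_zero hr
  have htlt : ∀ r < c, st Y.t r < Y.m := by
    intro r hr
    have := (hlt (Y.t - 1) (by omega) r hr).2
    rwa [Nat.sub_add_cancel ht] at this
  have hm : 0 < Y.m := by have := Y.Mi_lt h.init; omega
  have hbot : num Y.m c (st 0) = st 0 0 + Y.m * num Y.m (c - 1) (fun r => st 0 (r + 1)) := by
    obtain ⟨c, rfl⟩ : ∃ c', c = c' + 1 := ⟨c - 1, by omega⟩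
    rfl
  have htop : num Y.m c (st Y.t) =
      num Y.m (c - 1) (fun r => st 0 (r + 1)) + st 0 c * Y.m ^ (c - 1) := by
    have hcong : num Y.m (c - 1) (fun r => st 0 (r + 1)) = num Y.m (c - 1) (st Y.t) :=
      num_congr fun r hr => (h.next r (by omega)).symm
    have h2 := h.next (c - 1) (by omega)
    rw [Nat.sub_add_cancel hc] at h2
    rw [hcong, ← h2, ← num_succ_top, Nat.sub_add_cancel hc]
  have hW : num Y.m (c - 1) (fun r => st 0 (r + 1)) < Y.m ^ (c - 1) :=
    num_lt fun r hr => (hlt 0 ht (r + 1) (by omega)).1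
  have hmod0 : num Y.m c (st 0) % Y.m = st 0 0 := by
    rw [hbot, Nat.add_mul_mod_self_left, Nat.mod_eq_of_lt (Y.Mi_lt h.init)]
  refine ⟨num Y.m c (st 0), num_lt fun r hr => (hlt 0 ht r hr).1, x0, _,
    ⟨rfl, rfl, hd0, by rw [hmod0]; exact h.init, h.thread_init 0 ht⟩, hend, rfl, rfl, ?_, ?_⟩
  · dsimp only
    rw [hdt, htop, Nat.add_mul_mod_self_right, Nat.mod_eq_of_lt hW, hbot,
      Nat.add_mul_div_left _ _ hm, Nat.div_eq_of_lt (Y.Mi_lt h.init), zero_add]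
  · dsimp only
    rw [hdt, htop, Nat.add_mul_div_right _ _ (by positivity), Nat.div_eq_of_lt hW, zero_add]
    exact h.final

/-- The part of a certificate that is found when thread `i` is in round `k`. -/
structure PartialCert (Y : Sys) (c p i k : ℕ) (st th : ℕ → ℕ → ℕ) : Prop where
  init : Y.Mi (st 0 0)
  start_lt : ∀ r < c, st 0 r < Y.m
  start : p = num Y.m c (st 0)
  thread_init : ∀ j ≤ i, j < Y.t → Y.Ai j (th j 0)
  thread_final : ∀ j < i, Y.Af j (th j c)
  block : ∀ j r, r < c → (j < i ∨ j = i ∧ r < k) →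
    Y.Block j (st j r) (th j r) (st (j + 1) r) (th j (r + 1))

/-- The new entries stand at `(i + 1, k)` of `st` and at `(i, k + 1)` of `th`, where neither the
start data nor any earlier block looks, so overwriting them is harmless. -/
theorem PartialCert.extend {p i k q a : ℕ} {st th : ℕ → ℕ → ℕ} (h : Y.PartialCert c p i k st th)
    (hb : Y.Block i (st i k) (th i k) q a) :
    Y.PartialCert c p i (k + 1) (fun j r => if j = i + 1 ∧ r = k then q else st j r)
      (fun j r => if j = i ∧ r = k + 1 then a else th j r) where
  init := by simpa using h.init
  start_lt r hr := by simpa using h.start_lt r hr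
  start := by simpa using h.start
  thread_init j hj hjt := by simpa using h.thread_init j hj hjt
  thread_final j hj := by simpa [hj.ne] using h.thread_final j hj
  block j r hr hjr := by
    rw [if_neg (show ¬ (j = i + 1 ∧ r = k) by omega),
      if_neg (show ¬ (j = i ∧ r = k + 1) by omega)]
    by_cases hjk : j = i ∧ r = k
    · obtain ⟨rfl, rfl⟩ := hjk
      simpa using hb
    · rw [if_neg (show ¬ (j + 1 = i + 1 ∧ r = k) by omega),
        if_neg (show ¬ (j = i ∧ r + 1 = k + 1) by omega)]
      exact h.block j r hr (by omega)

theorem PartialCert.next_thread {p i a : ℕ} {st th : ℕ → ℕ → ℕ}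
    (h : Y.PartialCert c p i c st th) (hf : Y.Af i (th i c)) (ha : i + 1 = Y.t ∨ Y.Ai (i + 1) a) :
    Y.PartialCert c p (i + 1) 0 st (fun j r => if j = i + 1 ∧ r = 0 then a else th j r) where
  init := h.init
  start_lt := h.start_lt
  start := h.start
  thread_init j hj hjt := by
    by_cases hji : j = i + 1
    · subst hji
      simpa using ha.resolve_left (by omega)
    · simpa [hji] using h.thread_init j (by omega) hjt
  thread_final j hj := by
    rw [if_neg (by omega)]
    rcases Nat.lt_or_ge j i with hji | hji
    · exact h.thread_final j hji
    · obtain rfl : j = i := by omega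
      exact hf
  block j r hr hjr := by
    rw [if_neg (by omega), if_neg (by omega)]
    exact h.block j r hr (by omega)

/-- What is known about a node that is reachable from a start node with number `p`. -/
def Explained (Y : Sys) (c p : ℕ) (x : Node) : Prop :=
  ∃ st th, Y.PartialCert c p x.i x.k st th ∧ x.k < c ∧ x.i ≤ Y.t ∧
    if x.i < Y.t then
      ∃ q w, q < Y.m ∧
        x.v = q + Y.m * num Y.m (c - 1) (fun r => digits c x.k (st x.i) (st (x.i + 1)) (r + 1)) ∧
        IsPath Y.Md (st x.i x.k) w q ∧ IsPath (Y.Ad x.i) (th x.i x.k) w x.a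
    else x.k = 0 ∧ x.v = num Y.m c (st x.i)

/-- The word `w` read so far in the current context grows by one letter. When the context ends, the
letter makes the word nonempty and yields a block that extends the partial certificate; the equation
for the queue persists by `num_digits` and `num_digits_succ`. -/
theorem Explained.step {p : ℕ} {x y : Node} (hc : 1 ≤ c) (h : Y.Explained c p x)
    (hs : Y.Step c x y) : Y.Explained c p y := by
  obtain ⟨st, th, hp, hk, hi, hx⟩ := h
  cases hs with
  | @stay i k v a σ q' a' hit hM hA =>
    dsimp only at *
    rw [if_pos hit] at hx
    obtain ⟨q, w, hq, hv, h1, h2⟩ := hx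
    have hmod : v % Y.m = q := by rw [hv, Nat.add_mul_mod_self_left, Nat.mod_eq_of_lt hq]
    rw [hmod] at hM ⊢
    refine ⟨st, th, hp, hk, hi, ?_⟩
    dsimp only
    rw [if_pos hit]
    refine ⟨q', w ++ [σ], (Y.Md_lt hM).2.2, ?_, IsPath.append_iff.2 ⟨q, h1, q', hM, rfl⟩,
      IsPath.append_iff.2 ⟨a, h2, a', hA, rfl⟩⟩
    rw [hv, Nat.add_sub_cancel_left, add_comm]
  | @next i k v a σ q' a' hit hM hA hkc =>
    dsimp only at *
    rw [if_pos hit] at hx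
    obtain ⟨q, w, hq, hv, h1, h2⟩ := hx
    have hmod : v % Y.m = q := by rw [hv, Nat.add_mul_mod_self_left, Nat.mod_eq_of_lt hq]
    have hdiv : v / Y.m = num Y.m (c - 1) (fun r => digits c k (st i) (st (i + 1)) (r + 1)) := by
      rw [hv, Nat.add_mul_div_left _ _ (by omega), Nat.div_eq_of_lt hq, zero_add]
    rw [hmod] at hM
    have hp' := hp.extend (Block.snoc h1 h2 hM hA)
    refine ⟨_, _, hp', hkc, hi, ?_⟩
    dsimp only
    rw [if_pos hit]
    refine ⟨st i (k + 1), [], ?_, ?_, ?_, ?_⟩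
    -- The state in which the next round begins is a guessed digit for thread `0`, and the end of a
    -- block of thread `i - 1` otherwise; either way it is below `Y.m`.
    · rcases Nat.eq_zero_or_pos i with rfl | hi0
      · exact hp.start_lt _ hkc
      · have := (hp.block (i - 1) (k + 1) hkc (Or.inl (by omega))).lt.2.2.1
        rwa [Nat.sub_add_cancel hi0] at this
    · have e1 : ∀ r < c, digits c (k + 1) (fun r => if i = i + 1 ∧ r = k then q' else st i r)
          (fun r => if i + 1 = i + 1 ∧ r = k then q' else st (i + 1) r) r =
          digits c (k + 1) (st i) (fun r => if r = k then q' else st (i + 1) r) r := by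
        intro r hr; simp [digits]
      have e2 := num_digits (m := Y.m) (f := st i)
        (g := fun r => if r = k then q' else st (i + 1) r) hkc
      rw [num_digits_succ hc] at e2
      simp only [if_true] at e2
      have e3 : num Y.m (c - 1) (fun r => digits c k (st i)
          (fun r => if r = k then q' else st (i + 1) r) (r + 1)) =
          num Y.m (c - 1) (fun r => digits c k (st i) (st (i + 1)) (r + 1)) := by
        refine num_congr fun r hr => ?_
        simp only [digits]
        split_ifs with h3 h4
        · rfl
        · omega
        · rfl
      rw [e3, ← hdiv] at e2
      rw [e2]
      congr 2
      exact num_congr fun r hr => (e1 (r + 1) (by omega)).symm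
    · simp [IsPath]
    · simp [IsPath]
  | @last i k v a σ q' a' a'' hit hM hA hkc hf ha hor =>
    dsimp only at *
    rw [if_pos hit] at hx
    obtain ⟨q, w, hq, hv, h1, h2⟩ := hx
    have hmod : v % Y.m = q := by rw [hv, Nat.add_mul_mod_self_left, Nat.mod_eq_of_lt hq]
    have hdiv : v / Y.m = num Y.m (c - 1) (fun r => digits c k (st i) (st (i + 1)) (r + 1)) := by
      rw [hv, Nat.add_mul_div_left _ _ (by omega), Nat.div_eq_of_lt hq, zero_add]
    rw [hmod] at hM
    have hp' := hp.extend (Block.snoc h1 h2 hM hA)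
    rw [hkc] at hp'
    have hp'' := hp'.next_thread (by simpa using hf) hor
    have hnum : v / Y.m + q' * Y.m ^ (c - 1) =
        num Y.m c (fun r => if r = k then q' else st (i + 1) r) := by
      have e2 := num_digits_succ (m := Y.m) (f := st i) (k := k)
        (g := fun r => if r = k then q' else st (i + 1) r) hc
      simp only [if_true] at e2
      have e3 : num Y.m (c - 1) (fun r => digits c k (st i)
          (fun r => if r = k then q' else st (i + 1) r) (r + 1)) =
          num Y.m (c - 1) (fun r => digits c k (st i) (st (i + 1)) (r + 1)) := by
        refine num_congr fun r hr => ?_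
        simp only [digits]
        split_ifs with h3 h4
        · rfl
        · omega
        · rfl
      rw [e3, ← hdiv, hkc, num_digits_self (g := fun _ => 0)] at e2
      rw [← e2]
      exact num_congr fun r hr => digits_zero hr
    refine ⟨_, _, hp'', hc, hit, ?_⟩
    dsimp only
    by_cases hlt : i + 1 < Y.t
    · rw [if_pos hlt]
      refine ⟨if 0 = k then q' else st (i + 1) 0, [], ?_, ?_, ?_, ?_⟩
      · have := (hp''.block i 0 hc (Or.inl (by omega))).lt.2.2.1
        simpa using this
      · rw [hnum]
        have e4 := num_digits (m := Y.m) (k := 0)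
          (f := fun r => if r = k then q' else st (i + 1) r) (g := st (i + 1 + 1)) (c := c) hc
        have e5 : num Y.m c (digits c 0 (fun r => if r = k then q' else st (i + 1) r)
            (st (i + 1 + 1))) = num Y.m c (fun r => if r = k then q' else st (i + 1) r) :=
          num_congr fun r hr => digits_zero hr
        rw [← e5, e4]
        simp
      · simp [IsPath]
      · simp [IsPath]
    · rw [if_neg hlt]
      refine ⟨rfl, ?_⟩
      rw [hnum]
      simp

theorem Start.explained {p : ℕ} {x : Node} (hc : 1 ≤ c) (hp : p < Y.m ^ c) (h : Y.Start p x) :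
    Y.Explained c p x := by
  obtain ⟨hi, hk, hv, hM, hA⟩ := h
  have hm := Y.Mi_lt hM
  have surj : ∀ (n v : ℕ), v < Y.m ^ n → ∃ f : ℕ → ℕ, (∀ r < n, f r < Y.m) ∧ v = num Y.m n f := by
    intro n
    induction n with
    | zero => intro v hv; exact ⟨fun _ => 0, by simp, by simpa [num] using hv⟩
    | succ n ih =>
      intro v hv
      obtain ⟨f, hf, e⟩ := ih (v / Y.m) (Nat.div_lt_of_lt_mul (by rwa [← pow_succ']))
      refine ⟨fun r => if r = 0 then v % Y.m else f (r - 1), fun r hr => ?_, ?_⟩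
      · dsimp only
        split_ifs
        · exact Nat.mod_lt _ (by omega)
        · exact hf _ (by omega)
      · simp only [num, if_true, Nat.add_eq_zero_iff, one_ne_zero, and_false, if_false,
          Nat.add_sub_cancel]
        rw [← e, Nat.mod_add_div]
  obtain ⟨f, hf, e⟩ := surj c p hp
  have ht := Y.t_pos
  have e2 := num_digits (m := Y.m) (k := 0) (f := f) (g := f) (c := c) hc
  rw [num_congr (g := f) fun r hr => digits_zero hr, ← e] at e2
  have h0 : p % Y.m = f 0 := by
    rw [e2, Nat.add_mul_mod_self_left, Nat.mod_eq_of_lt (hf 0 hc)]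
  refine ⟨fun _ => f, fun _ _ => x.a, ⟨by rwa [← h0], hf, e, ?_, ?_, ?_⟩, by omega, by omega, ?_⟩
  · intro j hj _
    obtain rfl : j = 0 := by omega
    exact hA
  · intro j hj; omega
  · intro j r _ hjr; omega
  · rw [if_pos (by omega)]
    refine ⟨f 0, [], hf 0 hc, ?_, ?_, ?_⟩
    · rw [hv, hk]; exact e2
    · rw [hk]; rfl
    · rfl

/-- At an accepting node the partial certificate covers all threads. Only the equations `next` are
missing, and uniqueness of digits (`num_inj`) extracts them from the equality of `v % m ^ (c - 1)`
and `p / m`. -/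
theorem Reachable.exists_cert (hc : 1 ≤ c) (h : Y.Reachable c) : ∃ st th, Y.IsCert c st th := by
  obtain ⟨p, hp, x, y, hs, hr, hi, hk, hmod, hdiv⟩ := h
  have hex : Y.Explained c p y := by
    clear hi hk hmod hdiv
    induction hr with
    | refl => exact hs.explained hc hp
    | tail _ h ih => exact ih.step hc h
  obtain ⟨st, th, hpc, -, -, hy⟩ := hex
  rw [if_neg (by omega)] at hy
  obtain ⟨-, hv⟩ := hy
  rw [hi] at hv hpc
  have ht := Y.t_pos
  have htlt : ∀ r < c, st Y.t r < Y.m := by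
    intro r hr
    have := (hpc.block (Y.t - 1) r hr (Or.inl (by omega))).lt.2.2.1
    rwa [Nat.sub_add_cancel ht] at this
  have hW : num Y.m (c - 1) (st Y.t) < Y.m ^ (c - 1) := num_lt fun r hr => htlt r (by omega)
  have htop : y.v = num Y.m (c - 1) (st Y.t) + st Y.t (c - 1) * Y.m ^ (c - 1) := by
    rw [hv, ← num_succ_top, Nat.sub_add_cancel hc]
  have hbot : p = st 0 0 + Y.m * num Y.m (c - 1) (fun r => st 0 (r + 1)) := by
    rw [hpc.start]
    obtain ⟨c, rfl⟩ : ∃ c', c = c' + 1 := ⟨c - 1, by omega⟩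
    rfl
  have h0 := hpc.start_lt 0 hc
  rw [htop, Nat.add_mul_mod_self_right, Nat.mod_eq_of_lt hW, hbot,
    Nat.add_mul_div_left _ _ (by omega), Nat.div_eq_of_lt h0, zero_add] at hmod
  rw [htop, Nat.add_mul_div_right _ _ (by omega), Nat.div_eq_of_lt hW, zero_add] at hdiv
  have hnext := num_inj (fun r hr => htlt r (by omega))
    (fun r hr => hpc.start_lt (r + 1) (by omega)) hmod
  -- The vector `p` says nothing about `st 0 c`, the state after the last round; it is set to the
  -- state in which the last context ends.
  refine ⟨fun j r => if j = 0 ∧ r = c then st Y.t (c - 1) else st j r, th, ?_, ?_, ?_, ?_, ?_, ?_⟩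
  · rw [if_neg (by omega)]; exact hpc.init
  · simpa using hdiv
  · intro r hr
    rw [if_neg (by omega)]
    split_ifs with h1
    · congr 1; omega
    · exact hnext r (by omega)
  · exact fun j hj => hpc.thread_init j hj.le hj
  · exact hpc.thread_final
  · intro j hj r hr
    rw [if_neg (by omega), if_neg (by omega)]
    exact hpc.block j r hr (Or.inl hj)

end Sys


/-! ### Reading the encoding -/

theorem getD_flatten_ofFn {n : ℕ} (g : Fin n → List ℕ) (b : ℕ) (hb : ∀ i, (g i).length = b)
    (i : Fin n) {x : ℕ} (hx : x < b) (l : List ℕ) :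
    ((List.ofFn g).flatten ++ l).getD (i * b + x) 0 = (g i).getD x 0 := by
  induction n with
  | zero => exact i.elim0
  | succ n ih =>
    rw [List.ofFn_succ, List.flatten_cons, List.append_assoc]
    refine Fin.cases ?_ (fun i => ?_) i
    · rw [Fin.val_zero, zero_mul, zero_add, List.getD_append _ _ _ _ (by rw [hb]; exact hx)]
    · rw [List.getD_append_right _ _ _ _ (by rw [hb, Fin.val_succ]; nlinarith), hb,
        ← ih (fun i => g i.succ) (fun i => hb _) i]
      congr 1
      rw [Fin.val_succ, add_mul]; omega

theorem length_flatten_ofFn {n : ℕ} (g : Fin n → List ℕ) (b : ℕ) (hb : ∀ i, (g i).length = b) :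
    (List.ofFn g).flatten.length = n * b := by
  rw [List.length_flatten, List.map_ofFn]
  have : (List.length ∘ g) = fun _ => b := funext hb
  rw [this, List.ofFn_const, List.sum_replicate, smul_eq_mul]

namespace Aut

variable {s : ℕ} (A : Aut s)

theorem length_encode : A.encode.length = 1 + 2 * A.n + A.n * s * A.n := by
  rw [encode]
  simp only [List.length_append, List.length_ofFn, List.length_singleton]
  rw [length_flatten_ofFn _ (s * A.n) fun q => ?_]
  · ring
  · rw [length_flatten_ofFn _ A.n fun a => by simp]

theorem encode_n : A.encode.getD 0 0 = A.n := by
  simp [encode]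

theorem encode_init {q : ℕ} (hq : q < A.n) :
    A.encode.getD (1 + q) 0 = if q = A.init then 1 else 0 := by
  rw [encode, List.append_assoc, List.append_assoc,
    List.getD_append_right _ _ _ _ (by simp), List.getD_append _ _ _ _ (by simpa using hq)]
  simp [hq, Fin.ext_iff, List.getD_eq_getElem?_getD]

theorem encode_final {q : ℕ} (hq : q < A.n) :
    A.encode.getD (1 + A.n + q) 0 = if q = A.final then 1 else 0 := by
  rw [encode, List.append_assoc, List.append_assoc,
    List.getD_append_right _ _ _ _ (by simp; omega),
    List.getD_append_right _ _ _ _ (by simp; omega),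
    List.getD_append _ _ _ _ (by simp; omega)]
  have : 1 + A.n + q - [A.n].length -
      (List.ofFn fun q : Fin A.n => if q = A.init then 1 else 0).length = q := by simp; omega
  rw [this]
  simp [hq, Fin.ext_iff, List.getD_eq_getElem?_getD]

theorem encode_step {q a q' : ℕ} (hq : q < A.n) (ha : a < s) (hq' : q' < A.n) :
    A.encode.getD (1 + 2 * A.n + (q * s + a) * A.n + q') 0 =
      if A.δ ⟨q, hq⟩ ⟨a, ha⟩ ⟨q', hq'⟩ = true then 1 else 0 := by
  rw [encode, List.append_assoc, List.append_assoc,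
    List.getD_append_right _ _ _ _ (by simp; omega),
    List.getD_append_right _ _ _ _ (by simp; omega),
    List.getD_append_right _ _ _ _ (by simp; omega)]
  have : 1 + 2 * A.n + (q * s + a) * A.n + q' - [A.n].length -
      (List.ofFn fun q : Fin A.n => if q = A.init then 1 else 0).length -
      (List.ofFn fun q : Fin A.n => if q = A.final then 1 else 0).length =
      ((⟨q, hq⟩ : Fin A.n) : ℕ) * (s * A.n) + (((⟨a, ha⟩ : Fin s) : ℕ) * A.n + q') := by
    simp only [List.length_singleton, List.length_ofFn]
    have : (q * s + a) * A.n = q * (s * A.n) + a * A.n := by ring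
    omega
  rw [this, ← List.append_nil (List.ofFn _).flatten, getD_flatten_ofFn _ (s * A.n) _ _ _ _,
    ← List.append_nil (List.ofFn _).flatten, getD_flatten_ofFn _ A.n _ _ hq']
  · simp [hq', List.getD_eq_getElem?_getD]
  · intro a; simp
  · intro q; rw [length_flatten_ofFn _ A.n fun a => by simp]
  · dsimp only
    have : (a + 1) * A.n ≤ s * A.n := Nat.mul_le_mul_right _ ha
    rw [add_mul] at this; omega

end Aut

/-- `f` is the input of a system, and `off` gives the positions of the threads in it. -/
structure Layout (Y : Sys) (cs : ℕ) (f off : ℕ → ℕ) : Prop where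
  ops : f 0 = Y.ops
  t : f 1 = Y.t
  cs : f 2 = cs
  m : f 3 = Y.m
  off_zero : off 0 = 4 + 2 * Y.m + Y.m * Y.ops * Y.m
  off_succ : ∀ i < Y.t, off (i + 1) = off i + 1 + 2 * f (off i) + f (off i) * Y.ops * f (off i)
  off_last : off Y.t = Y.len
  out : ∀ a, Y.len ≤ a → f a = 0
  Mi : ∀ {q}, Y.Mi q ↔ q < Y.m ∧ f (4 + q) ≠ 0
  Mf : ∀ {q}, Y.Mf q ↔ q < Y.m ∧ f (4 + Y.m + q) ≠ 0
  Md : ∀ {q a q'}, Y.Md q a q' ↔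
    q < Y.m ∧ a < Y.ops ∧ q' < Y.m ∧ f (4 + 2 * Y.m + (q * Y.ops + a) * Y.m + q') ≠ 0
  Ai : ∀ {i q}, Y.Ai i q ↔ i < Y.t ∧ q < f (off i) ∧ f (off i + 1 + q) ≠ 0
  Af : ∀ {i q}, Y.Af i q ↔ i < Y.t ∧ q < f (off i) ∧ f (off i + 1 + f (off i) + q) ≠ 0
  Ad : ∀ {i q a q'}, Y.Ad i q a q' ↔ i < Y.t ∧ q < f (off i) ∧ a < Y.ops ∧ q' < f (off i) ∧
    f (off i + 1 + 2 * f (off i) + (q * Y.ops + a) * f (off i) + q') ≠ 0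

theorem Layout.off_mono {Y : Sys} {cs : ℕ} {f off : ℕ → ℕ} (h : Layout Y cs f off) {i j : ℕ}
    (hij : i ≤ j) (hj : j ≤ Y.t) : off i ≤ off j := by
  induction j, hij using Nat.le_induction with
  | base => exact le_rfl
  | succ j hij ih =>
    have := h.off_succ j (by omega)
    have := ih (by omega)
    omega

/-- Positions of the threads in the encoding. -/
def SMCP.offset (S : SMCP) (i : ℕ) : ℕ :=
  3 + S.M.encode.length + (((List.ofFn S.A).take i).map fun A => A.encode.length).sum

theorem getD_flatten_map {β : Type} (e : β → List ℕ) (l : List β) {i x : ℕ} (hi : i < l.length)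
    (hx : x < (e l[i]).length) :
    (l.map e).flatten.getD (((l.take i).map fun b => (e b).length).sum + x) 0 =
      (e l[i]).getD x 0 := by
  induction l generalizing i with
  | nil => simp at hi
  | cons b l ih =>
    cases i with
    | zero =>
      simp only [List.getElem_cons_zero] at hx ⊢
      rw [List.map_cons, List.flatten_cons, List.getD_append _ _ _ _ (by simpa using hx)]
      simp
    | succ i =>
      simp only [List.getElem_cons_succ] at hx ⊢
      rw [List.map_cons, List.flatten_cons, List.getD_append_right _ _ _ _ (by simp; omega),
        ← ih (by simpa using hi) hx]
      congr 1
      simp; omega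

theorem SMCP.offset_succ (S : SMCP) (i : Fin S.t) :
    S.offset (i + 1) = S.offset i + (S.A i).encode.length := by
  rw [offset, offset, List.take_succ_eq_append_getElem (by simp)]
  simp [add_assoc]

theorem SMCP.offset_last (S : SMCP) (cs : ℕ) :
    S.offset S.t = (encodeInstance S cs).length := by
  rw [offset, encodeInstance, List.take_of_length_le (by simp)]
  simp [List.length_flatten, List.map_ofFn, Function.comp_def]
  omega

theorem SMCP.getD_thread (S : SMCP) (cs : ℕ) (i : Fin S.t) {x : ℕ}
    (hx : x < (S.A i).encode.length) :
    (encodeInstance S cs).getD (S.offset i + x) 0 = (S.A i).encode.getD x 0 := by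
  have h := getD_flatten_map Aut.encode (List.ofFn S.A) (i := i) (x := x) (by simp) (by simpa)
  rw [encodeInstance, List.append_assoc, List.getD_append_right _ _ _ _ (by simp [offset]; omega),
    List.getD_append_right _ _ _ _ (by simp [offset]; omega)]
  rw [List.map_ofFn] at h
  simp only [List.getElem_ofFn] at h
  rw [← h]
  congr 1
  simp [offset]; omega

theorem SMCP.getD_memory (S : SMCP) (cs : ℕ) {x : ℕ} (hx : x < S.M.encode.length) :
    (encodeInstance S cs).getD (3 + x) 0 = S.M.encode.getD x 0 := by
  rw [encodeInstance, List.append_assoc, List.getD_append_right _ _ _ _ (by simp),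
    List.getD_append _ _ _ _ (by simpa using hx)]
  simp

theorem table_lt {n s q a q' : ℕ} (hq : q < n) (ha : a < s) (hq' : q' < n) :
    (q * s + a) * n + q' < n * s * n := by
  have h1 : q * s + a + 1 ≤ n * s := by
    have : (q + 1) * s ≤ n * s := Nat.mul_le_mul_right _ hq
    rw [add_mul] at this; omega
  have := Nat.mul_le_mul_right n h1
  rw [add_mul] at this; omega

/-- Lets the input length serve as the common bound `len` for the states of all threads. -/
theorem SMCP.n_lt_length (S : SMCP) (cs : ℕ) (i : Fin S.t) :
    (S.A i).n ≤ (encodeInstance S cs).length := by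
  have h2 := S.offset_succ i
  rw [Aut.length_encode] at h2
  have : S.offset (i + 1) ≤ S.offset S.t := by
    unfold offset
    gcongr
    exact (List.take_sublist_take_left i.2).map _ |>.sum_le_sum (by simp)
  rw [S.offset_last cs] at this
  omega

theorem SMCP.layout (S : SMCP) (cs : ℕ) :
    Layout (S.toSys (encodeInstance S cs).length (S.n_lt_length cs)) cs
      (fun a => (encodeInstance S cs).getD a 0) S.offset := by
  have hn : ∀ i : Fin S.t, (encodeInstance S cs).getD (S.offset i) 0 = (S.A i).n := by
    intro i
    have := S.getD_thread cs i (x := 0) (by rw [Aut.length_encode]; omega)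
    rwa [add_zero, Aut.encode_n] at this
  have hM : ∀ x, x < 1 + 2 * S.M.n + S.M.n * S.ops * S.M.n →
      (encodeInstance S cs).getD (3 + x) 0 = S.M.encode.getD x 0 := fun x hx =>
    S.getD_memory cs (by rwa [Aut.length_encode])
  have hA : ∀ (i : Fin S.t) x, x < 1 + 2 * (S.A i).n + (S.A i).n * S.ops * (S.A i).n →
      (encodeInstance S cs).getD (S.offset i + x) 0 = (S.A i).encode.getD x 0 := fun i x hx =>
    S.getD_thread cs i (by rwa [Aut.length_encode])
  have hone : ∀ {p : Prop} [Decidable p], (if p then 1 else 0 : ℕ) ≠ 0 ↔ p := by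
    intro p _; split_ifs <;> simp_all
  refine ⟨by simp [encodeInstance, SMCP.toSys], by simp [encodeInstance, SMCP.toSys],
    by simp [encodeInstance], ?_, ?_, ?_, S.offset_last cs, ?_, ?_, ?_, ?_, ?_, ?_, ?_⟩
  · have := hM 0 (by omega)
    rwa [Aut.encode_n] at this
  · simp only [SMCP.offset, List.take_zero, Aut.length_encode, SMCP.toSys]
    simp; omega
  · intro i hi
    have := S.offset_succ ⟨i, hi⟩
    dsimp only at this ⊢
    rw [this, hn ⟨i, hi⟩, Aut.length_encode]
    simp only [SMCP.toSys]; omega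
  · intro a ha
    exact List.getD_eq_default _ _ ha
  · intro q
    simp only [SMCP.toSys]
    constructor
    · rintro rfl
      refine ⟨Fin.is_lt _, ?_⟩
      rw [(by omega : 4 + (S.M.init : ℕ) = 3 + (1 + S.M.init)), hM _ (by omega),
        Aut.encode_init _ (Fin.is_lt _), if_pos rfl]
      exact one_ne_zero
    · rintro ⟨hq, h⟩
      rwa [(by omega : 4 + q = 3 + (1 + q)), hM _ (by omega), Aut.encode_init _ hq, hone] at h
  · intro q
    simp only [SMCP.toSys]
    constructor
    · rintro rfl
      refine ⟨Fin.is_lt _, ?_⟩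
      rw [(by omega : 4 + S.M.n + (S.M.final : ℕ) = 3 + (1 + S.M.n + S.M.final)),
        hM _ (by omega), Aut.encode_final _ (Fin.is_lt _), if_pos rfl]
      exact one_ne_zero
    · rintro ⟨hq, h⟩
      rwa [(by omega : 4 + S.M.n + q = 3 + (1 + S.M.n + q)), hM _ (by omega),
        Aut.encode_final _ hq, hone] at h
  · intro q a q'
    simp only [SMCP.toSys, Aut.Step]
    have key : ∀ (hq : q < S.M.n) (ha : a < S.ops) (hq' : q' < S.M.n),
        (encodeInstance S cs).getD (4 + 2 * S.M.n + (q * S.ops + a) * S.M.n + q') 0 ≠ 0 ↔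
          S.M.δ ⟨q, hq⟩ ⟨a, ha⟩ ⟨q', hq'⟩ = true := by
      intro hq ha hq'
      have := table_lt hq ha hq'
      rw [(by omega : 4 + 2 * S.M.n + (q * S.ops + a) * S.M.n + q' =
        3 + (1 + 2 * S.M.n + (q * S.ops + a) * S.M.n + q')), hM _ (by omega),
        Aut.encode_step _ hq ha hq', hone]
    constructor
    · rintro ⟨hq, ha, hq', h⟩; exact ⟨hq, ha, hq', (key hq ha hq').2 h⟩
    · rintro ⟨hq, ha, hq', h⟩; exact ⟨hq, ha, hq', (key hq ha hq').1 h⟩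
  · intro i q
    simp only [SMCP.toSys]
    rw [← exists_prop]
    refine exists_congr fun hi => ?_
    have hni := hn ⟨i, hi⟩
    dsimp only at hni
    rw [hni]
    constructor
    · rintro rfl
      refine ⟨Fin.is_lt _, ?_⟩
      have := hA ⟨i, hi⟩ (1 + (S.A ⟨i, hi⟩).init) (by omega)
      dsimp only at this
      rw [add_assoc, this, Aut.encode_init _ (Fin.is_lt _), if_pos rfl]
      exact one_ne_zero
    · rintro ⟨hq, h⟩
      have := hA ⟨i, hi⟩ (1 + q) (by omega)
      dsimp only at this
      rwa [add_assoc, this, Aut.encode_init _ hq, hone] at h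
  · intro i q
    simp only [SMCP.toSys]
    rw [← exists_prop]
    refine exists_congr fun hi => ?_
    have hni := hn ⟨i, hi⟩
    dsimp only at hni
    rw [hni]
    constructor
    · rintro rfl
      refine ⟨Fin.is_lt _, ?_⟩
      have := hA ⟨i, hi⟩ (1 + (S.A ⟨i, hi⟩).n + (S.A ⟨i, hi⟩).final) (by omega)
      dsimp only at this
      rw [add_assoc, add_assoc, ← add_assoc 1, this, Aut.encode_final _ (Fin.is_lt _), if_pos rfl]
      exact one_ne_zero
    · rintro ⟨hq, h⟩
      have := hA ⟨i, hi⟩ (1 + (S.A ⟨i, hi⟩).n + q) (by omega)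
      dsimp only at this
      rwa [add_assoc, add_assoc, ← add_assoc 1, this, Aut.encode_final _ hq, hone] at h
  · intro i q a q'
    simp only [SMCP.toSys, Aut.Step]
    rw [← exists_prop]
    refine exists_congr fun hi => ?_
    have hni := hn ⟨i, hi⟩
    dsimp only at hni
    rw [hni]
    have key : ∀ (hq : q < (S.A ⟨i, hi⟩).n) (ha : a < S.ops) (hq' : q' < (S.A ⟨i, hi⟩).n),
        (encodeInstance S cs).getD (S.offset i + 1 + 2 * (S.A ⟨i, hi⟩).n +
          (q * S.ops + a) * (S.A ⟨i, hi⟩).n + q') 0 ≠ 0 ↔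
          (S.A ⟨i, hi⟩).δ ⟨q, hq⟩ ⟨a, ha⟩ ⟨q', hq'⟩ = true := by
      intro hq ha hq'
      have := table_lt hq ha hq'
      have h2 := hA ⟨i, hi⟩ (1 + 2 * (S.A ⟨i, hi⟩).n + (q * S.ops + a) * (S.A ⟨i, hi⟩).n + q')
        (by omega)
      dsimp only at h2
      rw [(by omega : S.offset i + 1 + 2 * (S.A ⟨i, hi⟩).n +
        (q * S.ops + a) * (S.A ⟨i, hi⟩).n + q' = S.offset i + (1 + 2 * (S.A ⟨i, hi⟩).n +
        (q * S.ops + a) * (S.A ⟨i, hi⟩).n + q')), h2, Aut.encode_step _ hq ha hq', hone]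
    constructor
    · rintro ⟨hq, ha, hq', h⟩; exact ⟨hq, ha, hq', (key hq ha hq').2 h⟩
    · rintro ⟨hq, ha, hq', h⟩; exact ⟨hq, ha, hq', (key hq ha hq').1 h⟩

/-! ### Levels and numbers of nodes -/

namespace Sys

variable (Y : Sys) (c : ℕ)

/-- The nodes that are reached from a start node in `n` steps. -/
def Level (p : ℕ) : ℕ → Node → Prop
  | 0, x => Y.Start p x
  | n + 1, y => ∃ x, Level p n x ∧ Y.Step c x y

/-- Bounds for the components of a node. -/
def Valid (x : Node) : Prop := x.i ≤ Y.t ∧ x.k < c ∧ x.v < Y.m ^ c ∧ x.a < Y.len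

/-- Number of valid nodes. -/
def nodes : ℕ := (Y.t + 1) * c * Y.m ^ c * Y.len

/-- Mixed radix notation with `p` as the most significant part, so that division and remainder
recover all components of a valid node. -/
def code (p : ℕ) (x : Node) : ℕ :=
  (((p * (Y.t + 1) + x.i) * c + x.k) * Y.m ^ c + x.v) * Y.len + x.a

def codeNum (d : ℕ) : ℕ := d / Y.len / Y.m ^ c / c / (Y.t + 1)

def codeNode (d : ℕ) : Node where
  i := d / Y.len / Y.m ^ c / c % (Y.t + 1)
  k := d / Y.len / Y.m ^ c % c
  v := d / Y.len % Y.m ^ c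
  a := d % Y.len

variable {Y c}

theorem code_codeNum (d : ℕ) : Y.code c (Y.codeNum c d) (Y.codeNode c d) = d := by
  simp only [code, codeNum, codeNode, Nat.div_add_mod']

theorem mul_add_div_of_lt {h b l : ℕ} (hl : l < b) : (h * b + l) / b = h := by
  rw [mul_comm, Nat.mul_add_div (by omega), Nat.div_eq_of_lt hl, add_zero]

theorem mul_add_mod_of_lt {h b l : ℕ} (hl : l < b) : (h * b + l) % b = l := by
  rw [Nat.mul_add_mod', Nat.mod_eq_of_lt hl]

theorem codeNum_code {p : ℕ} {x : Node} (h : Y.Valid c x) : Y.codeNum c (Y.code c p x) = p := by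
  obtain ⟨hi, hk, hv, ha⟩ := h
  rw [codeNum, code, mul_add_div_of_lt ha, mul_add_div_of_lt hv, mul_add_div_of_lt hk,
    mul_add_div_of_lt (by omega)]

theorem codeNode_code {p : ℕ} {x : Node} (h : Y.Valid c x) : Y.codeNode c (Y.code c p x) = x := by
  obtain ⟨hi, hk, hv, ha⟩ := h
  rw [codeNode, code, mul_add_div_of_lt ha, mul_add_div_of_lt hv, mul_add_div_of_lt hk,
    mul_add_mod_of_lt ha, mul_add_mod_of_lt hv, mul_add_mod_of_lt hk, mul_add_mod_of_lt (by omega)]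

theorem mul_add_lt {h H b l : ℕ} (hh : h < H) (hl : l < b) : h * b + l < H * b := by
  have := Nat.mul_le_mul_right b hh
  rw [Nat.succ_mul] at this; omega

theorem code_lt {p : ℕ} {x : Node} (hp : p < Y.m ^ c) (h : Y.Valid c x) :
    Y.code c p x < Y.m ^ c * Y.nodes c := by
  obtain ⟨hi, hk, hv, ha⟩ := h
  have := mul_add_lt (mul_add_lt (mul_add_lt (mul_add_lt hp (by omega : x.i < Y.t + 1)) hk) hv) ha
  rw [code, nodes]
  calc _ < _ := this
    _ = _ := by ring

theorem Start.valid {p : ℕ} {x : Node} (hc : 1 ≤ c) (hp : p < Y.m ^ c) (h : Y.Start p x) :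
    Y.Valid c x := by
  obtain ⟨hi, hk, hv, -, hA⟩ := h
  exact ⟨by omega, by omega, by omega, Y.Ai_lt hA⟩

theorem Step.valid {x y : Node} (hc : 1 ≤ c) (hx : Y.Valid c x) (h : Y.Step c x y) :
    Y.Valid c y := by
  have hstay : ∀ {v q : ℕ}, v < Y.m ^ c → q < Y.m → v - v % Y.m + q < Y.m ^ c := by
    intro v q hv hq
    obtain ⟨c, rfl⟩ : ∃ c', c = c' + 1 := ⟨c - 1, by omega⟩
    have h1 : v / Y.m < Y.m ^ c := Nat.div_lt_of_lt_mul (by rwa [← pow_succ'])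
    have := mul_add_lt h1 hq
    have h2 := Nat.div_add_mod' v Y.m
    rw [pow_succ]; omega
  have hrot : ∀ {v q : ℕ}, v < Y.m ^ c → q < Y.m →
      v / Y.m + q * Y.m ^ (c - 1) < Y.m ^ c := by
    intro v q hv hq
    obtain ⟨c, rfl⟩ : ∃ c', c = c' + 1 := ⟨c - 1, by omega⟩
    have h1 : v / Y.m < Y.m ^ c := Nat.div_lt_of_lt_mul (by rwa [← pow_succ'])
    have := mul_add_lt hq h1
    rw [pow_succ', Nat.add_sub_cancel]; omega
  obtain ⟨hi, hk, hv, ha⟩ := hx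
  cases h with
  | stay hit hM hA => exact ⟨hi, hk, hstay hv (Y.Md_lt hM).2.2, (Y.Ad_lt hA).2⟩
  | next hit hM hA hkc => exact ⟨hi, hkc, hrot hv (Y.Md_lt hM).2.2, (Y.Ad_lt hA).2⟩
  | last hit hM hA hkc hf ha'' hor => exact ⟨hit, hc, hrot hv (Y.Md_lt hM).2.2, ha''⟩

theorem Level.valid {p n : ℕ} {x : Node} (hc : 1 ≤ c) (hp : p < Y.m ^ c) (h : Y.Level c p n x) :
    Y.Valid c x := by
  induction n generalizing x with
  | zero => exact Start.valid hc hp h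
  | succ n ih =>
    obtain ⟨y, hy, hs⟩ := h
    exact hs.valid hc (ih hy)

theorem Level.exists_seq {p n : ℕ} {x : Node} (h : Y.Level c p n x) :
    ∃ g : ℕ → Node, g n = x ∧ (∀ i ≤ n, Y.Level c p i (g i)) ∧
      ∀ i < n, Y.Step c (g i) (g (i + 1)) := by
  induction n generalizing x with
  | zero => exact ⟨fun _ => x, rfl, fun i hi => by obtain rfl : i = 0 := by omega
                                                   exact h, by simp⟩
  | succ n ih =>
    obtain ⟨y, hy, hs⟩ := h
    obtain ⟨g, hg, hl, hst⟩ := ih hy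
    refine ⟨fun i => if i ≤ n then g i else x, by simp, fun i hi => ?_, fun i hi => ?_⟩
    · dsimp only
      split_ifs with h1
      · exact hl i h1
      · obtain rfl : i = n + 1 := by omega
        exact ⟨y, hy, hs⟩
    · dsimp only
      rw [if_pos (by omega)]
      split_ifs with h1
      · exact hst i (by omega)
      · obtain rfl : i = n := by omega
        rwa [hg]

/-- A shortest path visits no node twice, and codes with first part `0` number the valid nodes
injectively below `Y.nodes c`. -/
theorem Level.exists_lt {p n : ℕ} {x : Node} (hc : 1 ≤ c) (hp : p < Y.m ^ c)
    (h : Y.Level c p n x) : ∃ k < Y.nodes c, Y.Level c p k x := by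
  classical
  have hex : ∃ n, Y.Level c p n x := ⟨n, h⟩
  refine ⟨Nat.find hex, ?_, Nat.find_spec hex⟩
  by_contra hge
  push Not at hge
  obtain ⟨g, hg, hl, hs⟩ := (Nat.find_spec hex).exists_seq
  have hmaps : ∀ i ∈ Finset.range (Nat.find hex + 1),
      Y.code c 0 (g i) ∈ Finset.range (Y.nodes c) := by
    intro i hi
    obtain ⟨hi', hk, hv, ha⟩ := (hl i (by simpa [Nat.lt_succ_iff] using hi)).valid hc hp
    rw [Finset.mem_range, code, nodes, zero_mul, zero_add]
    exact mul_add_lt (mul_add_lt (mul_add_lt (by omega) hk) hv) ha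
  obtain ⟨i, hi, j, hj, hne, he⟩ :=
    Finset.exists_ne_map_eq_of_card_lt_of_maps_to (by rw [Finset.card_range, Finset.card_range]; omega) hmaps
  wlog hij : i < j generalizing i j
  · exact this j hj i hi hne.symm he.symm (by omega)
  simp only [Finset.mem_range] at hi hj
  have hgij : g i = g j := by
    rw [← codeNode_code ((hl i (by omega)).valid hc hp), he,
      codeNode_code ((hl j (by omega)).valid hc hp)]
  -- Cutting out the part between the two visits of the same node contradicts minimality.
  have hshort : ∀ d, j + d ≤ Nat.find hex → Y.Level c p (i + d) (g (j + d)) := by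
    intro d
    induction d with
    | zero => intro _; simpa [← hgij] using hl i (by omega)
    | succ d ih => intro hd; exact ⟨_, ih (by omega), hs _ (by omega)⟩
  have := hshort (Nat.find hex - j) (by omega)
  rw [Nat.add_sub_cancel' (by omega), hg] at this
  exact Nat.find_min hex (by omega) this

theorem Level.reflTransGen {p n : ℕ} {y : Node} (h : Y.Level c p n y) :
    ∃ x, Y.Start p x ∧ Relation.ReflTransGen (Y.Step c) x y := by
  induction n generalizing y with
  | zero => exact ⟨y, h, .refl⟩
  | succ n ih =>
    obtain ⟨z, hz, hs⟩ := h
    obtain ⟨x, hx, hr⟩ := ih hz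
    exact ⟨x, hx, hr.tail hs⟩

theorem reachable_iff (hc : 1 ≤ c) : Y.Reachable c ↔
    ∃ p < Y.m ^ c, ∃ n < Y.nodes c, ∃ y, Y.Level c p n y ∧ Y.Accept c p y := by
  constructor
  · rintro ⟨p, hp, x, y, hs, hr, ha⟩
    obtain ⟨n, hn⟩ : ∃ n, Y.Level c p n y := by
      clear ha
      induction hr with
      | refl => exact ⟨0, hs⟩
      | tail _ h ih =>
        obtain ⟨n, hn⟩ := ih
        exact ⟨n + 1, _, hn, h⟩
    obtain ⟨k, hk, hl⟩ := hn.exists_lt hc hp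
    exact ⟨p, hp, k, hk, y, hl, ha⟩
  · rintro ⟨p, hp, n, -, y, hl, ha⟩
    obtain ⟨x, hx, hr⟩ := hl.reflTransGen
    exact ⟨p, hp, x, y, hx, hr, ha⟩

end Sys


/-! ### The search program -/

namespace Expr

instance : Add Expr := ⟨add⟩
instance : Sub Expr := ⟨sub⟩
instance : Mul Expr := ⟨mul⟩
instance : Div Expr := ⟨div⟩
instance : Mod Expr := ⟨mod⟩

section

variable (a b : Expr) (c : ℕ) (s : State)

@[simp] theorem eval_add : (a + b).eval s = a.eval s + b.eval s := rfl
@[simp] theorem eval_sub : (a - b).eval s = a.eval s - b.eval s := rfl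
@[simp] theorem eval_mul : (a * b).eval s = a.eval s * b.eval s := rfl
@[simp] theorem eval_div : (a / b).eval s = a.eval s / b.eval s := rfl
@[simp] theorem eval_mod : (a % b).eval s = a.eval s % b.eval s := rfl
@[simp] theorem eval_lit : (lit c).eval s = c := rfl
@[simp] theorem eval_load : (load a).eval s = s.mem (a.eval s) := rfl

/-- Comparison; the value is nonzero if and only if `a < b`. -/
def lt : Expr := b - a

/-- Comparison; the value is nonzero if and only if `a = b`. -/
def eq : Expr := lit 1 - ((a - b) + (b - a))

@[simp] theorem eval_lt : (lt a b).eval s ≠ 0 ↔ a.eval s < b.eval s := by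
  simp only [lt, eval_sub]; omega

@[simp] theorem eval_eq : (eq a b).eval s ≠ 0 ↔ a.eval s = b.eval s := by
  simp only [eq, eval_sub, eval_add, eval_lit]; omega

theorem eval_and : (a * b).eval s ≠ 0 ↔ a.eval s ≠ 0 ∧ b.eval s ≠ 0 := by
  rw [eval_mul]; exact mul_ne_zero_iff

theorem eval_or : (a + b).eval s ≠ 0 ↔ a.eval s ≠ 0 ∨ b.eval s ≠ 0 := by
  rw [eval_add]; omega

end

end Expr

namespace Sys

variable (Y : Sys) (c : ℕ)

/-- Number of choices for a step. -/
def choices : ℕ := Y.ops * Y.m * Y.len * 2 * Y.len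

/-- Number of pairs of a node and a choice. -/
def sweep : ℕ := Y.m ^ c * Y.nodes c * Y.choices

/-- The node that is treated when the counter of the main loop is `z`. -/
def idx (z : ℕ) : ℕ := z % Y.sweep c / Y.choices

/-- The choice that is treated when the counter of the main loop is `z`. -/
def choice (z : ℕ) : ℕ := z % Y.sweep c % Y.choices

/-- The step from `x` to `y` that belongs to a letter `σ`, new states `q'` and `a'`, the decision `b` to
end the context and an initial state `a''` of the next thread. -/
def Edge (σ q' a' b a'' : ℕ) (x y : Node) : Prop :=
  (x.i < Y.t ∧ Y.Md (x.v % Y.m) σ q' ∧ Y.Ad x.i x.a σ a') ∧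
    (b = 0 ∧ y = ⟨x.i, x.k, x.v - x.v % Y.m + q', a'⟩ ∨
      b ≠ 0 ∧ x.k + 1 < c ∧ y = ⟨x.i, x.k + 1, x.v / Y.m + q' * Y.m ^ (c - 1), a'⟩ ∨
      b ≠ 0 ∧ ¬ x.k + 1 < c ∧ (Y.Af x.i a' ∧ (x.i + 1 = Y.t ∨ Y.Ai (x.i + 1) a'')) ∧
        y = ⟨x.i + 1, 0, x.v / Y.m + q' * Y.m ^ (c - 1), a''⟩)

/-- `Edge` for a numbered choice. -/
def EdgeAt (d : ℕ) : Node → Node → Prop :=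
  Y.Edge c (d % Y.ops) (d / Y.ops % Y.m) (d / Y.ops / Y.m % Y.len)
    (d / Y.ops / Y.m / Y.len % 2) (d / Y.ops / Y.m / Y.len / 2)

variable {Y c}

theorem EdgeAt.step {d : ℕ} {x y : Node} (hd : d < Y.choices) (hx : Y.Valid c x)
    (h : Y.EdgeAt c d x y) : Y.Step c x y := by
  obtain ⟨i, k, v, a⟩ := x
  obtain ⟨⟨hi, hM, hA⟩, ⟨-, rfl⟩ | ⟨-, hk, rfl⟩ | ⟨-, hk, ⟨hf, hor⟩, rfl⟩⟩ := h
  · exact .stay hi hM hA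
  · exact .next hi hM hA hk
  · have hk' : k < c := hx.2.1
    refine .last hi hM hA ?_ hf ?_ hor
    · dsimp only at hk; omega
    -- The guess `a''` is the top quotient, which is not reduced modulo `len`; it is bounded because
    -- `d` is below the number of choices.
    · rw [Nat.div_div_eq_div_mul, Nat.div_div_eq_div_mul, Nat.div_div_eq_div_mul]
      refine Nat.div_lt_of_lt_mul (hd.trans_eq ?_)
      rw [choices]; ring

theorem Step.exists_edgeAt {x y : Node} (h : Y.Step c x y) :
    ∃ d < Y.choices, Y.EdgeAt c d x y := by
  have key : ∀ {σ q' a' b a'' : ℕ}, σ < Y.ops → q' < Y.m → a' < Y.len → b < 2 → a'' < Y.len →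
      Y.Edge c σ q' a' b a'' x y → ∃ d < Y.choices, Y.EdgeAt c d x y := by
    intro σ q' a' b a'' h1 h2 h3 h4 h5 he
    refine ⟨(((a'' * 2 + b) * Y.len + a') * Y.m + q') * Y.ops + σ, ?_, ?_⟩
    · have := mul_add_lt (mul_add_lt (mul_add_lt (mul_add_lt h5 h4) h3) h2) h1
      rw [choices]
      calc _ < _ := this
        _ = _ := by ring
    · rwa [EdgeAt, mul_add_div_of_lt h1, mul_add_div_of_lt h2, mul_add_div_of_lt h3,
        mul_add_div_of_lt h4, mul_add_mod_of_lt h1, mul_add_mod_of_lt h2, mul_add_mod_of_lt h3,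
        mul_add_mod_of_lt h4]
  cases h with
  | stay hi hM hA =>
    have ha := (Y.Ad_lt hA).2
    -- The component `a''` plays no role unless the thread changes; `a'` is used as an admissible
    -- value.
    exact key (Y.Md_lt hM).2.1 (Y.Md_lt hM).2.2 ha Nat.two_pos ha
      ⟨⟨hi, hM, hA⟩, Or.inl ⟨rfl, rfl⟩⟩
  | next hi hM hA hk =>
    have ha := (Y.Ad_lt hA).2
    exact key (Y.Md_lt hM).2.1 (Y.Md_lt hM).2.2 ha Nat.one_lt_two ha
      ⟨⟨hi, hM, hA⟩, Or.inr (Or.inl ⟨one_ne_zero, hk, rfl⟩)⟩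
  | last hi hM hA hk hf ha hor =>
    exact key (Y.Md_lt hM).2.1 (Y.Md_lt hM).2.2 (Y.Ad_lt hA).2 Nat.one_lt_two ha
      ⟨⟨hi, hM, hA⟩, Or.inr (Or.inr ⟨one_ne_zero, by dsimp only; omega, ⟨hf, hor⟩, rfl⟩)⟩

end Sys

namespace Search

open BCS.Expr

def len : Expr := var 0
def rounds : Expr := var 1
def pow : Expr := var 2
def counter : Expr := var 3
def ops : Expr := load (lit 0)
def threads : Expr := load (lit 1)
def mem : Expr := load (lit 3)
def nodes : Expr := (threads + lit 1) * rounds * pow * len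
def choices : Expr := ops * mem * len * lit 2 * len
def sweep : Expr := pow * nodes * choices
def idx : Expr := counter % sweep / choices
def choice : Expr := counter % sweep % choices
def num : Expr := idx / len / pow / rounds / (threads + lit 1)
def thread : Expr := idx / len / pow / rounds % (threads + lit 1)
def round : Expr := idx / len / pow % rounds
def vec : Expr := idx / len % pow
def st : Expr := idx % len
def letter : Expr := choice % ops
def memNew : Expr := choice / ops % mem
def stNew : Expr := choice / ops / mem % len
def leave : Expr := choice / ops / mem / len % lit 2
def stNext : Expr := choice / ops / mem / len / lit 2
def off (i : Expr) : Expr := load (len + i)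
def size (i : Expr) : Expr := load (off i)
def Mi (q : Expr) : Expr := lt q mem * load (lit 4 + q)
def Mf (q : Expr) : Expr := lt q mem * load (lit 4 + mem + q)
def Md (q a q' : Expr) : Expr :=
  lt q mem * (lt a ops * (lt q' mem * load (lit 4 + lit 2 * mem + (q * ops + a) * mem + q')))
def Ai (i q : Expr) : Expr := lt i threads * (lt q (size i) * load (off i + lit 1 + q))
def Af (i q : Expr) : Expr := lt i threads * (lt q (size i) * load (off i + lit 1 + size i + q))
def Ad (i q a q' : Expr) : Expr :=
  lt i threads * (lt q (size i) * (lt a ops * (lt q' (size i) *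
    load (off i + lit 1 + lit 2 * size i + (q * ops + a) * size i + q'))))
-- Start nodes are recognised by a test instead of being marked in advance. Marks begin at address
-- `2 * len`: the input lies below `len`, and the table of thread positions takes `t ≤ len` further
-- cells.
def marked : Expr :=
  load (lit 2 * len + idx) + eq thread (lit 0) * (eq round (lit 0) * (eq vec num *
    (Mi (num % mem) * Ai (lit 0) st)))
def accept : Expr :=
  eq thread threads * (eq round (lit 0) * (eq (vec % (pow / mem)) (num / mem) *
    Mf (vec / (pow / mem))))
def step : Expr := lt thread threads * (Md (vec % mem) letter memNew * Ad thread st letter stNew)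
def rot : Expr := vec / mem + memNew * (pow / mem)

/-- Marks a node. -/
def mark (i k v a : Expr) : Cmd :=
  .store (lit 2 * len + ((((num * (threads + lit 1) + i) * rounds + k) * pow + v) * len + a)) (lit 1)

/-- The body of the main loop. -/
def body : Cmd :=
  .ite marked
    (.seq (.ite accept (.assign 4 (lit 1)) .skip)
      (.ite step
        (.ite leave
          (.ite (lt (round + lit 1) rounds)
            (mark thread (round + lit 1) rot stNew)
            (.ite (Af thread stNew * (eq (thread + lit 1) threads + Ai (thread + lit 1) stNext))
              (mark (thread + lit 1) (lit 0) rot stNext) .skip))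
          (mark thread round (vec - vec % mem + memNew) stNew))
        .skip))
    .skip

/-- The state holds the input, the positions of the threads and the constants of the search. -/
structure Ready (Y : Sys) (c : ℕ) (f off : ℕ → ℕ) (s : State) : Prop where
  len_eq : s.reg 0 = Y.len
  rounds_eq : s.reg 1 = c
  pow_eq : s.reg 2 = Y.m ^ c
  input : ∀ a < Y.len, s.mem a = f a
  offsets : ∀ i < Y.t, s.mem (Y.len + i) = off i

section Eval

variable {Y : Sys} {c cs : ℕ} {f o : ℕ → ℕ} {s : State}

theorem Ready.header (hL : Layout Y cs f o) (h : Ready Y c f o s) :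
    ops.eval s = Y.ops ∧ threads.eval s = Y.t ∧ (load (lit 2)).eval s = cs ∧ mem.eval s = Y.m := by
  have h4 : 4 ≤ Y.len := by
    have := hL.off_mono (Nat.zero_le Y.t) le_rfl
    rw [hL.off_zero, hL.off_last] at this; omega
  refine ⟨?_, ?_, ?_, ?_⟩
  · exact (h.input 0 (by omega)).trans hL.ops
  · exact (h.input 1 (by omega)).trans hL.t
  · exact (h.input 2 (by omega)).trans hL.cs
  · exact (h.input 3 (by omega)).trans hL.m

theorem Ready.size_eval (hL : Layout Y cs f o) (h : Ready Y c f o s) {i : Expr}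
    (hi : i.eval s < Y.t) :
    (off i).eval s = o (i.eval s) ∧ (size i).eval s = f (o (i.eval s)) ∧
      o (i.eval s) + 1 + 2 * f (o (i.eval s)) + f (o (i.eval s)) * Y.ops * f (o (i.eval s)) ≤
        Y.len := by
  have h1 := hL.off_succ _ hi
  have h2 := hL.off_mono (show i.eval s + 1 ≤ Y.t from hi) le_rfl
  rw [hL.off_last] at h2
  have h3 : (off i).eval s = o (i.eval s) := by
    rw [off, eval_load, eval_add, ← h.offsets _ hi, ← h.len_eq]; rfl
  refine ⟨h3, ?_, by omega⟩
  rw [size, eval_load, h3, h.input _ (by omega)]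

theorem Ready.Mi_eval (hL : Layout Y cs f o) (h : Ready Y c f o s) (q : Expr) :
    (Mi q).eval s ≠ 0 ↔ Y.Mi (q.eval s) := by
  obtain ⟨h0, h1, -, h3⟩ := h.header hL
  have hlen := hL.off_mono (Nat.zero_le Y.t) le_rfl
  rw [hL.off_zero, hL.off_last] at hlen
  rw [hL.Mi, Mi, eval_and, eval_lt, h3, eval_load, eval_add, eval_lit]
  refine and_congr_right fun hq => ?_
  rw [h.input _ (by omega)]

theorem Ready.Mf_eval (hL : Layout Y cs f o) (h : Ready Y c f o s) (q : Expr) :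
    (Mf q).eval s ≠ 0 ↔ Y.Mf (q.eval s) := by
  obtain ⟨h0, h1, -, h3⟩ := h.header hL
  have hlen := hL.off_mono (Nat.zero_le Y.t) le_rfl
  rw [hL.off_zero, hL.off_last] at hlen
  rw [hL.Mf, Mf, eval_and, eval_lt, h3, eval_load, eval_add, eval_add, eval_lit, h3]
  refine and_congr_right fun hq => ?_
  rw [h.input _ (by omega)]

theorem Ready.Md_eval (hL : Layout Y cs f o) (h : Ready Y c f o s) (q a q' : Expr) :
    (Md q a q').eval s ≠ 0 ↔ Y.Md (q.eval s) (a.eval s) (q'.eval s) := by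
  obtain ⟨h0, h1, -, h3⟩ := h.header hL
  have hlen := hL.off_mono (Nat.zero_le Y.t) le_rfl
  rw [hL.off_zero, hL.off_last] at hlen
  rw [hL.Md, Md, eval_and, eval_and, eval_and, eval_lt, eval_lt, eval_lt, h0, h3]
  refine and_congr_right fun hq => and_congr_right fun ha => and_congr_right fun hq' => ?_
  have := table_lt hq ha hq'
  simp only [eval_load, eval_add, eval_mul, eval_lit, h0, h3]
  rw [h.input _ (by omega)]

theorem Ready.Ai_eval (hL : Layout Y cs f o) (h : Ready Y c f o s) (i q : Expr) :
    (Ai i q).eval s ≠ 0 ↔ Y.Ai (i.eval s) (q.eval s) := by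
  obtain ⟨h0, h1, -, h3⟩ := h.header hL
  rw [hL.Ai, Ai, eval_and, eval_and, eval_lt, eval_lt, h1]
  refine and_congr_right fun hi => ?_
  obtain ⟨e1, e2, e3⟩ := h.size_eval hL hi
  rw [e2]
  refine and_congr_right fun hq => ?_
  simp only [eval_load, eval_add, eval_lit, e1]
  rw [h.input _ (by omega)]

theorem Ready.Af_eval (hL : Layout Y cs f o) (h : Ready Y c f o s) (i q : Expr) :
    (Af i q).eval s ≠ 0 ↔ Y.Af (i.eval s) (q.eval s) := by
  obtain ⟨h0, h1, -, h3⟩ := h.header hL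
  rw [hL.Af, Af, eval_and, eval_and, eval_lt, eval_lt, h1]
  refine and_congr_right fun hi => ?_
  obtain ⟨e1, e2, e3⟩ := h.size_eval hL hi
  rw [e2]
  refine and_congr_right fun hq => ?_
  simp only [eval_load (off i + _ + _ + _), eval_add, eval_lit, e1, e2]
  rw [h.input _ (by omega)]

theorem Ready.Ad_eval (hL : Layout Y cs f o) (h : Ready Y c f o s) (i q a q' : Expr) :
    (Ad i q a q').eval s ≠ 0 ↔ Y.Ad (i.eval s) (q.eval s) (a.eval s) (q'.eval s) := by
  obtain ⟨h0, h1, -, h3⟩ := h.header hL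
  rw [hL.Ad, Ad, eval_and, eval_and, eval_and, eval_and, eval_lt, eval_lt, eval_lt, eval_lt, h1,
    h0]
  refine and_congr_right fun hi => ?_
  obtain ⟨e1, e2, e3⟩ := h.size_eval hL hi
  rw [e2]
  refine and_congr_right fun hq => and_congr_right fun ha => and_congr_right fun hq' => ?_
  have := table_lt hq ha hq'
  rw [eval_load]
  simp only [eval_add, eval_mul, eval_lit, e1, e2, h0]
  rw [h.input _ (by omega)]

theorem Ready.pow_eval (h : Ready Y c f o s) : pow.eval s = Y.m ^ c := h.pow_eq

theorem Ready.nodes_eval (hL : Layout Y cs f o) (h : Ready Y c f o s) :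
    nodes.eval s = Y.nodes c := by
  obtain ⟨h0, h1, -, h3⟩ := h.header hL
  have e0 : len.eval s = Y.len := h.len_eq
  have e1 : rounds.eval s = c := h.rounds_eq
  simp only [nodes, eval_add, eval_mul, eval_lit, h1, e0, e1, h.pow_eval, Sys.nodes]

theorem Ready.sweep_eval (hL : Layout Y cs f o) (h : Ready Y c f o s) :
    choices.eval s = Y.choices ∧ sweep.eval s = Y.sweep c := by
  obtain ⟨h0, h1, -, h3⟩ := h.header hL
  have e0 : len.eval s = Y.len := h.len_eq
  have e1 : choices.eval s = Y.choices := by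
    simp only [choices, eval_mul, eval_lit, h0, h3, e0, Sys.choices]
  refine ⟨e1, ?_⟩
  simp only [sweep, eval_mul, e1, h.nodes_eval hL, h.pow_eval, Sys.sweep]

/-- The values of the components of the current node and choice. -/
structure Values (Y : Sys) (c p : ℕ) (x : Node) (d : ℕ) (s : State) : Prop where
  num : num.eval s = p
  thread : thread.eval s = x.i
  round : round.eval s = x.k
  vec : vec.eval s = x.v
  st : st.eval s = x.a
  letter : letter.eval s = d % Y.ops
  memNew : memNew.eval s = d / Y.ops % Y.m
  stNew : stNew.eval s = d / Y.ops / Y.m % Y.len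
  leave : leave.eval s = d / Y.ops / Y.m / Y.len % 2
  stNext : stNext.eval s = d / Y.ops / Y.m / Y.len / 2
  wt : (pow / mem).eval s = Y.m ^ (c - 1)
  rot : rot.eval s = x.v / Y.m + d / Y.ops % Y.m * Y.m ^ (c - 1)

theorem Ready.values (hL : Layout Y cs f o) (h : Ready Y c f o s) (hc : 1 ≤ c) (hm : 1 ≤ Y.m) :
    idx.eval s = Y.idx c (s.reg 3) ∧
    Values Y c (Y.codeNum c (Y.idx c (s.reg 3))) (Y.codeNode c (Y.idx c (s.reg 3)))
      (Y.choice c (s.reg 3)) s := by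
  obtain ⟨h0, h1, -, h3⟩ := h.header hL
  have e0 : len.eval s = Y.len := h.len_eq
  have e1 : rounds.eval s = c := h.rounds_eq
  have e3 : counter.eval s = s.reg 3 := rfl
  obtain ⟨e5, e6⟩ := h.sweep_eval hL
  have e7 : idx.eval s = Y.idx c (s.reg 3) := by
    simp only [idx, eval_div, eval_mod, e5, e6, e3, Sys.idx]
  have e8 : choice.eval s = Y.choice c (s.reg 3) := by
    simp only [choice, eval_mod, e5, e6, e3, Sys.choice]
  have hpow : Y.m ^ c / Y.m = Y.m ^ (c - 1) := by
    obtain ⟨c, rfl⟩ : ∃ c', c = c' + 1 := ⟨c - 1, by omega⟩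
    rw [pow_succ, Nat.mul_div_cancel _ hm, Nat.add_sub_cancel]
  refine ⟨e7, ?_⟩
  constructor
  all_goals
    simp only [num, thread, round, vec, st, letter, memNew, stNew, leave, stNext, rot, eval_add,
      eval_mul, eval_div, eval_mod, eval_lit, e0, e1, e7, e8, h.pow_eval, h0, h1, h3, hpow,
      Sys.codeNum, Sys.codeNode]

theorem Ready.marked_eval (hL : Layout Y cs f o) (h : Ready Y c f o s) {p d : ℕ} {x : Node}
    (hv : Values Y c p x d s) :
    marked.eval s ≠ 0 ↔ s.mem (2 * Y.len + idx.eval s) ≠ 0 ∨ Y.Start p x := by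
  obtain ⟨h0, h1, -, h3⟩ := h.header hL
  have e0 : len.eval s = Y.len := h.len_eq
  rw [marked, eval_or, eval_and, eval_and, eval_and, eval_and, eval_eq, eval_eq, eval_eq,
    h.Mi_eval hL, h.Ai_eval hL, hv.thread, hv.round, hv.vec, hv.st, eval_mod, hv.num, h3, Sys.Start,
    eval_load, eval_add, eval_mul, e0]
  rfl

theorem Ready.accept_eval (hL : Layout Y cs f o) (h : Ready Y c f o s) {p d : ℕ} {x : Node}
    (hv : Values Y c p x d s) : accept.eval s ≠ 0 ↔ Y.Accept c p x := by
  obtain ⟨h0, h1, -, h3⟩ := h.header hL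
  rw [accept, eval_and, eval_and, eval_and, eval_eq, eval_eq, eval_eq, h.Mf_eval hL, hv.thread,
    hv.round, eval_mod, eval_div vec, eval_div num, hv.wt, hv.vec, hv.num, h1, h3, Sys.Accept]
  rfl

theorem Ready.step_eval (hL : Layout Y cs f o) (h : Ready Y c f o s) {p d : ℕ} {x : Node}
    (hv : Values Y c p x d s) : step.eval s ≠ 0 ↔
      x.i < Y.t ∧ Y.Md (x.v % Y.m) (d % Y.ops) (d / Y.ops % Y.m) ∧
        Y.Ad x.i x.a (d % Y.ops) (d / Y.ops / Y.m % Y.len) := by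
  obtain ⟨h0, h1, -, h3⟩ := h.header hL
  rw [step, eval_and, eval_and, eval_lt, h.Md_eval hL, h.Ad_eval hL, hv.thread, eval_mod, hv.vec,
    hv.letter, hv.memNew, hv.st, hv.stNew, h1, h3]

theorem Ready.mark_run (hL : Layout Y cs f o) (h : Ready Y c f o s) {p d : ℕ} {x y : Node}
    (hv : Values Y c p x d s) {i k v a : Expr} (hi : i.eval s = y.i) (hk : k.eval s = y.k)
    (hv' : v.eval s = y.v) (ha : a.eval s = y.a) :
    (mark i k v a).run s = s.setMem (2 * Y.len + Y.code c p y) 1 := by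
  obtain ⟨h0, h1, -, h3⟩ := h.header hL
  have e0 : len.eval s = Y.len := h.len_eq
  have e1 : rounds.eval s = c := h.rounds_eq
  simp only [mark, Cmd.run, eval_add, eval_mul, eval_lit, hv.num, h1, hi, hk, hv', ha, e0, e1,
    h.pow_eval, Sys.code]

/-- What the body of the main loop does for a marked node. -/
theorem Ready.step_run (hL : Layout Y cs f o) (h : Ready Y c f o s) {p d : ℕ} {x : Node}
    (hv : Values Y c p x d s) {s' : State}
    (hs' : s' = (Cmd.ite step
        (.ite leave
          (.ite (lt (round + lit 1) rounds)
            (mark thread (round + lit 1) rot stNew)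
            (.ite (Af thread stNew * (eq (thread + lit 1) threads + Ai (thread + lit 1) stNext))
              (mark (thread + lit 1) (lit 0) rot stNext) .skip))
          (mark thread round (vec - vec % mem + memNew) stNew))
        .skip).run s) :
    (∃ y, Y.EdgeAt c d x y ∧ s' = s.setMem (2 * Y.len + Y.code c p y) 1 ∧
      ∀ y', Y.EdgeAt c d x y' → y' = y) ∨ (∀ y, ¬ Y.EdgeAt c d x y) ∧ s' = s := by
  obtain ⟨h0, h1, -, h3⟩ := h.header hL
  have e1 : rounds.eval s = c := h.rounds_eq
  have hlt : (lt (round + lit 1) rounds).eval s ≠ 0 ↔ x.k + 1 < c := by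
    rw [eval_lt, eval_add, hv.round, eval_lit, e1]
  have hcond : (Af thread stNew * (eq (thread + lit 1) threads +
      Ai (thread + lit 1) stNext)).eval s ≠ 0 ↔
      Y.Af x.i (d / Y.ops / Y.m % Y.len) ∧
        (x.i + 1 = Y.t ∨ Y.Ai (x.i + 1) (d / Y.ops / Y.m / Y.len / 2)) := by
    rw [eval_and, eval_or, eval_eq, h.Af_eval hL, h.Ai_eval hL, eval_add, eval_lit, hv.thread,
      hv.stNew, hv.stNext, h1]
  simp only [Cmd.run, hlt, hv.leave] at hs'
  unfold Sys.EdgeAt Sys.Edge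
  split_ifs at hs' with c1 c2 c3 c4 <;> rw [h.step_eval hL hv] at c1 <;> try rw [hcond] at c4
  · refine Or.inl ⟨⟨x.i, x.k + 1, x.v / Y.m + d / Y.ops % Y.m * Y.m ^ (c - 1),
      d / Y.ops / Y.m % Y.len⟩, ⟨c1, Or.inr (Or.inl ⟨c2, c3, rfl⟩)⟩, ?_, ?_⟩
    · rw [hs']
      exact h.mark_run hL hv hv.thread (by simp [hv.round]) hv.rot hv.stNew
    · rintro y' ⟨-, ⟨e, -⟩ | ⟨-, -, e⟩ | ⟨-, e, -⟩⟩
      · exact absurd e c2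
      · exact e
      · exact absurd c3 e
  · refine Or.inl ⟨⟨x.i + 1, 0, x.v / Y.m + d / Y.ops % Y.m * Y.m ^ (c - 1),
      d / Y.ops / Y.m / Y.len / 2⟩, ⟨c1, Or.inr (Or.inr ⟨c2, c3, c4, rfl⟩)⟩, ?_, ?_⟩
    · rw [hs']
      exact h.mark_run hL hv (by simp [hv.thread]) rfl hv.rot hv.stNext
    · rintro y' ⟨-, ⟨e, -⟩ | ⟨-, e, -⟩ | ⟨-, -, -, e⟩⟩
      · exact absurd e c2
      · exact absurd e c3
      · exact e
  · refine Or.inr ⟨?_, hs'⟩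
    rintro y' ⟨-, ⟨e, -⟩ | ⟨-, e, -⟩ | ⟨-, -, e, -⟩⟩
    · exact absurd e c2
    · exact absurd e c3
    · exact absurd e c4
  · rw [not_not] at c2
    refine Or.inl ⟨⟨x.i, x.k, x.v - x.v % Y.m + d / Y.ops % Y.m,
      d / Y.ops / Y.m % Y.len⟩, ⟨c1, Or.inl ⟨c2, rfl⟩⟩, ?_, ?_⟩
    · rw [hs']
      exact h.mark_run hL hv hv.thread hv.round (by simp [hv.vec, hv.memNew, h3]) hv.stNew
    · rintro y' ⟨-, ⟨-, e⟩ | ⟨e, -⟩ | ⟨e, -⟩⟩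
      · exact e
      · exact absurd c2 e
      · exact absurd c2 e
  · exact Or.inr ⟨fun y' hy' => c1 hy'.1, hs'⟩

/-- A node and a numbered choice have at most one successor. So one pass changes at most one cell,
and the uniqueness clause makes that single mark cover every edge of this choice. -/
theorem Ready.body_run (hL : Layout Y cs f o) (h : Ready Y c f o s) (hc : 1 ≤ c) (hm : 1 ≤ Y.m)
    {p d z : ℕ} {x : Node} (hz : s.reg 3 = z) (hp : p = Y.codeNum c (Y.idx c z))
    (hx : x = Y.codeNode c (Y.idx c z)) (hd : d = Y.choice c z) {M : Prop}
    (hM : M ↔ s.mem (2 * Y.len + Y.idx c z) ≠ 0 ∨ Y.Start p x) :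
    (∀ r ≠ 4, (body.run s).reg r = s.reg r) ∧
    ((M ∧ Y.Accept c p x ∧ (body.run s).reg 4 = 1) ∨
      (¬ (M ∧ Y.Accept c p x) ∧ (body.run s).reg 4 = s.reg 4)) ∧
    ((M ∧ ∃ y, Y.EdgeAt c d x y ∧
        (∀ a, (body.run s).mem a = if a = 2 * Y.len + Y.code c p y then 1 else s.mem a) ∧
        ∀ y', Y.EdgeAt c d x y' → y' = y) ∨
      (¬ (M ∧ ∃ y, Y.EdgeAt c d x y) ∧ (body.run s).mem = s.mem)) := by
  obtain ⟨hidx, hv⟩ := h.values hL hc hm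
  rw [hz] at hidx
  rw [hz, ← hp, ← hx, ← hd] at hv
  have hmark := h.marked_eval hL hv
  rw [hidx, ← hM] at hmark
  by_cases hM' : M
  · have h4 : ∀ s', s' = s.setReg 4 1 ∨ s' = s → Ready Y c f o s' := by
      rintro s' (rfl | rfl)
      · exact ⟨by simpa using h.len_eq, by simpa using h.rounds_eq, by simpa using h.pow_eq, h.input,
          h.offsets⟩
      · exact h
    have hrun : ∃ s1, (s1 = s.setReg 4 1 ∨ s1 = s) ∧
        (Y.Accept c p x ∧ s1.reg 4 = 1 ∨ ¬ Y.Accept c p x ∧ s1.reg 4 = s.reg 4) ∧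
        body.run s = (Cmd.ite step
        (.ite leave
          (.ite (lt (round + lit 1) rounds)
            (mark thread (round + lit 1) rot stNew)
            (.ite (Af thread stNew * (eq (thread + lit 1) threads + Ai (thread + lit 1) stNext))
              (mark (thread + lit 1) (lit 0) rot stNext) .skip))
          (mark thread round (vec - vec % mem + memNew) stNew))
        .skip).run s1 := by
      rw [body, Cmd.run, if_pos (hmark.2 hM'), Cmd.run]
      by_cases ha : Y.Accept c p x
      · refine ⟨s.setReg 4 1, Or.inl rfl, Or.inl ⟨ha, by simp⟩, ?_⟩
        conv_lhs => arg 2; rw [Cmd.run, if_pos ((h.accept_eval hL hv).2 ha)]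
        rfl
      · refine ⟨s, Or.inr rfl, Or.inr ⟨ha, rfl⟩, ?_⟩
        conv_lhs => arg 2; rw [Cmd.run, if_neg (fun e => ha ((h.accept_eval hL hv).1 e))]
        rfl
    obtain ⟨s1, hs1, hacc, hrun⟩ := hrun
    have h1 := h4 s1 hs1
    have hreg : ∀ r ≠ 4, s1.reg r = s.reg r := by
      rcases hs1 with rfl | rfl
      · intro r hr; simp [hr]
      · exact fun _ _ => rfl
    have hmem : s1.mem = s.mem := by rcases hs1 with rfl | rfl <;> rfl
    obtain ⟨-, hv1⟩ := h1.values hL hc hm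
    rw [hreg 3 (by omega), hz, ← hp, ← hx, ← hd] at hv1
    refine ⟨?_, ?_, ?_⟩
    · rcases h1.step_run hL hv1 hrun with ⟨y, -, e, -⟩ | ⟨-, e⟩
      · rw [e]; exact hreg
      · rw [e]; exact hreg
    · have e4 : (body.run s).reg 4 = s1.reg 4 := by
        rcases h1.step_run hL hv1 hrun with ⟨y, -, e, -⟩ | ⟨-, e⟩ <;> rw [e]; rfl
      rw [e4]
      rcases hacc with ⟨ha, e⟩ | ⟨ha, e⟩
      · exact Or.inl ⟨hM', ha, e⟩
      · exact Or.inr ⟨fun hh => ha hh.2, e⟩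
    · rcases h1.step_run hL hv1 hrun with ⟨y, hy, e, hu⟩ | ⟨hn, e⟩
      · refine Or.inl ⟨hM', y, hy, fun a => ?_, hu⟩
        rw [e, State.setMem_mem, hmem]
      · refine Or.inr ⟨fun ⟨_, y, hy⟩ => hn y hy, by rw [e, hmem]⟩
  · have hrun : body.run s = s := by
      rw [body, Cmd.run, if_neg (fun e => hM' (hmark.1 e))]; rfl
    rw [hrun]
    exact ⟨fun _ _ => rfl, Or.inr ⟨fun e => hM' e.1, rfl⟩, Or.inr ⟨fun e => hM' e.1, rfl⟩⟩

end Eval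

end Search


/-- Every thread occupies at least one cell of the input, namely its number of states. Hence the
table of positions ends before address `2 * len`, where the marks begin. -/
theorem Layout.t_add_le {Y : Sys} {cs : ℕ} {f o : ℕ → ℕ} (hL : Layout Y cs f o) :
    Y.t + 4 + 2 * Y.m ≤ Y.len := by
  have key : ∀ i ≤ Y.t, i + 4 + 2 * Y.m ≤ o i := by
    intro i
    induction i with
    | zero => intro _; rw [hL.off_zero]; omega
    | succ i ih =>
      intro hi
      have := ih (by omega)
      rw [hL.off_succ i (by omega)]; omega
  have := key _ le_rfl
  rwa [hL.off_last] at this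

namespace Search

open BCS.Expr

variable {Y : Sys} {c cs : ℕ} {f o : ℕ → ℕ}

/-! ### The main loop -/

/-- Invariant of the main loop. -/
structure Inv (Y : Sys) (c : ℕ) (f o : ℕ → ℕ) (z : ℕ) (s : State) : Prop where
  ready : Ready Y c f o s
  counter : s.reg 3 = z
  spare : s.reg 5 = 0
  answer_le : s.reg 4 ≤ 1
  mem_le : ∀ a, Y.len + Y.t ≤ a → s.mem a ≤ 1
  z_le : z ≤ Y.nodes c * Y.sweep c
  sound : ∀ d, s.mem (2 * Y.len + d) ≠ 0 →
    ∃ p < Y.m ^ c, ∃ x n, Y.Level c p n x ∧ d = Y.code c p x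
  answer_sound : s.reg 4 ≠ 0 → Y.Reachable c
  complete : ∀ z', z ≤ z' → z' < Y.nodes c * Y.sweep c →
    Y.Level c (Y.codeNum c (Y.idx c z')) (Y.nodes c - 1 - z' / Y.sweep c)
      (Y.codeNode c (Y.idx c z')) →
    ∀ y, Y.EdgeAt c (Y.choice c z') (Y.codeNode c (Y.idx c z')) y →
      s.mem (2 * Y.len + Y.code c (Y.codeNum c (Y.idx c z')) y) ≠ 0
  answer_complete : ∀ z', z ≤ z' → z' < Y.nodes c * Y.sweep c →
    Y.Level c (Y.codeNum c (Y.idx c z')) (Y.nodes c - 1 - z' / Y.sweep c)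
      (Y.codeNode c (Y.idx c z')) →
    Y.Accept c (Y.codeNum c (Y.idx c z')) (Y.codeNode c (Y.idx c z')) → s.reg 4 ≠ 0

theorem idx_mul_add {r e d : ℕ} (he : e * Y.choices + d < Y.sweep c) (hd : d < Y.choices) :
    (r * Y.sweep c + (e * Y.choices + d)) / Y.sweep c = r ∧
      Y.idx c (r * Y.sweep c + (e * Y.choices + d)) = e ∧
      Y.choice c (r * Y.sweep c + (e * Y.choices + d)) = d := by
  refine ⟨Sys.mul_add_div_of_lt he, ?_, ?_⟩
  · rw [Sys.idx, Sys.mul_add_mod_of_lt he, Sys.mul_add_div_of_lt hd]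
  · rw [Sys.choice, Sys.mul_add_mod_of_lt he, Sys.mul_add_mod_of_lt hd]

theorem code_mul_add_lt {p d : ℕ} {x : Node} (hp : p < Y.m ^ c) (hx : Y.Valid c x)
    (hd : d < Y.choices) : Y.code c p x * Y.choices + d < Y.sweep c :=
  Sys.mul_add_lt (Sys.code_lt hp hx) hd

theorem idx_lt {z : ℕ} (hz : z < Y.nodes c * Y.sweep c) :
    Y.idx c z < Y.m ^ c * Y.nodes c ∧ Y.choice c z < Y.choices := by
  have h1 : 0 < Y.sweep c := Nat.pos_of_ne_zero fun e => by rw [e, mul_zero] at hz; omega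
  have h2 : 0 < Y.choices := Nat.pos_of_ne_zero fun e => by rw [Sys.sweep, e, mul_zero] at h1; omega
  refine ⟨Nat.div_lt_of_lt_mul ?_, Nat.mod_lt _ h2⟩
  rw [mul_comm]
  exact Nat.mod_lt _ h1

theorem codeNum_lt {d : ℕ} (hd : d < Y.m ^ c * Y.nodes c) : Y.codeNum c d < Y.m ^ c := by
  rw [Sys.codeNum, Nat.div_div_eq_div_mul, Nat.div_div_eq_div_mul, Nat.div_div_eq_div_mul]
  refine Nat.div_lt_of_lt_mul (hd.trans_eq ?_)
  rw [Sys.nodes]; ring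

theorem Inv.marked_sound {z : ℕ} {s : State} (hc : 1 ≤ c) (h : Inv Y c f o (z + 1) s)
    (hM : s.mem (2 * Y.len + Y.idx c z) ≠ 0 ∨
      Y.Start (Y.codeNum c (Y.idx c z)) (Y.codeNode c (Y.idx c z))) :
    ∃ n, Y.Level c (Y.codeNum c (Y.idx c z)) n (Y.codeNode c (Y.idx c z)) := by
  rcases hM with hM | hM
  · obtain ⟨p, hp, x, n, hl, e⟩ := h.sound _ hM
    have hv := hl.valid hc hp
    rw [e, Sys.codeNum_code hv, Sys.codeNode_code hv]
    exact ⟨n, hl⟩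
  · exact ⟨0, hM⟩

/-- The counter runs downwards, so `z / Y.sweep c` is the number of sweeps still to come, and the
current sweep is responsible for level `Y.nodes c - 1 - z / Y.sweep c`. A node of positive level has
a predecessor one level below. That predecessor was treated, with the right choice, in the preceding
sweep, whose counters are all larger than `z`, so the mark is already there. -/
theorem Inv.marked_complete {z : ℕ} {s : State} (hc : 1 ≤ c) (h : Inv Y c f o (z + 1) s)
    (hl : Y.Level c (Y.codeNum c (Y.idx c z)) (Y.nodes c - 1 - z / Y.sweep c)
      (Y.codeNode c (Y.idx c z))) :
    s.mem (2 * Y.len + Y.idx c z) ≠ 0 ∨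
      Y.Start (Y.codeNum c (Y.idx c z)) (Y.codeNode c (Y.idx c z)) := by
  have hp := codeNum_lt (idx_lt (Nat.lt_of_succ_le h.z_le)).1
  rcases hn : Y.nodes c - 1 - z / Y.sweep c with _ | n
  · rw [hn] at hl
    exact Or.inr hl
  · left
    rw [hn] at hl
    obtain ⟨x, hx, hs⟩ := hl
    obtain ⟨d, hd, he⟩ := hs.exists_edgeAt
    have hv := hx.valid hc hp
    have hlt := code_mul_add_lt hp hv hd
    obtain ⟨e1, e2, e3⟩ := idx_mul_add (r := z / Y.sweep c + 1) hlt hd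
    have hge : z + 1 ≤ (z / Y.sweep c + 1) * Y.sweep c +
        (Y.code c (Y.codeNum c (Y.idx c z)) x * Y.choices + d) := by
      have h1 := Nat.div_add_mod' z (Y.sweep c)
      have h2 := Nat.mod_lt z (show Y.sweep c > 0 by omega)
      rw [add_mul]; omega
    have hlt' : (z / Y.sweep c + 1) * Y.sweep c +
        (Y.code c (Y.codeNum c (Y.idx c z)) x * Y.choices + d) < Y.nodes c * Y.sweep c :=
      Sys.mul_add_lt (by omega) hlt
    have := h.complete _ hge hlt'
    rw [e1, e2, e3, Sys.codeNum_code hv, Sys.codeNode_code hv] at this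
    have := this (by rwa [(by omega : Y.nodes c - 1 - (z / Y.sweep c + 1) = n)]) _ he
    rwa [Sys.code_codeNum] at this

/-- Neither marks nor a positive answer are ever erased, so the completeness statements for earlier
counters persist; the one for the current counter comes from `marked_complete` and `body_run`. -/
theorem Inv.step (hL : Layout Y cs f o) (hc : 1 ≤ c) (hm : 1 ≤ Y.m) {z : ℕ} {s : State}
    (h : Inv Y c f o (z + 1) s) : Inv Y c f o z (body.run (s.setReg 3 z)) := by
  have hr := h.ready
  have hr0 : Ready Y c f o (s.setReg 3 z) := ⟨by simpa using hr.len_eq, by simpa using hr.rounds_eq,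
    by simpa using hr.pow_eq, hr.input, hr.offsets⟩
  obtain ⟨hreg, hans, hmem⟩ := hr0.body_run hL hc hm (z := z) (by simp) rfl rfl rfl
    (M := s.mem (2 * Y.len + Y.idx c z) ≠ 0 ∨
      Y.Start (Y.codeNum c (Y.idx c z)) (Y.codeNode c (Y.idx c z))) Iff.rfl
  simp only [State.setReg_reg, State.setReg_mem, show ¬ 4 = 3 by omega, if_false] at hreg hans hmem
  have htl := Layout.t_add_le hL
  have hidx := idx_lt (Nat.lt_of_succ_le h.z_le)
  have hp := codeNum_lt hidx.1
  have hmem' : ∀ a, (body.run (s.setReg 3 z)).mem a = s.mem a ∨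
      2 * Y.len ≤ a ∧ (body.run (s.setReg 3 z)).mem a = 1 := by
    intro a
    rcases hmem with ⟨_, y, _, e, _⟩ | ⟨_, e⟩
    · rw [e]
      split_ifs with ha
      · exact Or.inr ⟨by omega, rfl⟩
      · exact Or.inl rfl
    · exact Or.inl (by rw [e])
  have hlow : ∀ a < 2 * Y.len, (body.run (s.setReg 3 z)).mem a = s.mem a := fun a ha =>
    (hmem' a).resolve_right (by omega)
  have hmono : ∀ a, s.mem a ≠ 0 → (body.run (s.setReg 3 z)).mem a ≠ 0 := by
    intro a ha
    rcases hmem' a with e | ⟨_, e⟩ <;> omega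
  have hans' : s.reg 4 ≠ 0 → (body.run (s.setReg 3 z)).reg 4 ≠ 0 := by
    intro ha
    rcases hans with ⟨_, _, e⟩ | ⟨_, e⟩ <;> omega
  refine ⟨⟨?_, ?_, ?_, ?_, ?_⟩, ?_, ?_, ?_, ?_, ?_, ?_, ?_, ?_, ?_⟩
  · rw [hreg 0 (by omega)]; simpa using hr.len_eq
  · rw [hreg 1 (by omega)]; simpa using hr.rounds_eq
  · rw [hreg 2 (by omega)]; simpa using hr.pow_eq
  · intro a ha; rw [hlow a (by omega)]; exact hr.input a ha
  · intro i hi; rw [hlow _ (by omega)]; exact hr.offsets i hi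
  · rw [hreg 3 (by omega)]; simp
  · rw [hreg 5 (by omega)]; simpa using h.spare
  · have := h.answer_le
    rcases hans with ⟨_, _, e⟩ | ⟨_, e⟩ <;> omega
  · intro a ha
    have := h.mem_le a ha
    rcases hmem' a with e | ⟨_, e⟩ <;> omega
  · have := h.z_le; omega
  · intro d hd
    rcases hmem with ⟨hM, y, hy, e, -⟩ | ⟨_, e⟩
    · rw [e] at hd
      split_ifs at hd with hdy
      · obtain ⟨n, hl⟩ := h.marked_sound hc hM
        exact ⟨_, hp, y, n + 1, ⟨_, hl, hy.step hidx.2 (hl.valid hc hp)⟩, by omega⟩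
      · exact h.sound d hd
    · rw [e] at hd; exact h.sound d hd
  · intro ha
    rcases hans with ⟨hM, hacc, -⟩ | ⟨_, e⟩
    · obtain ⟨n, hl⟩ := h.marked_sound hc hM
      obtain ⟨x, hx, hrt⟩ := hl.reflTransGen
      exact ⟨_, hp, x, _, hx, hrt, hacc⟩
    · rw [e] at ha; exact h.answer_sound ha
  · intro z' hz' hlt hl y hy
    rcases Nat.eq_or_lt_of_le hz' with rfl | hz'
    · have hM := h.marked_complete hc hl
      rcases hmem with ⟨-, y', hy', e, hu⟩ | ⟨hn, -⟩
      · obtain rfl := hu y hy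
        rw [e, if_pos rfl]; exact one_ne_zero
      · exact absurd ⟨hM, y, hy⟩ hn
    · exact hmono _ (h.complete z' hz' hlt hl y hy)
  · intro z' hz' hlt hl hacc
    rcases Nat.eq_or_lt_of_le hz' with rfl | hz'
    · have hM := h.marked_complete hc hl
      rcases hans with ⟨-, -, e⟩ | ⟨hn, -⟩
      · omega
      · exact absurd ⟨hM, hacc⟩ hn
    · exact hans' (h.answer_complete z' hz' hlt hl hacc)

theorem Inv.answer {s : State} (hc : 1 ≤ c) (h : Inv Y c f o 0 s) :
    s.reg 4 ≠ 0 ↔ Y.Reachable c := by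
  refine ⟨h.answer_sound, fun hr => ?_⟩
  obtain ⟨p, hp, n, hn, y, hl, ha⟩ := (Sys.reachable_iff hc).1 hr
  have hv := hl.valid hc hp
  -- An accepting node is inspected only in company of some choice, so there must be one. It exists
  -- because an accepting node has thread `t ≥ 1`, is not a start node, and is therefore entered by
  -- an edge.
  have hch : 0 < Y.choices := by
    cases n with
    | zero =>
      have h1 := ha.1
      have h2 := hl.1
      have := Y.t_pos
      omega
    | succ n =>
      obtain ⟨x, -, hs⟩ := hl
      obtain ⟨d, hd, -⟩ := hs.exists_edgeAt
      omega
  have hlt := code_mul_add_lt hp hv hch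
  obtain ⟨e1, e2, -⟩ := idx_mul_add (r := Y.nodes c - 1 - n) hlt hch
  have := h.answer_complete
    ((Y.nodes c - 1 - n) * Y.sweep c + (Y.code c p y * Y.choices + 0)) (Nat.zero_le _)
    (Sys.mul_add_lt (by omega) hlt)
  rw [e1, e2, Sys.codeNum_code hv, Sys.codeNode_code hv] at this
  exact this (by rwa [(by omega : Y.nodes c - 1 - (Y.nodes c - 1 - n) = n)]) ha

/-! ### Preparation -/

def givenRounds : Expr := load (lit 2)

/-- The comparison has value `1` or `0`, so the difference is `min cs len` for a single memory state
and `cs` otherwise. -/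
def setRounds : Cmd :=
  .seq (.assign 1 (givenRounds - eq mem (lit 1) * (givenRounds - len)))
    (.seq (.assign 2 (lit 1)) (.assign 3 rounds))

def powBody : Cmd := .assign 2 (pow * mem)

def setOffset : Cmd :=
  .seq (.assign 5 (lit 4 + lit 2 * mem + mem * ops * mem)) (.assign 3 threads)

/-- The counter has already been decreased, so thread `t - 1 - counter` is next; register `5`
carries its position. -/
def offsetBody : Cmd :=
  .seq (.store (len + (threads - lit 1 - counter)) (var 5))
    (.assign 5 (var 5 + lit 1 + lit 2 * load (var 5) + load (var 5) * ops * load (var 5)))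

def setTrivial : Cmd := .seq (.assign 5 (lit 0)) (.assign 3 mem)

/-- With zero rounds only the empty word is possible, and it is accepted exactly if some memory
state is both initial and final. -/
def trivialBody : Cmd :=
  .ite (eq rounds (lit 0) * (Mi counter * Mf counter)) (.assign 4 (lit 1)) .skip

/-- The search is skipped for zero rounds and for one thread with more than one round; in the latter
case register `4` is still `0`. The test uses the given number of rounds, not the truncated one. -/
def setCounter : Cmd :=
  .ite (eq rounds (lit 0) + eq threads (lit 1) * lt (lit 1) givenRounds)
    (.assign 3 (lit 0)) (.assign 3 (nodes * sweep))

/-- The decision procedure. -/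
def prog : Prog :=
  .seq setRounds.compile <| .seq (powBody.forLoop 3) <|
  .seq setOffset.compile <| .seq (offsetBody.forLoop 3) <|
  .seq setTrivial.compile <| .seq (trivialBody.forLoop 3) <|
  .seq setCounter.compile <| .seq (body.forLoop 3) (.copy 0 4)

/-- With a single memory state the number of rounds is cut off at the length of the input. -/
def effectiveRounds (cs m len : ℕ) : ℕ := if m = 1 then min cs len else cs

/-- Bounds on the bit lengths of the constants of the search. -/
structure Bits (Y : Sys) (c : ℕ) (f : ℕ → ℕ) (B : ℕ) : Prop where
  one : 1 ≤ B
  input : ∀ a, Nat.size (f a) ≤ B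
  len : Nat.size Y.len ≤ B
  rounds : Nat.size c ≤ B
  pow : Nat.size (Y.m ^ c) ≤ B
  total : Nat.size (Y.nodes c * Y.sweep c) ≤ B

theorem bounded_of {B : ℕ} {s : State} (h0 : Nat.size (s.reg 0) ≤ B) (h1 : Nat.size (s.reg 1) ≤ B)
    (h2 : Nat.size (s.reg 2) ≤ B) (h3 : Nat.size (s.reg 3) ≤ B) (h4 : Nat.size (s.reg 4) ≤ B)
    (h5 : Nat.size (s.reg 5) ≤ B) (hm : ∀ a, Nat.size (s.mem a) ≤ B) : Bounded B s := by
  refine ⟨fun x hx => ?_, hm⟩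
  interval_cases x <;> assumption

theorem size_le_one {a B : ℕ} (hB : 1 ≤ B) (ha : a ≤ 1) : Nat.size a ≤ B :=
  (Nat.size_le_size ha).trans (by rwa [Nat.size_one])

theorem Inv.bounded {B z : ℕ} {s : State} (hL : Layout Y cs f o) (hb : Bits Y c f B)
    (h : Inv Y c f o z s) : Bounded B s := by
  refine bounded_of ?_ ?_ ?_ ?_ (size_le_one hb.one h.answer_le) ?_ fun a => ?_
  · rw [h.ready.len_eq]; exact hb.len
  · rw [h.ready.rounds_eq]; exact hb.rounds
  · rw [h.ready.pow_eq]; exact hb.pow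
  · rw [h.counter]; exact (Nat.size_le_size h.z_le).trans hb.total
  · rw [h.spare]; simp
  · rcases Nat.lt_or_ge a Y.len with h1 | h1
    · rw [h.ready.input a h1]; exact hb.input a
    rcases Nat.lt_or_ge a (Y.len + Y.t) with h2 | h2
    · obtain ⟨i, rfl⟩ : ∃ i, a = Y.len + i := ⟨a - Y.len, by omega⟩
      rw [h.ready.offsets i (by omega)]
      have := hL.off_mono (show i ≤ Y.t by omega) le_rfl
      rw [hL.off_last] at this
      exact (Nat.size_le_size this).trans hb.len
    · exact size_le_one hb.one (h.mem_le a h2)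

/-- Invariant of the computation of the power. -/
structure PowInv (Y : Sys) (c : ℕ) (f : ℕ → ℕ) (j : ℕ) (s : State) : Prop where
  r0 : s.reg 0 = Y.len
  r1 : s.reg 1 = c
  r2 : s.reg 2 = Y.m ^ (c - j)
  r3 : s.reg 3 = j
  r4 : s.reg 4 = 0
  r5 : s.reg 5 = 0
  mem : s.mem = f
  le : j ≤ c

/-- Invariant of the computation of the positions of the threads. -/
structure OffsetInv (Y : Sys) (c : ℕ) (f o : ℕ → ℕ) (j : ℕ) (s : State) : Prop where
  r0 : s.reg 0 = Y.len
  r1 : s.reg 1 = c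
  r2 : s.reg 2 = Y.m ^ c
  r3 : s.reg 3 = j
  r4 : s.reg 4 = 0
  r5 : s.reg 5 = o (Y.t - j)
  input : ∀ a < Y.len, s.mem a = f a
  offsets : ∀ i < Y.t - j, s.mem (Y.len + i) = o i
  rest : ∀ a, Y.len + (Y.t - j) ≤ a → s.mem a = 0
  le : j ≤ Y.t

/-- Invariant of the treatment of the empty word. -/
structure TrivialInv (Y : Sys) (c : ℕ) (f o : ℕ → ℕ) (j : ℕ) (s : State) : Prop where
  ready : Ready Y c f o s
  r3 : s.reg 3 = j
  r4 : s.reg 4 ≤ 1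
  r5 : s.reg 5 = 0
  rest : ∀ a, Y.len + Y.t ≤ a → s.mem a = 0
  le : j ≤ Y.m
  answer : s.reg 4 ≠ 0 ↔ c = 0 ∧ ∃ q ≥ j, Y.Mi q ∧ Y.Mf q

theorem PowInv.bounded {B j : ℕ} {s : State} (hm : 1 ≤ Y.m) (hb : Bits Y c f B)
    (h : PowInv Y c f j s) : Bounded B s := by
  refine bounded_of ?_ ?_ ?_ ?_ ?_ ?_ fun a => ?_
  · rw [h.r0]; exact hb.len
  · rw [h.r1]; exact hb.rounds
  · rw [h.r2]
    exact (Nat.size_le_size (Nat.pow_le_pow_right hm (by omega))).trans hb.pow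
  · rw [h.r3]; exact (Nat.size_le_size h.le).trans hb.rounds
  · rw [h.r4]; simp
  · rw [h.r5]; simp
  · rw [h.mem]; exact hb.input a

theorem PowInv.step {j : ℕ} {s : State} (hL : Layout Y cs f o) (h : PowInv Y c f (j + 1) s) :
    PowInv Y c f j (powBody.run (s.setReg 3 j)) := by
  have hle := h.le
  have e : powBody.run (s.setReg 3 j) = (s.setReg 3 j).setReg 2 (Y.m ^ (c - j)) := by
    have e1 : pow.eval (s.setReg 3 j) = Y.m ^ (c - (j + 1)) := h.r2
    have e2 : Search.mem.eval (s.setReg 3 j) = Y.m := by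
      show s.mem 3 = _
      rw [h.mem, hL.m]
    show (s.setReg 3 j).setReg 2 (pow.eval (s.setReg 3 j) * Search.mem.eval (s.setReg 3 j)) = _
    rw [e1, e2, ← pow_succ, (by omega : c - (j + 1) + 1 = c - j)]
  rw [e]
  exact ⟨by simpa using h.r0, by simpa using h.r1, by simp, by simp, by simpa using h.r4,
    by simpa using h.r5, h.mem, by omega⟩

theorem OffsetInv.bounded {B j : ℕ} {s : State} (hL : Layout Y cs f o) (hb : Bits Y c f B)
    (h : OffsetInv Y c f o j s) : Bounded B s := by
  have htl := Layout.t_add_le hL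
  have hle := h.le
  have hoff : ∀ i ≤ Y.t, Nat.size (o i) ≤ B := by
    intro i hi
    have := hL.off_mono hi le_rfl
    rw [hL.off_last] at this
    exact (Nat.size_le_size this).trans hb.len
  refine bounded_of ?_ ?_ ?_ ?_ ?_ ?_ fun a => ?_
  · rw [h.r0]; exact hb.len
  · rw [h.r1]; exact hb.rounds
  · rw [h.r2]; exact hb.pow
  · rw [h.r3]; exact (Nat.size_le_size (by omega)).trans hb.len
  · rw [h.r4]; simp
  · rw [h.r5]; exact hoff _ (by omega)
  · rcases Nat.lt_or_ge a Y.len with h1 | h1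
    · rw [h.input a h1]; exact hb.input a
    rcases Nat.lt_or_ge a (Y.len + (Y.t - j)) with h2 | h2
    · obtain ⟨i, rfl⟩ : ∃ i, a = Y.len + i := ⟨a - Y.len, by omega⟩
      rw [h.offsets i (by omega)]
      exact hoff _ (by omega)
    · rw [h.rest a h2]; simp

theorem OffsetInv.step {j : ℕ} {s : State} (hL : Layout Y cs f o)
    (h : OffsetInv Y c f o (j + 1) s) : OffsetInv Y c f o j (offsetBody.run (s.setReg 3 j)) := by
  have hle := h.le
  have htl := Layout.t_add_le hL
  have hsucc := hL.off_succ (Y.t - (j + 1)) (by omega)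
  have hlast := hL.off_mono (show Y.t - (j + 1) + 1 ≤ Y.t by omega) le_rfl
  rw [hL.off_last] at hlast
  have hj : Y.t - (j + 1) + 1 = Y.t - j := by omega
  have hmem1 : ∀ a < Y.len, ((s.setReg 3 j).setMem (Y.len + (Y.t - (j + 1)))
      (o (Y.t - (j + 1)))).mem a = f a := by
    intro a ha
    rw [State.setMem_mem, if_neg (by omega)]
    exact h.input a ha
  have e : offsetBody.run (s.setReg 3 j) = ((s.setReg 3 j).setMem (Y.len + (Y.t - (j + 1)))
      (o (Y.t - (j + 1)))).setReg 5 (o (Y.t - j)) := by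
    have e1 : (len + (threads - lit 1 - counter)).eval (s.setReg 3 j) =
        Y.len + (Y.t - (j + 1)) := by
      have e0 : len.eval (s.setReg 3 j) = Y.len := h.r0
      have e2 : threads.eval (s.setReg 3 j) = Y.t := (h.input 1 (by omega)).trans hL.t
      have e3 : counter.eval (s.setReg 3 j) = j := by
        show (s.setReg 3 j).reg 3 = j
        simp
      rw [eval_add, eval_sub, eval_sub, e0, e2, e3, eval_lit, Nat.sub_sub, add_comm 1]
    have e2 : (var 5).eval (s.setReg 3 j) = o (Y.t - (j + 1)) := h.r5
    have e3 : (var 5).eval ((s.setReg 3 j).setMem (Y.len + (Y.t - (j + 1)))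
      (o (Y.t - (j + 1)))) = o (Y.t - (j + 1)) := h.r5
    have e4 : ops.eval ((s.setReg 3 j).setMem (Y.len + (Y.t - (j + 1)))
      (o (Y.t - (j + 1)))) = Y.ops := (hmem1 0 (by omega)).trans hL.ops
    rw [offsetBody, Cmd.run, Cmd.run, Cmd.run, e1, e2]
    simp only [eval_add, eval_mul, eval_lit, eval_load, e3, e4]
    rw [hmem1 _ (by omega), ← hsucc, hj]
    rfl
  rw [e]
  refine ⟨by simpa using h.r0, by simpa using h.r1, by simpa using h.r2, by simp,
    by simpa using h.r4, by simp, hmem1, fun i hi => ?_, fun a ha => ?_, by omega⟩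
  · rw [State.setReg_mem, State.setMem_mem]
    split_ifs with h1
    · congr 1; omega
    · exact h.offsets i (by omega)
  · rw [State.setReg_mem, State.setMem_mem, if_neg (by omega)]
    exact h.rest a (by omega)

theorem TrivialInv.bounded {B j : ℕ} {s : State} (hL : Layout Y cs f o) (hb : Bits Y c f B)
    (h : TrivialInv Y c f o j s) : Bounded B s := by
  have htl := Layout.t_add_le hL
  have hle := h.le
  refine bounded_of ?_ ?_ ?_ ?_ (size_le_one hb.one h.r4) ?_ fun a => ?_
  · rw [h.ready.len_eq]; exact hb.len
  · rw [h.ready.rounds_eq]; exact hb.rounds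
  · rw [h.ready.pow_eq]; exact hb.pow
  · rw [h.r3]; exact (Nat.size_le_size (by omega)).trans hb.len
  · rw [h.r5]; simp
  · rcases Nat.lt_or_ge a Y.len with h1 | h1
    · rw [h.ready.input a h1]; exact hb.input a
    rcases Nat.lt_or_ge a (Y.len + Y.t) with h2 | h2
    · obtain ⟨i, rfl⟩ : ∃ i, a = Y.len + i := ⟨a - Y.len, by omega⟩
      rw [h.ready.offsets i (by omega)]
      have := hL.off_mono (show i ≤ Y.t by omega) le_rfl
      rw [hL.off_last] at this
      exact (Nat.size_le_size this).trans hb.len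
    · rw [h.rest a h2]; simp

theorem Ready.setReg {s : State} (h : Ready Y c f o s) {x v : ℕ} (hx : 3 ≤ x) :
    Ready Y c f o (s.setReg x v) :=
  ⟨by rw [State.setReg_reg, if_neg (by omega)]; exact h.len_eq,
    by rw [State.setReg_reg, if_neg (by omega)]; exact h.rounds_eq,
    by rw [State.setReg_reg, if_neg (by omega)]; exact h.pow_eq, h.input, h.offsets⟩

theorem TrivialInv.step {j : ℕ} {s : State} (hL : Layout Y cs f o)
    (h : TrivialInv Y c f o (j + 1) s) :
    TrivialInv Y c f o j (trivialBody.run (s.setReg 3 j)) := by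
  have hle := h.le
  have hr : Ready Y c f o (s.setReg 3 j) := h.ready.setReg (by omega)
  have e1 : rounds.eval (s.setReg 3 j) = c := hr.rounds_eq
  have e3 : counter.eval (s.setReg 3 j) = j := by
    show (s.setReg 3 j).reg 3 = j
    simp
  have hcond : (eq rounds (lit 0) * (Mi counter * Mf counter)).eval (s.setReg 3 j) ≠ 0 ↔
      c = 0 ∧ Y.Mi j ∧ Y.Mf j := by
    rw [eval_and, eval_and, eval_eq, hr.Mi_eval hL, hr.Mf_eval hL, e1, e3, eval_lit]
  have hsplit : (∃ q ≥ j, Y.Mi q ∧ Y.Mf q) ↔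
      (Y.Mi j ∧ Y.Mf j) ∨ ∃ q ≥ j + 1, Y.Mi q ∧ Y.Mf q := by
    constructor
    · rintro ⟨q, hq, hh⟩
      rcases Nat.eq_or_lt_of_le hq with rfl | hq
      · exact Or.inl hh
      · exact Or.inr ⟨q, hq, hh⟩
    · rintro (hh | ⟨q, hq, hh⟩)
      · exact ⟨j, le_rfl, hh⟩
      · exact ⟨q, by omega, hh⟩
  have hans := h.answer
  have h4 := h.r4
  have h5 := h.r5
  have hrest := h.rest
  by_cases h1 : (eq rounds (lit 0) * (Mi counter * Mf counter)).eval (s.setReg 3 j) ≠ 0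
  · have e : trivialBody.run (s.setReg 3 j) = (s.setReg 3 j).setReg 4 1 := if_pos h1
    rw [e]
    rw [hcond] at h1
    refine ⟨hr.setReg (by omega), by simp, by simp, by simpa using h5, hrest, by omega, ?_⟩
    rw [hsplit]
    simp [h1]
  · have e : trivialBody.run (s.setReg 3 j) = s.setReg 3 j := if_neg h1
    rw [e]
    rw [hcond] at h1
    refine ⟨hr, by simp, by simpa using h4, by simpa using h5, hrest, by omega, ?_⟩
    rw [hsplit]
    simp only [State.setReg_reg, show ¬ 4 = 3 by omega, if_false]
    rw [hans]
    exact ⟨fun h => ⟨h.1, Or.inr h.2⟩, fun h => ⟨h.1, h.2.resolve_left fun hh => h1 ⟨h.1, hh⟩⟩⟩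

theorem setRounds_run (hL : Layout Y cs f o) {s : State} (h0 : s.reg 0 = Y.len)
    (hz : ∀ x, 1 ≤ x → x < 6 → s.reg x = 0) (hmem : s.mem = f)
    (hc : c = effectiveRounds cs Y.m Y.len) : PowInv Y c f c (setRounds.run s) := by
  have e1 : (givenRounds - eq Search.mem (lit 1) * (givenRounds - len)).eval s = c := by
    have e2 : givenRounds.eval s = cs := by
      show s.mem 2 = _
      rw [hmem, hL.cs]
    have e3 : Search.mem.eval s = Y.m := by
      show s.mem 3 = _
      rw [hmem, hL.m]
    have e4 : len.eval s = Y.len := h0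
    simp only [eq, eval_sub, eval_mul, eval_add, eval_lit, e2, e3, e4]
    rw [hc, effectiveRounds]
    split_ifs with h1
    · rw [h1]
      simp only [Nat.sub_self, add_zero, Nat.sub_zero, one_mul]; omega
    · rw [(by omega : 1 - (Y.m - 1 + (1 - Y.m)) = 0), zero_mul, Nat.sub_zero]
  have e : setRounds.run s = ((s.setReg 1 c).setReg 2 1).setReg 3 c := by
    rw [setRounds, Cmd.run, Cmd.run, Cmd.run, Cmd.run, Cmd.run, e1]
    rfl
  rw [e]
  exact ⟨by simpa using h0, by simp, by simp, by simp, by simpa using hz 4 (by omega) (by omega),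
    by simpa using hz 5 (by omega) (by omega), hmem, le_rfl⟩

theorem setOffset_run (hL : Layout Y cs f o) {s : State} (h : PowInv Y c f 0 s) :
    OffsetInv Y c f o Y.t (setOffset.run s) := by
  have e : setOffset.run s = (s.setReg 5 (o 0)).setReg 3 Y.t := by
    have e1 : (lit 4 + lit 2 * Search.mem + Search.mem * ops * Search.mem).eval s = o 0 := by
      have e2 : ops.eval s = Y.ops := by
        show s.mem 0 = _
        rw [h.mem, hL.ops]
      have e3 : Search.mem.eval s = Y.m := by
        show s.mem 3 = _
        rw [h.mem, hL.m]
      simp only [eval_add, eval_mul, eval_lit, e2, e3, hL.off_zero]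
    have e2 : threads.eval (s.setReg 5 (o 0)) = Y.t := by
      show s.mem 1 = _
      rw [h.mem, hL.t]
    rw [setOffset, Cmd.run, Cmd.run, Cmd.run, e1]
    show (s.setReg 5 (o 0)).setReg 3 (threads.eval (s.setReg 5 (o 0))) = _
    rw [e2]
  rw [e]
  refine ⟨by simpa using h.r0, by simpa using h.r1, by simpa using h.r2, by simp,
    by simpa using h.r4, by simp, fun a _ => ?_, fun i hi => by omega, fun a ha => ?_, le_rfl⟩
  · exact congrFun h.mem a
  · exact (congrFun h.mem a).trans (hL.out a (by omega))

theorem setTrivial_run (hL : Layout Y cs f o) {s : State} (h : OffsetInv Y c f o 0 s) :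
    TrivialInv Y c f o Y.m (setTrivial.run s) := by
  have htl := Layout.t_add_le hL
  have hr : Ready Y c f o s := ⟨h.r0, h.r1, h.r2, h.input, h.offsets⟩
  have e : setTrivial.run s = (s.setReg 5 0).setReg 3 Y.m := by
    rw [← ((hr.setReg (x := 5) (v := 0) (by omega)).header hL).2.2.2]
    rfl
  rw [e]
  refine ⟨(hr.setReg (by omega)).setReg (by omega), by simp, by simp [h.r4], by simp, h.rest, le_rfl,
    ?_⟩
  simp only [State.setReg_reg, h.r4]
  simp only [show ¬ 4 = 3 by omega, show ¬ 4 = 5 by omega, if_false, ne_eq, not_true,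
    false_iff, not_and, not_exists]
  intro _ q hq hM
  have := Y.Mi_lt hM
  omega

theorem setCounter_run (hL : Layout Y cs f o) {s : State} (h : TrivialInv Y c f o 0 s) :
    ((c = 0 ∨ Y.t = 1 ∧ 1 < cs) ∧ setCounter.run s = s.setReg 3 0) ∨
      (1 ≤ c ∧ ¬ (Y.t = 1 ∧ 1 < cs) ∧ Inv Y c f o (Y.nodes c * Y.sweep c) (setCounter.run s)) := by
  obtain ⟨h0, h1, h2, h3⟩ := h.ready.header hL
  have e1 : rounds.eval s = c := h.ready.rounds_eq
  have hcond : (eq rounds (lit 0) + eq threads (lit 1) * lt (lit 1) givenRounds).eval s ≠ 0 ↔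
      c = 0 ∨ Y.t = 1 ∧ 1 < cs := by
    rw [eval_or, eval_and, eval_eq, eval_eq, eval_lt, e1, h1, givenRounds, h2]
    rfl
  rw [setCounter, Cmd.run]
  split_ifs with hh
  · exact Or.inl ⟨hcond.1 hh, rfl⟩
  · rw [hcond] at hh
    have hc : 1 ≤ c := by omega
    refine Or.inr ⟨hc, fun e => hh (Or.inr e), ?_⟩
    have e : (Cmd.assign 3 (nodes * sweep)).run s = s.setReg 3 (Y.nodes c * Y.sweep c) := by
      rw [← h.ready.nodes_eval hL, ← (h.ready.sweep_eval hL).2]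
      rfl
    have h4 : s.reg 4 = 0 := by
      by_contra h4
      have := (h.answer.1 h4).1
      omega
    rw [e]
    refine ⟨h.ready.setReg (by omega), by simp, by simpa using h.r5, by simp [h4], fun a ha => ?_,
      le_rfl, fun d hd => ?_, fun h5 => ?_, fun z' h1 h2 => by omega, fun z' h1 h2 => by omega⟩
    · have := h.rest a ha
      simp only [State.setReg_mem]; omega
    · have := h.rest (2 * Y.len + d) (by have := Layout.t_add_le hL; omega)
      exact absurd this hd
    · simp [h4] at h5

/-! ### Composition of the loops to the whole program -/

theorem prog_run : ∃ C, ∀ (Y : Sys) (cs c B : ℕ) (f o : ℕ → ℕ) (s : State), Layout Y cs f o →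
    1 ≤ Y.m → c = effectiveRounds cs Y.m Y.len → Bits Y c f B → s.reg 0 = Y.len →
    (∀ x, 1 ≤ x → x < 6 → s.reg x = 0) → s.mem = f →
    ∃ s', Run prog s s' (C * B ^ 3 * (c + Y.t + Y.m + Y.nodes c * Y.sweep c + 1)) ∧
      (s'.reg 0 ≠ 0 ↔ c = 0 ∧ (∃ q, Y.Mi q ∧ Y.Mf q) ∨
        1 ≤ c ∧ ¬ (Y.t = 1 ∧ 1 < cs) ∧ Y.Reachable c) := by
  obtain ⟨C1, -, H1⟩ := setRounds.compile_spec
  obtain ⟨C2, H2⟩ := powBody.forLoop_spec 3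
  obtain ⟨C3, -, H3⟩ := setOffset.compile_spec
  obtain ⟨C4, H4⟩ := offsetBody.forLoop_spec 3
  obtain ⟨C5, -, H5⟩ := setTrivial.compile_spec
  obtain ⟨C6, H6⟩ := trivialBody.forLoop_spec 3
  obtain ⟨C7, -, H7⟩ := setCounter.compile_spec
  obtain ⟨C8, H8⟩ := body.forLoop_spec 3
  refine ⟨C1 + C2 + C3 + C4 + C5 + C6 + C7 + C8 + 3, ?_⟩
  intro Y cs c B f o s hL hm hc hb h0 hz hmem
  have hB := hb.one
  have hs : Bounded B s := by
    refine bounded_of ?_ ?_ ?_ ?_ ?_ ?_ fun a => ?_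
    · rw [h0]; exact hb.len
    · rw [hz 1 (by omega) (by omega)]; simp
    · rw [hz 2 (by omega) (by omega)]; simp
    · rw [hz 3 (by omega) (by omega)]; simp
    · rw [hz 4 (by omega) (by omega)]; simp
    · rw [hz 5 (by omega) (by omega)]; simp
    · rw [hmem]; exact hb.input a
  obtain ⟨s1, r1, m1, -⟩ := H1 s s B hB hs (Sim.refl s)
  have i1 := setRounds_run hL h0 hz hmem hc
  obtain ⟨s2, t2, r2, m2, i2⟩ := H2 B (PowInv Y c f) hB
    (fun j t h => ⟨h.r3, h.bounded hm hb⟩) (fun j t h => h.step hL) c s1 _ m1 i1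
  obtain ⟨s3, r3, m3, -⟩ := H3 s2 t2 B hB (i2.bounded hm hb) m2
  have i3 := setOffset_run hL i2
  obtain ⟨s4, t4, r4, m4, i4⟩ := H4 B (OffsetInv Y c f o) hB
    (fun j t h => ⟨h.r3, h.bounded hL hb⟩) (fun j t h => h.step hL) Y.t s3 _ m3 i3
  obtain ⟨s5, r5, m5, -⟩ := H5 s4 t4 B hB (i4.bounded hL hb) m4
  have i5 := setTrivial_run hL i4
  obtain ⟨s6, t6, r6, m6, i6⟩ := H6 B (TrivialInv Y c f o) hB
    (fun j t h => ⟨h.r3, h.bounded hL hb⟩) (fun j t h => h.step hL) Y.m s5 _ m5 i5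
  obtain ⟨s7, r7, m7, -⟩ := H7 s6 t6 B hB (i6.bounded hL hb) m6
  have hmain : ∃ s8 t8, Run (body.forLoop 3) s7 s8
      ((Y.nodes c * Y.sweep c + 1) * (C8 * B ^ 3)) ∧ Sim t8 s8 ∧ t8.reg 4 ≤ 1 ∧
      (t8.reg 4 ≠ 0 ↔ c = 0 ∧ (∃ q, Y.Mi q ∧ Y.Mf q) ∨
        1 ≤ c ∧ ¬ (Y.t = 1 ∧ 1 < cs) ∧ Y.Reachable c) := by
    rcases setCounter_run hL i6 with ⟨hcase, e⟩ | ⟨hc1, hnt, i7⟩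
    · rw [e] at m7
      have hbd : Bounded B (t6.setReg 3 0) := by
        have hb6 := i6.bounded hL hb
        refine ⟨fun x hx => ?_, hb6.2⟩
        rw [State.setReg_reg]
        split_ifs
        · simp
        · exact hb6.1 x hx
      -- With counter `0` the body never runs, so an invariant describing a single state suffices
      -- and its step is vacuous.
      obtain ⟨s8, t8, r8, m8, -, i8⟩ := H8 B (fun j t => j = 0 ∧ t = t6.setReg 3 0) hB
        (fun j t h => by rw [h.1, h.2]; exact ⟨by simp, hbd⟩)
        (fun j t h => absurd h.1 (by omega)) 0 s7 _ m7 ⟨rfl, rfl⟩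
      refine ⟨s8, t8, r8.mono (Nat.mul_le_mul_right _ (by omega)), m8, ?_, ?_⟩
      · rw [i8]; simpa using i6.r4
      · have := i6.answer
        rw [i8]
        simp only [State.setReg_reg, show ¬ 4 = 3 by omega, if_false, this, ge_iff_le,
          Nat.zero_le, true_and]
        constructor
        · exact Or.inl
        · rintro (h | ⟨h1, h2, -⟩)
          · exact h
          · exfalso
            rcases hcase with h3 | h3
            · omega
            · exact h2 h3
    · obtain ⟨s8, t8, r8, m8, i8⟩ := H8 B (Inv Y c f o) hB
        (fun j t h => ⟨h.counter, h.bounded hL hb⟩) (fun j t h => h.step hL hc1 hm) _ s7 _ m7 i7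
      refine ⟨s8, t8, r8, m8, i8.answer_le, ?_⟩
      rw [i8.answer hc1]
      constructor
      · exact fun h => Or.inr ⟨hc1, hnt, h⟩
      · rintro (⟨h, -⟩ | ⟨-, -, h⟩)
        · omega
        · exact h
  obtain ⟨s8, t8, r8, m8, hle, hiff⟩ := hmain
  have h84 : s8.reg 4 = t8.reg 4 := m8.2 4 (by omega)
  have r9 := Run.copy (s := s8) (x := 0) (y := 4) (V := 1)
    (by rw [h84]; exact size_le_one le_rfl hle)
  refine ⟨_, (r1.seq (r2.seq (r3.seq (r4.seq (r5.seq (r6.seq (r7.seq (r8.seq r9)))))))).mono ?_, ?_⟩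
  · have hB3 : 1 ≤ B ^ 3 := Nat.one_le_pow _ _ hB
    generalize B ^ 3 = b at *
    generalize Y.nodes c * Y.sweep c = Z
    have key : ∀ {n C : ℕ}, n ≤ c + Y.t + Y.m + Z → (n + 1) * (C * b) ≤
        C * b * (c + Y.t + Y.m + Z + 1) := fun {n C} hn => by
      rw [mul_comm]; exact Nat.mul_le_mul_left _ (by omega)
    have k2 := key (n := c) (C := C2) (by omega)
    have k4 := key (n := Y.t) (C := C4) (by omega)
    have k6 := key (n := Y.m) (C := C6) (by omega)
    have k8 := key (n := Z) (C := C8) (by omega)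
    have k1 := key (n := 0) (C := C1) (by omega)
    have k3 := key (n := 0) (C := C3) (by omega)
    have k5 := key (n := 0) (C := C5) (by omega)
    have k7 := key (n := 0) (C := C7) (by omega)
    have k9 := key (n := 0) (C := 3) (by omega)
    have hexp : (C1 + C2 + C3 + C4 + C5 + C6 + C7 + C8 + 3) * b * (c + Y.t + Y.m + Z + 1) =
        C1 * b * (c + Y.t + Y.m + Z + 1) + C2 * b * (c + Y.t + Y.m + Z + 1) +
        C3 * b * (c + Y.t + Y.m + Z + 1) + C4 * b * (c + Y.t + Y.m + Z + 1) +
        C5 * b * (c + Y.t + Y.m + Z + 1) + C6 * b * (c + Y.t + Y.m + Z + 1) +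
        C7 * b * (c + Y.t + Y.m + Z + 1) + C8 * b * (c + Y.t + Y.m + Z + 1) +
        3 * b * (c + Y.t + Y.m + Z + 1) := by ring
    omega
  · rw [State.setReg_reg, if_pos rfl, h84, hiff]

end Search

/-! ### Time bound and correctness of the answer -/

theorem length_le_inputSize (w : List ℕ) : w.length ≤ inputSize w := by
  induction w with
  | nil => simp
  | cons a w ih => simp only [inputSize, List.length_cons, List.map_cons, List.sum_cons] at *; omega

theorem size_getD_le_inputSize (w : List ℕ) (a : ℕ) : Nat.size (w.getD a 0) ≤ inputSize w := by
  rcases Nat.lt_or_ge a w.length with h | h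
  · rw [List.getD_eq_getElem _ _ h]
    have := List.single_le_sum (l := w.map fun a => Nat.size a + 1) (fun _ _ => Nat.zero_le _) _
      (List.mem_map_of_mem (List.getElem_mem h))
    exact (Nat.le_succ _).trans this
  · rw [List.getD_eq_default _ _ h]; simp

theorem Layout.ops_le {Y : Sys} {cs : ℕ} {f o : ℕ → ℕ} (hL : Layout Y cs f o) (hm : 1 ≤ Y.m) :
    Y.ops ≤ Y.len := by
  have h := hL.off_mono (Nat.zero_le Y.t) le_rfl
  rw [hL.off_last, hL.off_zero] at h
  have : Y.ops ≤ Y.m * Y.ops * Y.m := by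
    rw [mul_right_comm]; exact Nat.le_mul_of_pos_left _ (Nat.mul_pos hm hm)
  omega

namespace Search

variable {Y : Sys} {c cs : ℕ} {f o : ℕ → ℕ}

theorem effectiveRounds_le (cs m len : ℕ) : effectiveRounds cs m len ≤ cs := by
  unfold effectiveRounds; split_ifs <;> omega

/-- The number of iterations of the main loop. -/
theorem nodes_mul_sweep_le (hL : Layout Y cs f o) (hm : 1 ≤ Y.m) (c : ℕ) :
    Y.nodes c * Y.sweep c ≤ 2 * Y.len ^ 8 * c ^ 2 * (Y.m ^ c) ^ 3 := by
  have h1 := Layout.t_add_le hL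
  have hn : Y.nodes c ≤ Y.len * c * Y.m ^ c * Y.len := by unfold Sys.nodes; gcongr; omega
  have hch : Y.choices ≤ Y.len * Y.len * Y.len * 2 * Y.len := by
    unfold Sys.choices
    have := Layout.ops_le hL hm
    gcongr; omega
  calc Y.nodes c * Y.sweep c
      ≤ (Y.len * c * Y.m ^ c * Y.len) * (Y.m ^ c * (Y.len * c * Y.m ^ c * Y.len) *
          (Y.len * Y.len * Y.len * 2 * Y.len)) := by unfold Sys.sweep; gcongr
    _ = _ := by ring

/-- Since `cs` is an input cell, it has at most `s` bits, and so has `len`. Hence `m ^ c` is at most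
`2 ^ (s * c)`, and the number of iterations is at most `2 ^ (3 * (s * c) + 10 * s + 1)`. The factor
`12` covers all these lengths. -/
theorem bits {s : ℕ} (hL : Layout Y cs f o) (hm : 1 ≤ Y.m) (hc : c ≤ cs) (hlen : Y.len ≤ s)
    (hf : ∀ a, Nat.size (f a) ≤ s) : Bits Y c f (12 * ((s + 1) * (c + 1))) := by
  have hexp : (s + 1) * (c + 1) = s * c + s + c + 1 := by ring
  have hlt := Layout.t_add_le hL
  have hls : Nat.size Y.len ≤ s := by
    rw [Nat.size_le]; exact hlen.trans_lt Nat.lt_two_pow_self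
  have hcs : Nat.size c ≤ s := (Nat.size_le_size hc).trans (by rw [← hL.cs]; exact hf 2)
  have hl2 := (Nat.size_le.1 hls).le
  have hc2 := (Nat.size_le.1 hcs).le
  have hpow : Y.m ^ c ≤ 2 ^ (s * c) := by
    rw [pow_mul]; exact Nat.pow_le_pow_left (le_trans (by omega) hl2) c
  have hZ : Y.nodes c * Y.sweep c ≤ 2 ^ (3 * (s * c) + 10 * s + 1) :=
    calc Y.nodes c * Y.sweep c ≤ 2 * Y.len ^ 8 * c ^ 2 * (Y.m ^ c) ^ 3 := nodes_mul_sweep_le hL hm c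
      _ ≤ 2 * (2 ^ s) ^ 8 * (2 ^ s) ^ 2 * (2 ^ (s * c)) ^ 3 := by gcongr
      _ = _ := by ring
  refine ⟨by omega, fun a => (hf a).trans (by omega), hls.trans (by omega), hcs.trans (by omega),
    ?_, ?_⟩
  · refine (Nat.size_le.2 (hpow.trans_lt (Nat.pow_lt_pow_right one_lt_two
      (Nat.lt_succ_self _)))).trans (by omega)
  · refine (Nat.size_le.2 (hZ.trans_lt (Nat.pow_lt_pow_right one_lt_two
      (Nat.lt_succ_self _)))).trans (by omega)

/-- From `c = 7` on the left side grows by at most the factor `(9/8) ^ 5 < 2` per step; the smaller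
values are checked. -/
theorem succ_pow_five_le (c : ℕ) : (c + 1) ^ 5 ≤ 300 * 2 ^ c := by
  rcases Nat.lt_or_ge c 7 with h | h
  · interval_cases c <;> norm_num
  · induction c, h using Nat.le_induction with
    | base => norm_num
    | succ c hc ih =>
      have h1 : (8 * (c + 1 + 1)) ^ 5 ≤ (9 * (c + 1)) ^ 5 := Nat.pow_le_pow_left (by omega) 5
      rw [mul_pow, mul_pow] at h1
      rw [pow_succ 2 c]
      omega

/-- This is where the exponent `4 * cs` arises. The search costs `m ^ (3 * c)`, and the power `(c +
1) ^ 5`, which need not be polynomial in the input length, is paid by a further `m ^ c ≥ 2 ^ c`. For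
`m = 1` the truncation gives `c ≤ len ≤ s` instead. -/
theorem effectiveRounds_pow_le {cs m len s : ℕ} (hm : 1 ≤ m) (hlen : len ≤ s)
    (hc : c = effectiveRounds cs m len) :
    (c + 1) ^ 5 * (m ^ c) ^ 3 ≤ 300 * (s + 1) ^ 5 * m ^ (4 * cs) := by
  unfold effectiveRounds at hc
  split_ifs at hc with h1
  · subst h1
    have : (c + 1) ^ 5 ≤ (s + 1) ^ 5 := Nat.pow_le_pow_left (by omega) 5
    simp only [one_pow, mul_one]
    omega
  · subst hc
    calc (c + 1) ^ 5 * (m ^ c) ^ 3 ≤ (300 * 2 ^ c) * (m ^ c) ^ 3 := by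
          gcongr; exact succ_pow_five_le c
      _ ≤ (300 * m ^ c) * (m ^ c) ^ 3 := by gcongr; omega
      _ = 300 * 1 * m ^ (4 * c) := by ring
      _ ≤ 300 * (s + 1) ^ 5 * m ^ (4 * c) := by
          gcongr; exact Nat.one_le_pow _ _ (Nat.succ_pos s)

/-- The cube of the bit bound contributes `(s + 1) ^ 3 * (c + 1) ^ 3`, the iterations `(s + 1) ^ 8 *
(c + 1) ^ 2`, and the absorption of `(c + 1) ^ 5` another `(s + 1) ^ 5`; so `16 = 3 + 8 + 5` and
`1555200 = 12 ^ 3 * 3 * 300`. -/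
theorem time_le {s C : ℕ} (hL : Layout Y cs f o) (hm : 1 ≤ Y.m) (hlen : Y.len ≤ s)
    (hc : c = effectiveRounds cs Y.m Y.len) :
    C * (12 * ((s + 1) * (c + 1))) ^ 3 * (c + Y.t + Y.m + Y.nodes c * Y.sweep c + 1) ≤
      Y.m ^ (4 * cs) * (1555200 * C * (s + 1) ^ 16) := by
  have hlt := Layout.t_add_le hL
  have hP : 1 ≤ (Y.m ^ c) ^ 3 := Nat.one_le_pow _ _ (Nat.one_le_pow _ _ hm)
  have hsmall : c + Y.t + Y.m + 1 ≤ (s + 1) ^ 8 * (c + 1) ^ 2 * (Y.m ^ c) ^ 3 :=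
    calc c + Y.t + Y.m + 1 ≤ (s + 1) * (c + 1) * 1 := by
          have : (s + 1) * (c + 1) = s * c + s + c + 1 := by ring
          omega
      _ ≤ (s + 1) ^ 8 * (c + 1) ^ 2 * (Y.m ^ c) ^ 3 := by
          gcongr
          · exact Nat.le_self_pow (by omega) _
          · exact Nat.le_self_pow (by omega) _
  have hZ : Y.nodes c * Y.sweep c ≤ 2 * ((s + 1) ^ 8 * (c + 1) ^ 2 * (Y.m ^ c) ^ 3) :=
    calc Y.nodes c * Y.sweep c ≤ 2 * Y.len ^ 8 * c ^ 2 * (Y.m ^ c) ^ 3 := nodes_mul_sweep_le hL hm c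
      _ ≤ 2 * (s + 1) ^ 8 * (c + 1) ^ 2 * (Y.m ^ c) ^ 3 := by gcongr <;> omega
      _ = _ := by ring
  calc C * (12 * ((s + 1) * (c + 1))) ^ 3 * (c + Y.t + Y.m + Y.nodes c * Y.sweep c + 1)
      ≤ C * (12 * ((s + 1) * (c + 1))) ^ 3 * (3 * ((s + 1) ^ 8 * (c + 1) ^ 2 * (Y.m ^ c) ^ 3)) :=
        Nat.mul_le_mul_left _ (by omega)
    _ = 5184 * C * (s + 1) ^ 11 * ((c + 1) ^ 5 * (Y.m ^ c) ^ 3) := by ring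
    _ ≤ 5184 * C * (s + 1) ^ 11 * (300 * (s + 1) ^ 5 * Y.m ^ (4 * cs)) :=
        Nat.mul_le_mul_left _ (effectiveRounds_pow_le hm hlen hc)
    _ = _ := by ring

/-- The search runs with the truncated number of rounds; when truncation takes effect, both numbers
of rounds are at least `len`, so `change_rounds` translates certificates in both directions. -/
theorem reachable_iff_exists_cert (hlen : 1 ≤ Y.len) (hcs : 1 ≤ cs)
    (hc : c = effectiveRounds cs Y.m Y.len) :
    Y.Reachable c ↔ ∃ st th, Y.IsCert cs st th := by
  have hc1 : 1 ≤ c := by rw [hc]; unfold effectiveRounds; split_ifs <;> omega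
  have key : Y.Reachable c ↔ ∃ st th, Y.IsCert c st th :=
    ⟨fun h => h.exists_cert hc1, fun ⟨_, _, h⟩ => h.reachable hc1⟩
  rw [key]
  unfold effectiveRounds at hc
  split_ifs at hc with h1
  · rcases Nat.le_total cs Y.len with h2 | h2
    · rw [hc, min_eq_left h2]
    · rw [min_eq_right h2] at hc
      exact ⟨fun ⟨_, _, h⟩ => h.change_rounds h1 hlen hc.ge h2,
        fun ⟨_, _, h⟩ => h.change_rounds h1 hlen h2 hc.ge⟩
  · rw [hc]

theorem answer_iff (S : SMCP) (cs len : ℕ) (hlen : ∀ i, (S.A i).n ≤ len) (h1 : 1 ≤ len)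
    (hc : c = effectiveRounds cs S.M.n len) :
    (c = 0 ∧ (∃ q, (S.toSys len hlen).Mi q ∧ (S.toSys len hlen).Mf q) ∨
      1 ≤ c ∧ ¬ (S.t = 1 ∧ 1 < cs) ∧ (S.toSys len hlen).Reachable c) ↔ BCSLRR S cs := by
  rcases Nat.eq_zero_or_pos cs with rfl | hcs
  · obtain rfl : c = 0 := Nat.le_zero.1 (hc.le.trans (effectiveRounds_le _ _ _))
    rw [S.bcslRR_zero]
    constructor
    · rintro (⟨-, q, h2, h3⟩ | ⟨h2, -⟩)
      · exact Fin.ext (h2.symm.trans h3)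
      · omega
    · exact fun h => Or.inl ⟨rfl, _, rfl, congrArg Fin.val h⟩
  · have hc1 : 1 ≤ c := by rw [hc]; unfold effectiveRounds; split_ifs <;> omega
    rw [S.bcslRR_iff hcs hlen, ← reachable_iff_exists_cert (Y := S.toSys len hlen) h1 hcs hc]
    constructor
    · rintro (⟨h2, -⟩ | ⟨-, h2, h3⟩)
      · omega
      · exact ⟨fun ht => by omega, h3⟩
    · exact fun ⟨h2, h3⟩ => Or.inr ⟨hc1, fun h => by have := h2 h.1; omega, h3⟩

theorem decidesWithin : ∃ K, ∀ (S : SMCP) (cs : ℕ),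
    DecidesWithin prog (encodeInstance S cs) (BCSLRR S cs)
      (S.M.n ^ (4 * cs) * (K * (inputSize (encodeInstance S cs) + 1) ^ 16)) := by
  obtain ⟨C, hC⟩ := prog_run
  refine ⟨1555200 * C, fun S cs => ?_⟩
  have hm : 1 ≤ S.M.n := Fin.pos S.M.init
  have hL := S.layout cs
  have hls := length_le_inputSize (encodeInstance S cs)
  have ht := Layout.t_add_le hL
  obtain ⟨s', ⟨k, hk, hx⟩, hiff⟩ := hC _ cs _ _ _ _ (initState (encodeInstance S cs)) hL hm rfl
    (bits hL hm (effectiveRounds_le _ _ _) hls (size_getD_le_inputSize _)) rfl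
    (fun x h _ => if_neg (by omega)) rfl
  exact ⟨s', k, hx, hk.trans (time_le hL hm hls rfl), hiff.trans
    (answer_iff S cs _ _ ((by omega : 1 ≤ _).trans ht) rfl)⟩

end Search
end BCS

theorem mainTheorem7 :
    (∃ (prog : BCS.Prog) (p : Polynomial ℕ), ∀ (S : BCS.SMCP) (cs : ℕ),
      BCS.DecidesWithin prog (BCS.encodeInstance S cs) (BCS.BCSLRR S cs)
        (S.M.n ^ (4 * cs) * p.eval (BCS.inputSize (BCS.encodeInstance S cs)))) ∧
    (∀ (S : BCS.SMCP) (cs : ℕ), 1 ≤ cs →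
      (BCS.BCSLRR S cs ↔ BCS.BCSLFix S (BCS.MGraph.cycle S.t cs))) ∧
    (∀ t cs : ℕ, 2 ≤ t → 1 ≤ cs →
      ∃ π : List BCS.MGraph, (BCS.MGraph.cycle t cs).IsContraction π ∧
        BCS.MGraph.listDegree π = cs) := by
  refine ⟨?_, fun S cs h => BCS.bcslRR_iff_bcslFix S h, fun t cs ht _ => ?_⟩
  · obtain ⟨K, hK⟩ := BCS.Search.decidesWithin
    refine ⟨BCS.Search.prog, Polynomial.C K * (Polynomial.X + 1) ^ 16, fun S cs => ?_⟩
    simpa using hK S cs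
  · obtain ⟨t, rfl⟩ : ∃ n, t = n + 1 := ⟨t - 1, by omega⟩
    obtain ⟨π, h1, h2⟩ := (BCS.MGraph.isCycle_cycle ht).exists_contraction
    exact ⟨π, h1, by rw [h2, if_neg (by omega)]⟩
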